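/- Let $H$ be an infinite-dimensional separable complex Hilbert space with inner product $(\cdot,\cdot)$, and let $\alpha\in(0,\pi/2)$. Conventions. A (linear, not necessarily everywhere defined) operator $A$ in $H$ is accretive if $\operatorname{Re}(Au,u)\ge 0$ for all $u\in\operatorname{dom}A$; it is $m$-accretive if it is accretive and densely defined and $\operatorname{ran}(A-\lambda I)=H$ for some $\lambda\in\mathbb C$ with $\operatorname{Re}\lambda<0$; it is coercive if there is $a>0$ with $\operatorname{Re}(Au,u)\ge a\|u\|^2$ for all $u\in\operatorname{dom}A$; it is $m$-$\alpha$-sectorial if it is $m$-accretive and $|\operatorname{Im}(Au,u)|\le\tan\alpha\,\operatorname{Re}(Au,u)$ for all $u\in\operatorname{dom}A$. For an $m$-accretive operator $A$, $A^{1/2}$ is its unique $m$-accretive square root, $A^{*1/2}=(A^*)^{1/2}$, and, if $A$ is also coercive, $A^{-1/2}=(A^{1/2})^{-1}$. On $\operatorname{dom}A\cap\operatorname{dom}A^*$ we put $\operatorname{Re}A=\frac12(A+A^*)$ and $\operatorname{Im}A=\frac1{2i}(A-A^*)$. A family $\{A(\xi)\}_{\xi\in\mathbb C}$ of $m$-accretive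 operators is norm-resolvent continuous if for every $\xi_0\in\mathbb C$ and every $z$ in the resolvent set of $A(\xi_0)$, $z$ belongs to the resolvent set of $A(\xi)$ for all $\xi$ near $\xi_0$ and $(A(\xi)-zI)^{-1}\to(A(\xi_0)-zI)^{-1}$ in operator norm as $\xi\to\xi_0$. (1) There exists a family $\{S(\xi)\}_{\xi\in\mathbb C}$ of unbounded coercive $m$-$\alpha$-sectorial operators in $H$ such that - $\operatorname{dom}S(\xi)\cap\operatorname{dom}S(\xi)^*=\{0\}$ for every $\xi\in\mathbb C$; - $\operatorname{dom}S(\xi)^{1/2}\ne\operatorname{dom}S(\xi)^{*1/2}$ for every $\xi\in\mathbb C$; - the operator $\operatorname{Re}(S(\xi)^{-1/2})$ does not depend on $\xi$; - $\operatorname{ran}\operatorname{Im}(S(\xi)^{-1/2})\cap\operatorname{ran}\operatorname{Im}(S(\zeta)^{-1/2})=\{0\}$ whenever $\xi\ne\zeta$. (2) There exists a norm-resolvent continuous family $\{X(\xi)\}_{\xi\in\mathbb C}$ of unbounded coercive $m$-$\alpha$-sectorial operators in $H$ such that - $\operatorname{dom}X(\xi)\cap\operatorname{dom}X(\xi)^*=\{0\}$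 for every $\xi\in\mathbb C$; - $\operatorname{dom}X(\xi)^{1/2}=\operatorname{dom}X(\xi)^{*1/2}$ for every $\xi\in\mathbb C$, and this linear manifold does not depend on $\xi$; - $\operatorname{ran}\operatorname{Im}(X(\xi)^{-1/2})$ is dense in $H$ for every $\xi\in\mathbb C$; - for $\xi\ne\zeta$, $\operatorname{ran}\operatorname{Im}(X(\xi)^{-1/2})\cap\operatorname{ran}\operatorname{Im}(X(\zeta)^{-1/2})=\{0\}$, and the direct sum $\operatorname{ran}\operatorname{Im}(X(\xi)^{-1/2})\dotplus\operatorname{ran}\operatorname{Im}(X(\zeta)^{-1/2})$ is the same linear manifold for all pairs $\xi\ne\zeta$. -/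

import Mathlib

open Filter Topology

noncomputable section

/- Linear operators in a complex Hilbert space `H` are partially defined linear maps
`A : H →ₗ.[ℂ] H`.  The value at `u` of the quadratic form of `A`, which is `(A u, u)` for an inner
product linear in its first argument, reads `inner ℂ u (A u)` here. -/
namespace LinearPMap

variable {H : Type*} [NormedAddCommGroup H] [InnerProductSpace ℂ H]

/-- `A` is accretive: `Re (A u, u) ≥ 0` on the domain. -/
def IsAccretive (A : H →ₗ.[ℂ] H) : Prop :=
  ∀ u : A.domain, 0 ≤ (inner ℂ (u : H) (A u)).re

/-- `A` is `m`-accretive (maximal accretive): it is accretive and densely defined, and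
`ran (A - l I) = H` for some complex number `l` with `Re l < 0`. -/
def IsMAccretive (A : H →ₗ.[ℂ] H) : Prop :=
  A.IsAccretive ∧ Dense (A.domain : Set H) ∧
    ∃ l : ℂ, l.re < 0 ∧ ∀ y : H, ∃ u : A.domain, A u - l • (u : H) = y

/-- `A` is coercive: `Re (A u, u) ≥ a ‖u‖²` on the domain, for some `a > 0`. -/
def IsCoercive (A : H →ₗ.[ℂ] H) : Prop :=
  ∃ a : ℝ, 0 < a ∧ ∀ u : A.domain, a * ‖(u : H)‖ ^ 2 ≤ (inner ℂ (u : H) (A u)).re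

/-- `A` is `α`-sectorial (vertex `0`, semi-angle `α ∈ [0, π/2)`):
`|Im (A u, u)| ≤ tan α · Re (A u, u)` and `Re (A u, u) ≥ 0` on the domain, that is, the numerical
range lies in the sector `|arg z| ≤ α`. -/
def IsSectorial (α : ℝ) (A : H →ₗ.[ℂ] H) : Prop :=
  ∀ u : A.domain, 0 ≤ (inner ℂ (u : H) (A u)).re ∧
    |(inner ℂ (u : H) (A u)).im| ≤ Real.tan α * (inner ℂ (u : H) (A u)).re

/-- `A` is `m`-`α`-sectorial: it is `α`-sectorial and `m`-accretive. -/
def IsMSectorial (α : ℝ) (A : H →ₗ.[ℂ] H) : Prop :=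
  A.IsSectorial α ∧ A.IsMAccretive

/-- `A` is an unbounded operator: no estimate `‖A u‖ ≤ C ‖u‖` holds on the whole domain. -/
def IsUnbounded (A : H →ₗ.[ℂ] H) : Prop :=
  ¬ ∃ C : ℝ, ∀ u : A.domain, ‖A u‖ ≤ C * ‖(u : H)‖

/-- `B` is an `m`-accretive square root of `A`: it is `m`-accretive and `A = B²`, where
`B²` has its natural domain `{x ∈ dom B | B x ∈ dom B}`. -/
def IsMAccretiveSqrt (B A : H →ₗ.[ℂ] H) : Prop :=
  B.IsMAccretive ∧
    ∀ x z : H, (x, z) ∈ A.graph ↔ ∃ y : H, (x, y) ∈ B.graph ∧ (y, z) ∈ B.graph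

open Classical in
/-- The square root `A^{1/2}` of an `m`-accretive operator `A`: its `m`-accretive square root, which
exists and is unique.  (The value is irrelevant if there is no `m`-accretive square root.) -/
def msqrt (A : H →ₗ.[ℂ] H) : H →ₗ.[ℂ] H :=
  if h : ∃ B : H →ₗ.[ℂ] H, IsMAccretiveSqrt B A then h.choose else ⊥

/-- `A^{-1/2}`, the inverse operator of `A^{1/2}`. -/
def invSqrt (A : H →ₗ.[ℂ] H) : H →ₗ.[ℂ] H :=
  A.msqrt.inverse

/-- `Re A = (A + A*) / 2`, with domain `dom A ∩ dom A*`. -/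
def rePart [CompleteSpace H] (A : H →ₗ.[ℂ] H) : H →ₗ.[ℂ] H :=
  (1 / 2 : ℂ) • (A + A.adjoint)

/-- `Im A = (A - A*) / (2 i)`, with domain `dom A ∩ dom A*`. -/
def imPart [CompleteSpace H] (A : H →ₗ.[ℂ] H) : H →ₗ.[ℂ] H :=
  (1 / (2 * Complex.I) : ℂ) • (A - A.adjoint)

/-- The range of `A`, a linear manifold in `H`. -/
def ran (A : H →ₗ.[ℂ] H) : Submodule ℂ H :=
  LinearMap.range A.toFun

/-- `z` lies in the resolvent set of `A` and the bounded operator `R` is the resolvent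
`(A - z I)⁻¹`. -/
def IsResolvent (A : H →ₗ.[ℂ] H) (z : ℂ) (R : H →L[ℂ] H) : Prop :=
  (∀ y : H, ∃ u : A.domain, (u : H) = R y ∧ A u - z • (u : H) = y) ∧
    ∀ u : A.domain, R (A u - z • (u : H)) = u

/-- Norm-resolvent continuity of a family of operators with non-empty resolvent sets: every `z` in
the resolvent set of `X ξ₀` lies in the resolvent set of `X ξ` for all `ξ` close to `ξ₀`, and
`(X ξ - z I)⁻¹ → (X ξ₀ - z I)⁻¹` in operator norm as `ξ → ξ₀`. -/
def NormResolventContinuous (X : ℂ → (H →ₗ.[ℂ] H)) : Prop :=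
  ∀ ξ₀ : ℂ, (∃ (z : ℂ) (R₀ : H →L[ℂ] H), (X ξ₀).IsResolvent z R₀) ∧
    ∀ (z : ℂ) (R₀ : H →L[ℂ] H), (X ξ₀).IsResolvent z R₀ →
      ∀ ε : ℝ, 0 < ε → ∀ᶠ ξ in 𝓝 ξ₀, ∃ R : H →L[ℂ] H, (X ξ).IsResolvent z R ∧ ‖R - R₀‖ < ε

end LinearPMap

end

/-! Both families consist of operators `T⁻²`, where `T = Q + iK` is bounded, `Q` and `K` are
self-adjoint and `Q` is positive. If `T²` is `α`-sectorial, then `T⁻²` is coercive and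
`m`-`α`-sectorial and `T⁻¹` is its only `m`-accretive square root (`eq_of_accretive_of_sq_eq`).
Every requirement then concerns bounded operators: the domains of `T⁻²` and of its adjoint are `ran
T²` and `ran T*²`, those of the square roots are `ran T` and `ran T*`, and the real and imaginary
parts of the inverse root are `Q` and `K`. Sectoriality of `T²` follows from `2 |Re (Qu, Ku)| ≤ tan
α (‖Qu‖² - ‖Ku‖²)` (`isSectorialRoot_cart`).

Identify `H` with `H ⊕ H` and put `Q = A ⊕ A`, `K = [[K₀, M a], [M ā, 0]]`, `M a = A R (U + a) R A`,
with `a` in the unit disc. Here `R` is injective, `U` maps no nonzero vector of `ran R` into `ran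
R`, and `A`, `K₀` factor through `R²`. This property of `U` gives both disjointness statements. If
`M a x = M b y`, cancelling `A` and `R` puts `U R A (x - y)` in `ran R`, so `x = y`, and then `a ≠
b` forces `x = 0` (`W_disjoint`). If `T² x = T*² y`, cancelling `A` puts a vector `R (U + b) R A s`
in `ran R²`, and again `s = 0` (`T_sq_disjoint`). A suitable `U` has matrix entries decaying more
slowly than the weights of `R` and visiting each basis vector infinitely often (`treeOperator`).

When `K₀ = 0`, `K = Q Z` with `‖Z‖ < 1`, so `ran T = ran T* = ran Q`. The ranges of the `K a` add up
to a fixed manifold because `M a` is affine in `a`. This is the second family.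

For the first family, `K₀` must make `A + iK₀` arbitrarily small compared with `A - iK₀` on suitable
vectors. Equality of `ran T` and `ran T*` would then contradict the norm comparison of Douglas'
lemma (`range_T_ne`). Such a `K₀` is a direct sum of matrices built from `∑ sᵐ/m`, `s` a truncated
shift: by Hilbert's inequality the imaginary part of its form is at most `π/2`, while the real part
grows like the harmonic numbers. After normalization its numerical range is thin and comes close to
`1` (`exists_skewBlock`). -/

noncomputable section

/-! ### Inverses of bounded injective operators and their resolvents. -/

namespace ContinuousLinearMap

variable {H : Type*} [NormedAddCommGroup H] [InnerProductSpace ℂ H]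

/-- A bounded operator as an everywhere defined linear partial map. -/
def asPMap (B : H →L[ℂ] H) : H →ₗ.[ℂ] H := (B : H →ₗ[ℂ] H).toPMap ⊤

/-- The inverse of an injective bounded operator `B`, with domain `ran B`. -/
def invPMap (B : H →L[ℂ] H) : H →ₗ.[ℂ] H := B.asPMap.inverse

theorem mem_asPMap_graph {B : H →L[ℂ] H} {x y : H} : (x, y) ∈ B.asPMap.graph ↔ B x = y := by
  simp [asPMap, LinearPMap.mem_graph_iff]

theorem asPMap_ker {B : H →L[ℂ] H} (hB : Function.Injective B) :
    LinearMap.ker B.asPMap.toFun = ⊥ := by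
  rw [LinearMap.ker_eq_bot']
  rintro ⟨m, hm⟩ h
  have h' : B m = 0 := h
  have : m = 0 := hB (by simpa using h')
  simpa using this

theorem mem_invPMap_graph {B : H →L[ℂ] H} (hB : Function.Injective B) {x y : H} :
    (x, y) ∈ B.invPMap.graph ↔ B y = x := by
  rw [invPMap, LinearPMap.inverse_graph (asPMap_ker hB), Submodule.mem_map]
  constructor
  · rintro ⟨⟨a, b⟩, hab, h⟩
    rw [mem_asPMap_graph] at hab
    simp only [LinearEquiv.coe_coe, LinearEquiv.prodComm_apply, Prod.swap_prod_mk,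
      Prod.mk.injEq] at h
    rw [← h.1, ← h.2, hab]
  · intro h
    exact ⟨(y, x), mem_asPMap_graph.2 h, rfl⟩

theorem invPMap_domain (B : H →L[ℂ] H) : B.invPMap.domain = LinearMap.range B.toLinearMap := by
  rw [invPMap, LinearPMap.inverse_domain]
  ext x
  constructor
  · rintro ⟨y, rfl⟩; exact ⟨y, rfl⟩
  · rintro ⟨y, rfl⟩; exact ⟨⟨y, trivial⟩, rfl⟩

theorem mem_invPMap_domain {B : H →L[ℂ] H} {x : H} : x ∈ B.invPMap.domain ↔ ∃ y, B y = x := by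
  rw [invPMap_domain]; rfl

theorem apply_invPMap {B : H →L[ℂ] H} (hB : Function.Injective B) (x : B.invPMap.domain) :
    B (B.invPMap x) = x :=
  (mem_invPMap_graph hB).1 (B.invPMap.mem_graph x)

theorem exists_invPMap_eq {B : H →L[ℂ] H} (hB : Function.Injective B) (y : H) :
    ∃ u : B.invPMap.domain, (u : H) = B y ∧ B.invPMap u = y := by
  have h := (mem_invPMap_graph hB).2 (rfl : B y = B y)
  rw [LinearPMap.mem_graph_iff] at h
  exact h

theorem eq_invPMap_of_graph {B : H →L[ℂ] H} (hB : Function.Injective B) {A : H →ₗ.[ℂ] H}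
    (h : ∀ x y, (x, y) ∈ A.graph ↔ B y = x) : A = B.invPMap := by
  apply LinearPMap.eq_of_eq_graph
  ext ⟨x, y⟩
  rw [h, mem_invPMap_graph hB]

theorem invPMap_inverse {B : H →L[ℂ] H} (hB : Function.Injective B) :
    B.invPMap.inverse = B.asPMap := by
  have hk : LinearMap.ker B.invPMap.toFun = ⊥ := by
    rw [LinearMap.ker_eq_bot']
    intro m hm
    have h1 := apply_invPMap hB m
    have h2 : B.invPMap m = 0 := hm
    rw [h2, map_zero] at h1
    exact Subtype.ext h1.symm
  apply LinearPMap.eq_of_eq_graph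
  rw [LinearPMap.inverse_graph hk]
  ext ⟨x, y⟩
  rw [mem_asPMap_graph, Submodule.mem_map]
  constructor
  · rintro ⟨⟨a, b⟩, hab, h⟩
    rw [mem_invPMap_graph hB] at hab
    simp only [LinearEquiv.coe_coe, LinearEquiv.prodComm_apply, Prod.swap_prod_mk,
      Prod.mk.injEq] at h
    rw [← h.1, ← h.2, hab]
  · intro h
    exact ⟨(y, x), (mem_invPMap_graph hB).2 h, rfl⟩

/-- The underlying identity is `(G⁻¹ - z)⁻¹ = G (1 - zG)⁻¹`, which turns resolvents of the unbounded
inverse into inverses in the Banach algebra. -/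
theorem isResolvent_of_mul_eq_one {G W : H →L[ℂ] H} (hG : Function.Injective G) {z : ℂ}
    (h1 : (1 - z • G) * W = 1) (h2 : W * (1 - z • G) = 1) :
    G.invPMap.IsResolvent z (G * W) := by
  constructor
  · intro y
    obtain ⟨u, hu, hu'⟩ := exists_invPMap_eq hG (W y)
    refine ⟨u, hu, ?_⟩
    rw [hu', hu]
    have := DFunLike.congr_fun h1 y
    simpa using this
  · intro u
    obtain ⟨w, hw⟩ := mem_invPMap_domain.1 u.2
    have h3 : G.invPMap u = w := hG (by rw [apply_invPMap hG, hw])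
    rw [h3, ← hw]
    have := DFunLike.congr_fun h2 w
    change G (W (w - z • G w)) = G w
    exact congrArg G this

/-- Converse of the preceding lemma: from `R = G (1 - zG)⁻¹` one recovers `(1 - zG)⁻¹ = 1 + zR`. -/
theorem mul_eq_one_of_isResolvent {G R : H →L[ℂ] H} (hG : Function.Injective G) {z : ℂ}
    (h : G.invPMap.IsResolvent z R) :
    (1 - z • G) * (1 + z • R) = 1 ∧ (1 + z • R) * (1 - z • G) = 1 ∧ R = G * (1 + z • R) := by
  have h1 : ∀ y, G (y + z • R y) = R y := by
    intro y
    obtain ⟨u, hu, hu'⟩ := h.1 y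
    have : G.invPMap u = y + z • R y := by rw [← hu, ← hu', sub_add_cancel]
    rw [← this, apply_invPMap hG, hu]
  have h2 : ∀ w, R (w - z • G w) = G w := by
    intro w
    obtain ⟨u, hu, hu'⟩ := exists_invPMap_eq hG w
    have := h.2 u
    rwa [hu', hu] at this
  refine ⟨?_, ?_, ?_⟩
  · ext y
    have := h1 y
    change y + z • R y - z • G (y + z • R y) = y
    rw [this, add_sub_cancel_right]
  · ext w
    have := h2 w
    change w - z • G w + z • R (w - z • G w) = w
    rw [this, sub_add_cancel]
  · ext y
    simpa using (h1 y).symm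

variable [CompleteSpace H]

theorem asPMap_adjoint (B : H →L[ℂ] H) : B.asPMap.adjoint = (adjoint B).asPMap :=
  toPMap_adjoint_eq_adjoint_toPMap_of_dense B (by simp)

theorem dense_range_of_injective_adjoint {B : H →L[ℂ] H}
    (h : Function.Injective (adjoint B)) : Dense (Set.range B) := by
  have : Dense ((LinearMap.range B.toLinearMap : Submodule ℂ H) : Set H) := by
    rw [Submodule.dense_iff_topologicalClosure_eq_top,
      Submodule.topologicalClosure_eq_top_iff, Submodule.eq_bot_iff]
    intro x hx
    rw [Submodule.mem_orthogonal] at hx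
    apply h
    rw [map_zero]
    refine ext_inner_left ℂ fun v => ?_
    rw [adjoint_inner_right, inner_zero_right]
    exact hx _ ⟨v, rfl⟩
  exact this

theorem invPMap_adjoint {B : H →L[ℂ] H} (hB : Function.Injective B)
    (hB' : Function.Injective (adjoint B)) : B.invPMap.adjoint = (adjoint B).invPMap := by
  have hd : Dense (B.invPMap.domain : Set H) := by
    rw [invPMap_domain]; exact dense_range_of_injective_adjoint hB'
  apply eq_invPMap_of_graph hB'
  intro x y
  rw [LinearPMap.adjoint_graph_eq_graph_adjoint hd, Submodule.mem_adjoint_iff]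
  constructor
  · intro h
    refine ext_inner_left ℂ fun v => ?_
    have := h (B v) v ((mem_invPMap_graph hB).2 rfl)
    rw [adjoint_inner_right]
    linear_combination -this
  · rintro rfl a b hab
    rw [mem_invPMap_graph hB] at hab
    rw [← hab, adjoint_inner_right, sub_self]

theorem asPMap_rePart (B : H →L[ℂ] H) :
    B.asPMap.rePart = ((1 / 2 : ℂ) • (B + adjoint B)).asPMap := by
  rw [LinearPMap.rePart, asPMap_adjoint]
  apply LinearPMap.ext
  · simp [asPMap, LinearPMap.add_domain]
  · intro x h1 h2
    rfl

theorem mem_ran_asPMap_imPart {B : H →L[ℂ] H} {x : H} :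
    x ∈ B.asPMap.imPart.ran ↔ ∃ y, ((1 / (2 * Complex.I) : ℂ) • (B - adjoint B)) y = x := by
  rw [LinearPMap.imPart, asPMap_adjoint, LinearPMap.ran]
  constructor
  · rintro ⟨y, rfl⟩
    exact ⟨y, rfl⟩
  · rintro ⟨y, rfl⟩
    exact ⟨⟨y, ⟨trivial, trivial⟩⟩, rfl⟩

/-- Norm continuity of a family of bounded injective operators gives norm-resolvent continuity of
the family of their inverses. -/
theorem normResolventContinuous_invPMap {G : ℂ → (H →L[ℂ] H)}
    (hG : ∀ ξ, Function.Injective (G ξ)) (hc : Continuous G) :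
    LinearPMap.NormResolventContinuous fun ξ => (G ξ).invPMap := by
  intro ξ₀
  -- The point `0` always lies in the resolvent set, with resolvent `G ξ₀`.
  refine ⟨⟨0, G ξ₀ * 1, isResolvent_of_mul_eq_one (hG ξ₀) (by simp) (by simp)⟩, ?_⟩
  intro z R₀ hR₀ ε hε
  obtain ⟨h1, h2, h3⟩ := mul_eq_one_of_isResolvent (hG ξ₀) hR₀
  set u : (H →L[ℂ] H)ˣ := ⟨1 - z • G ξ₀, 1 + z • R₀, h1, h2⟩ with hu
  have hcont : Continuous fun ξ => 1 - z • G ξ := continuous_const.sub (hc.const_smul z)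
  -- Units form an open set, so invertibility of `1 - z G ξ` persists near `ξ₀`.
  have hev : ∀ᶠ ξ in 𝓝 ξ₀, IsUnit (1 - z • G ξ) :=
    hcont.continuousAt.eventually (Units.nhds u)
  have hinv : ContinuousAt (fun ξ => G ξ * Ring.inverse (1 - z • G ξ)) ξ₀ := by
    refine hc.continuousAt.mul ?_
    exact ContinuousAt.comp (f := fun ξ => 1 - z • G ξ) (g := Ring.inverse)
      (NormedRing.inverse_continuousAt u) hcont.continuousAt
  have hval : G ξ₀ * Ring.inverse (1 - z • G ξ₀) = R₀ := by
    have : Ring.inverse (1 - z • G ξ₀) = 1 + z • R₀ := Ring.inverse_unit u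
    rw [this, ← h3]
  have hd := Metric.tendsto_nhds.1 hinv.tendsto ε hε
  filter_upwards [hev, hd] with ξ h4 h5
  refine ⟨G ξ * Ring.inverse (1 - z • G ξ), ?_, ?_⟩
  · exact isResolvent_of_mul_eq_one (hG ξ) (Ring.mul_inverse_cancel _ h4)
      (Ring.inverse_mul_cancel _ h4)
  · rwa [hval, dist_eq_norm] at h5

end ContinuousLinearMap

end

/-! ### Square roots of bounded sectorial operators: existence by iteration, uniqueness among
accretive maps. -/

noncomputable section

section SquareRootIteration

variable {𝔸 : Type*} [NormedRing 𝔸] [NormedAlgebra ℂ 𝔸]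

/-- The iteration `Yₙ₊₁ = (N + Yₙ²) / 2`, whose limit `Y` satisfies `(1 - Y)² = 1 - N`. -/
def sqrtIter (N : 𝔸) : ℕ → 𝔸
  | 0 => 0
  | n + 1 => (1 / 2 : ℂ) • (N + sqrtIter N n * sqrtIter N n)

/-- The scalar majorant of `sqrtIter`. -/
def sqrtIterBound : ℕ → ℝ
  | 0 => 0
  | n + 1 => (1 + sqrtIterBound n ^ 2) / 2

theorem sqrtIterBound_mem (n : ℕ) : 0 ≤ sqrtIterBound n ∧ sqrtIterBound n ≤ 1 := by
  induction n with
  | zero => simp [sqrtIterBound]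
  | succ n ih =>
    simp only [sqrtIterBound]
    constructor <;> nlinarith

theorem norm_half_smul (x : 𝔸) : ‖(1 / 2 : ℂ) • x‖ = ‖x‖ / 2 := by
  rw [norm_smul]; norm_num; ring

theorem norm_sqrtIter_le {N : 𝔸} (hN : ‖N‖ ≤ 1) (n : ℕ) :
    ‖sqrtIter N n‖ ≤ sqrtIterBound n := by
  induction n with
  | zero => simp [sqrtIter, sqrtIterBound]
  | succ n ih =>
    simp only [sqrtIter, sqrtIterBound, norm_half_smul]
    have h1 := norm_add_le N (sqrtIter N n * sqrtIter N n)
    have h2 := norm_mul_le (sqrtIter N n) (sqrtIter N n)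
    have h3 := norm_nonneg (sqrtIter N n)
    nlinarith

theorem commute_sqrtIter {N R : 𝔸} (h : Commute R N) (n : ℕ) : Commute R (sqrtIter N n) := by
  induction n with
  | zero => exact Commute.zero_right R
  | succ n ih => exact (h.add_right (ih.mul_right ih)).smul_right _

/-- Consecutive iterates commute, so the difference of their squares factors as `(A - B)(A + B)`;
the scalar recursion factors in the same way and dominates term by term. -/
theorem norm_sqrtIter_sub_le {N : 𝔸} (hN : ‖N‖ ≤ 1) (n : ℕ) :
    ‖sqrtIter N (n + 1) - sqrtIter N n‖ ≤ sqrtIterBound (n + 1) - sqrtIterBound n := by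
  induction n with
  | zero =>
    simp only [sqrtIter, sqrtIterBound, mul_zero, add_zero, sub_zero, norm_half_smul]
    linarith
  | succ n ih =>
    set A := sqrtIter N (n + 1) with hA
    set B := sqrtIter N n with hB
    have hc : Commute A B := by
      have h1 : Commute N B := commute_sqrtIter (Commute.refl N) n
      exact (commute_sqrtIter h1.symm (n + 1)).symm
    have h1 : sqrtIter N (n + 1 + 1) - A = (1 / 2 : ℂ) • ((A - B) * (A + B)) := by
      have h2 : sqrtIter N (n + 1 + 1) = (1 / 2 : ℂ) • (N + A * A) := rfl
      have h3 : A = (1 / 2 : ℂ) • (N + B * B) := rfl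
      have h4 : (1 / 2 : ℂ) • (N + A * A) - A =
          (1 / 2 : ℂ) • (N + A * A) - (1 / 2 : ℂ) • (N + B * B) := by rw [← h3]
      rw [h2, h4, ← smul_sub]
      congr 1
      rw [sub_mul, mul_add, mul_add, hc.eq]
      abel
    rw [h1, norm_half_smul]
    have hA' := norm_sqrtIter_le hN (n + 1)
    have hB' := norm_sqrtIter_le hN n
    have h4 := norm_mul_le (A - B) (A + B)
    have h5 := norm_add_le A B
    have h6 := norm_nonneg (A - B)
    have h7 := norm_nonneg (A + B)
    have h8 : ‖A - B‖ * ‖A + B‖ ≤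
        (sqrtIterBound (n + 1) - sqrtIterBound n) * (sqrtIterBound (n + 1) + sqrtIterBound n) :=
      mul_le_mul ih (by rw [← hA, ← hB] at *; linarith) h7 (h6.trans ih)
    have h9 : sqrtIterBound (n + 1 + 1) = (1 + sqrtIterBound (n + 1) ^ 2) / 2 := rfl
    have h10 : sqrtIterBound (n + 1) = (1 + sqrtIterBound n ^ 2) / 2 := rfl
    rw [h9]
    nlinarith

/-- An element `1 - N` with `‖N‖ ≤ 1` of a Banach algebra has a square root `1 - Y` with
`‖Y‖ ≤ 1` that commutes with everything `N` commutes with. -/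
theorem exists_sqrt_one_sub [CompleteSpace 𝔸] {N : 𝔸} (hN : ‖N‖ ≤ 1) :
    ∃ Y : 𝔸, ‖Y‖ ≤ 1 ∧ (1 - Y) * (1 - Y) = 1 - N ∧ ∀ R : 𝔸, Commute R N → Commute R Y := by
  -- The majorants telescope and stay below `1`, so no strict inequality `‖N‖ < 1` is needed.
  have hs : Summable fun n => sqrtIterBound (n + 1) - sqrtIterBound n := by
    refine summable_of_sum_range_le (c := 1) (fun n => ?_) (fun n => ?_)
    · exact (norm_nonneg _).trans (norm_sqrtIter_sub_le hN n)
    · rw [Finset.sum_range_sub]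
      have h1 := (sqrtIterBound_mem n).2
      have h2 : sqrtIterBound 0 = 0 := rfl
      linarith
  have hc : CauchySeq (sqrtIter N) := by
    refine cauchySeq_of_dist_le_of_summable _ (fun n => ?_) hs
    rw [dist_comm, dist_eq_norm]
    exact norm_sqrtIter_sub_le hN n
  obtain ⟨Y, hY⟩ := cauchySeq_tendsto_of_complete hc
  refine ⟨Y, ?_, ?_, ?_⟩
  · refine le_of_tendsto hY.norm (Eventually.of_forall fun n => ?_)
    exact (norm_sqrtIter_le hN n).trans (sqrtIterBound_mem n).2
  · have h1 : Tendsto (fun n => sqrtIter N (n + 1)) atTop (𝓝 ((1 / 2 : ℂ) • (N + Y * Y))) :=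
      ((hY.mul hY).const_add N).const_smul (1 / 2 : ℂ)
    have h2 := tendsto_nhds_unique h1 ((tendsto_add_atTop_iff_nat 1).2 hY)
    have h3 : N + Y * Y = Y + Y := by
      have h4 := congrArg (fun x => (2 : ℂ) • x) h2
      simp only [smul_smul] at h4
      norm_num at h4
      rw [h4, two_smul]
    rw [sub_mul, one_mul, mul_sub, mul_one]
    have h4 : Y * Y = Y + Y - N := by rw [← h3]; abel
    rw [h4]; abel
  · intro R hR
    have h1 : Tendsto (fun n => R * sqrtIter N n) atTop (𝓝 (R * Y)) := hY.const_mul R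
    have h2 : Tendsto (fun n => sqrtIter N n * R) atTop (𝓝 (Y * R)) := hY.mul_const R
    refine tendsto_nhds_unique h1 (h2.congr fun n => ?_)
    exact (commute_sqrtIter hR n).eq.symm

end SquareRootIteration

namespace ContinuousLinearMap

variable {H : Type*} [NormedAddCommGroup H] [InnerProductSpace ℂ H]

/-- A bounded sectorial operator satisfies `‖G u‖² ≤ C Re (G u, u)`. -/
theorem exists_norm_sq_le_of_sectorial {G : H →L[ℂ] H} {τ : ℝ} (hτ : 0 < τ)
    (hG : ∀ u, |(inner ℂ u (G u)).im| ≤ τ * (inner ℂ u (G u)).re) :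
    ∃ C : ℝ, 0 < C ∧ ∀ u, ‖G u‖ ^ 2 ≤ C * (inner ℂ u (G u)).re := by
  -- Chosen so that the second-order term `(1 + 3τ) s² d` below is absorbed by half of `2s ‖v‖²`.
  set s : ℝ := 1 / ((1 + 3 * τ) * (‖G‖ + 1)) with hs
  have hG0 := norm_nonneg G
  have hs0 : 0 < s := by positivity
  have hs1 : s * ((1 + 3 * τ) * (‖G‖ + 1)) = 1 := by rw [hs]; field_simp
  refine ⟨(1 + 3 * τ) / s, by positivity, fun u => ?_⟩
  have hq : ∀ v, 0 ≤ (inner ℂ v (G v)).re := fun v => by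
    have := (abs_nonneg _).trans (hG v)
    exact nonneg_of_mul_nonneg_right this hτ
  set v := G u with hv
  have e1 : inner ℂ (u - (s : ℂ) • v) (G (u - (s : ℂ) • v)) =
      inner ℂ u (G u) - s * inner ℂ u (G v) - s * inner ℂ v (G u) + s * s * inner ℂ v (G v) := by
    simp only [map_sub, map_smul, inner_sub_left, inner_sub_right, inner_smul_left,
      inner_smul_right, Complex.conj_ofReal]
    ring
  have e2 : inner ℂ (u + (s * Complex.I : ℂ) • v) (G (u + (s * Complex.I : ℂ) • v)) =
      inner ℂ u (G u) + s * Complex.I * inner ℂ u (G v) - s * Complex.I * inner ℂ v (G u)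
        + s * s * inner ℂ v (G v) := by
    simp only [map_add, map_smul, inner_add_left, inner_add_right, inner_smul_left,
      inner_smul_right, map_mul, Complex.conj_ofReal, Complex.conj_I]
    linear_combination -(s : ℂ) * s * inner ℂ v (G v) * Complex.I_sq
  have e3 : inner ℂ (u - (s * Complex.I : ℂ) • v) (G (u - (s * Complex.I : ℂ) • v)) =
      inner ℂ u (G u) - s * Complex.I * inner ℂ u (G v) + s * Complex.I * inner ℂ v (G u)
        + s * s * inner ℂ v (G v) := by
    simp only [map_sub, map_smul, inner_sub_left, inner_sub_right, inner_smul_left,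
      inner_smul_right, map_mul, Complex.conj_ofReal, Complex.conj_I]
    linear_combination -(s : ℂ) * s * inner ℂ v (G v) * Complex.I_sq
  have h1 := hq (u - (s : ℂ) • v)
  have h2 := hG (u - (s * Complex.I : ℂ) • v)
  have h3 := hq (u + (s * Complex.I : ℂ) • v)
  rw [e1] at h1
  rw [e3] at h2
  rw [e2] at h3
  have h4 : (inner ℂ v (G u)).re = ‖v‖ ^ 2 := by
    rw [← hv, ← inner_self_eq_norm_sq (𝕜 := ℂ)]; rfl
  have h5 : (inner ℂ v (G v)).re ≤ ‖G‖ * ‖v‖ ^ 2 := by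
    have h6 := Complex.re_le_norm (inner ℂ v (G v))
    have h7 := norm_inner_le_norm (𝕜 := ℂ) v (G v)
    have h8 := G.le_opNorm v
    have h9 := norm_nonneg v
    nlinarith
  have h6 := abs_le.1 (hG u)
  have h7 := abs_le.1 (hG v)
  have h2' := (abs_le.1 h2).2
  simp only [Complex.add_re, Complex.sub_re, Complex.mul_re, Complex.add_im, Complex.sub_im,
    Complex.mul_im, Complex.ofReal_re, Complex.ofReal_im, Complex.I_re, Complex.I_im] at h1 h2' h3
  ring_nf at h1 h2' h3
  rw [div_mul_eq_mul_div, le_div_iff₀ hs0]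
  set q := (inner ℂ u (G u)).re
  set d := (inner ℂ v (G v)).re
  -- Positivity at `u - sv` bounds `s(Re (u, Gv) + ‖v‖²)`, and sectoriality at `u - isv` bounds
  -- `s(‖v‖² - Re (u, Gv))`; positivity at `u + isv` controls the real part occurring in the latter.
  -- Adding removes `Re (u, Gv)`.
  have h8 : 2 * s * ‖v‖ ^ 2 ≤ (1 + 3 * τ) * (q + s ^ 2 * d) := by
    rw [← h4]
    nlinarith [mul_nonneg hτ.le h3, mul_le_mul_of_nonneg_left h7.1 (sq_nonneg s),
      mul_le_mul_of_nonneg_left h7.2 (sq_nonneg s)]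
  have h9 : (1 + 3 * τ) * (s ^ 2 * d) ≤ s * ‖v‖ ^ 2 := by
    have h10 : (1 + 3 * τ) * (s ^ 2 * d) ≤ (1 + 3 * τ) * (s ^ 2 * ((‖G‖ + 1) * ‖v‖ ^ 2)) := by
      have : d ≤ (‖G‖ + 1) * ‖v‖ ^ 2 := by nlinarith [sq_nonneg ‖v‖]
      gcongr
    calc _ ≤ _ := h10
      _ = (s * ((1 + 3 * τ) * (‖G‖ + 1))) * (s * ‖v‖ ^ 2) := by ring
      _ = _ := by rw [hs1, one_mul]
  linarith

/-- With `c = 1/C`, expanding `‖u - cGu‖²` leaves `‖u‖² - 2c Re (Gu, u) + c²‖Gu‖²`, and the last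
term is at most `c Re (Gu, u)`. -/
theorem exists_norm_one_sub_smul_le {G : H →L[ℂ] H} {C : ℝ} (hC : 0 < C)
    (hG : ∀ u, ‖G u‖ ^ 2 ≤ C * (inner ℂ u (G u)).re) :
    ∃ c : ℝ, 0 < c ∧ ‖1 - (c : ℂ) • G‖ ≤ 1 := by
  refine ⟨C⁻¹, by positivity, opNorm_le_bound _ zero_le_one fun u => ?_⟩
  rw [one_mul]
  refine le_of_sq_le_sq ?_ (norm_nonneg u)
  change ‖u - ((C⁻¹ : ℝ) : ℂ) • G u‖ ^ 2 ≤ _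
  rw [norm_sub_sq (𝕜 := ℂ), inner_smul_right, norm_smul, Complex.norm_real, mul_pow]
  have h1 := hG u
  have h2 : RCLike.re (((C⁻¹ : ℝ) : ℂ) * inner ℂ u (G u)) = C⁻¹ * (inner ℂ u (G u)).re := by
    simp
  rw [h2, Real.norm_eq_abs, sq_abs]
  have h3 : C⁻¹ ^ 2 * ‖G u‖ ^ 2 ≤ C⁻¹ ^ 2 * (C * (inner ℂ u (G u)).re) := by gcongr
  have h4 : C⁻¹ ^ 2 * (C * (inner ℂ u (G u)).re) = C⁻¹ * (inner ℂ u (G u)).re := by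
    field_simp
  have h5 : 0 ≤ C⁻¹ * (inner ℂ u (G u)).re := by rw [← h4]; exact le_trans (by positivity) h3
  linarith

/-- An everywhere defined accretive linear map is bounded. -/
theorem continuous_of_accretive [CompleteSpace H] (R : H →ₗ[ℂ] H)
    (hR : ∀ w, 0 ≤ (inner ℂ w (R w)).re) : Continuous R := by
  refine R.continuous_of_seq_closed_graph fun w x y hw hRw => ?_
  set z := y - R x with hz
  have hw' : Tendsto (fun n => w n - x) atTop (𝓝 0) := by simpa using hw.sub_const x
  have hRw' : Tendsto (fun n => R (w n - x)) atTop (𝓝 z) := by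
    simpa [map_sub] using hRw.sub_const (R x)
  -- Minty's argument: accretivity at `w n - x + h` passes to the limit. Replacing `h` by `t h` with
  -- `t → 0` then gives `Re (h, z) ≥ 0` for every `h`, and `h = -z` forces `z = 0`.
  have key : ∀ h : H, 0 ≤ (inner ℂ h (z + R h)).re := by
    intro h
    have h1 : Tendsto (fun n => (inner ℂ (w n - x + h) (R (w n - x) + R h)).re) atTop
        (𝓝 (inner ℂ (0 + h) (z + R h)).re) :=
      (Complex.continuous_re.tendsto _).comp
        ((hw'.add_const h).inner (𝕜 := ℂ) (hRw'.add_const (R h)))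
    rw [zero_add] at h1
    refine ge_of_tendsto h1 (Eventually.of_forall fun n => ?_)
    have := hR (w n - x + h)
    rwa [map_add] at this
  have key2 : ∀ h : H, ∀ t : ℝ, 0 < t → 0 ≤ (inner ℂ h z).re + t * (inner ℂ h (R h)).re := by
    intro h t ht
    have h1 := key ((t : ℂ) • h)
    rw [map_smul, inner_smul_left, inner_add_right, inner_smul_right, Complex.conj_ofReal,
      Complex.re_ofReal_mul, Complex.add_re, Complex.re_ofReal_mul] at h1
    exact nonneg_of_mul_nonneg_right h1 ht
  have key3 : 0 ≤ (inner ℂ (-z) z).re := by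
    have h1 : Tendsto (fun t : ℝ => (inner ℂ (-z) z).re + t * (inner ℂ (-z) (R (-z))).re)
        (𝓝[>] 0) (𝓝 ((inner ℂ (-z) z).re + 0 * (inner ℂ (-z) (R (-z))).re)) := by
      refine Tendsto.mono_left ?_ nhdsWithin_le_nhds
      exact (Continuous.tendsto (by fun_prop) 0)
    rw [zero_mul, add_zero] at h1
    refine ge_of_tendsto h1 ?_
    filter_upwards [self_mem_nhdsWithin] with t ht
    exact key2 (-z) t ht
  have h2 : (inner ℂ z z).re = ‖z‖ ^ 2 := by
    rw [← inner_self_eq_norm_sq (𝕜 := ℂ)]; rfl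
  rw [inner_neg_left, Complex.neg_re, h2] at key3
  have h3 : z = 0 := by
    have : ‖z‖ ^ 2 = 0 := le_antisymm (by linarith) (sq_nonneg _)
    simpa using this
  exact sub_eq_zero.1 h3

/-- A strictly accretive bounded operator is the only everywhere defined accretive square root of
its square, if its square is sectorial. -/
theorem eq_of_accretive_of_sq_eq [CompleteSpace H] {T : H →L[ℂ] H} {τ : ℝ} (hτ : 0 < τ)
    (hG : ∀ u, |(inner ℂ u (T (T u))).im| ≤ τ * (inner ℂ u (T (T u))).re)
    (hT : ∀ u, u ≠ 0 → 0 < (inner ℂ u (T u)).re) (R : H →ₗ[ℂ] H)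
    (hR : ∀ w, 0 ≤ (inner ℂ w (R w)).re) (hRT : ∀ w, R (R w) = T (T w)) (w : H) : R w = T w := by
  obtain ⟨C, hC, hGC⟩ := exists_norm_sq_le_of_sectorial (G := T * T) hτ hG
  obtain ⟨c, hc, hN⟩ := exists_norm_one_sub_smul_le hC hGC
  obtain ⟨Y, hY, hYN, hYc⟩ := exists_sqrt_one_sub hN
  set P : H →L[ℂ] H := (1 - Y) with hP
  have hPacc : ∀ u, 0 ≤ (inner ℂ u (P u)).re := by
    intro u
    change 0 ≤ (inner ℂ u (u - Y u)).re
    rw [inner_sub_right, Complex.sub_re]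
    have h1 : (inner ℂ u u).re = ‖u‖ ^ 2 := by
      rw [← inner_self_eq_norm_sq (𝕜 := ℂ)]; rfl
    have h2 := Complex.re_le_norm (inner ℂ u (Y u))
    have h3 := norm_inner_le_norm (𝕜 := ℂ) u (Y u)
    have h4 := Y.le_opNorm u
    have h5 := norm_nonneg u
    rw [h1]
    nlinarith
  -- Strict accretivity of `T` makes `sT + A` injective for accretive `A`. It is used twice to
  -- cancel the factor `X + Y` in `(X + Y)(X - Y) = 0` for commuting `X`, `Y` with equal squares.
  have hsum : ∀ (A : H →L[ℂ] H) (s : ℝ), 0 < s → (∀ u, 0 ≤ (inner ℂ u (A u)).re) → ∀ x : H,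
      (s : ℂ) • T x + A x = 0 → x = 0 := by
    intro A s hs hA x hx
    by_contra hne
    have h1 := congrArg (fun y => (inner ℂ x y).re) hx
    simp only [inner_add_right, inner_smul_right, inner_zero_right, Complex.zero_re,
      Complex.add_re, Complex.re_ofReal_mul] at h1
    have h2 := mul_pos hs (hT x hne)
    have h3 := hA x
    linarith
  set r : ℝ := Real.sqrt c with hr
  have hr0 : 0 < r := Real.sqrt_pos.2 hc
  have hrc : (r : ℂ) * r = c := by rw [← Complex.ofReal_mul, Real.mul_self_sqrt hc.le]
  have hPP : P * P = (c : ℂ) • (T * T) := by rw [hP, hYN]; abel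
  have hcomm : ∀ A : H →L[ℂ] H, Commute A (T * T) → Commute A P := by
    intro A hA
    have h1 : Commute A (1 - (c : ℂ) • (T * T)) :=
      (Commute.one_right A).sub_right (hA.smul_right _)
    exact (Commute.one_right A).sub_right (hYc A h1)
  -- The constructed root `P` of `cT²` commutes with `T`, hence equals `√c T`. Whatever commutes
  -- with `T²` therefore commutes with `T`.
  have hTP : ∀ x, (r : ℂ) • T x = P x := by
    intro x
    have h1 : Commute T P := hcomm T ((Commute.refl T).mul_right (Commute.refl T))
    have h2 : T (P x) = P (T x) := DFunLike.congr_fun h1.eq x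
    have h3 : P (P x) = (c : ℂ) • T (T x) := DFunLike.congr_fun hPP x
    refine sub_eq_zero.1 (hsum P r hr0 hPacc _ ?_)
    rw [map_sub, map_sub, map_smul, map_smul, h2, h3, smul_sub, smul_smul, hrc]
    abel
  set R' : H →L[ℂ] H := ⟨R, continuous_of_accretive R hR⟩ with hR'
  have h1 : Commute R' P := by
    refine hcomm R' ?_
    ext x
    change R (T (T x)) = T (T (R x))
    rw [← hRT, ← hRT]
  have h2 : R (T w) = T (R w) := by
    have h3 : R' (P w) = P (R' w) := DFunLike.congr_fun h1.eq w
    rw [← hTP, ← hTP, map_smul] at h3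
    exact smul_right_injective H (by exact_mod_cast hr0.ne') h3
  refine sub_eq_zero.1 (hsum R' 1 one_pos hR _ ?_)
  change ((1 : ℝ) : ℂ) • T (R w - T w) + R (R w - T w) = 0
  rw [map_sub, map_sub, h2, hRT, Complex.ofReal_one, one_smul]
  abel

end ContinuousLinearMap

end

/-! ### From a bounded `T` with sectorial square to the operator `T⁻²` and its root. -/

noncomputable section

namespace ContinuousLinearMap

variable {H : Type*} [NormedAddCommGroup H] [InnerProductSpace ℂ H]

/-- A bounded, strictly accretive operator with `α`-sectorial square. -/
structure IsSectorialRoot (α : ℝ) (T : H →L[ℂ] H) : Prop where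
  sectorial_sq : ∀ u, |(inner ℂ u (T (T u))).im| ≤ Real.tan α * (inner ℂ u (T (T u))).re
  strictly_accretive : ∀ u, u ≠ 0 → 0 < (inner ℂ u (T u)).re

theorem re_inner_self_eq (u : H) : (inner ℂ u u).re = ‖u‖ ^ 2 := by
  rw [← inner_self_eq_norm_sq (𝕜 := ℂ)]; rfl

namespace IsSectorialRoot

variable {α : ℝ} {T : H →L[ℂ] H}

theorem accretive (hT : T.IsSectorialRoot α) (u : H) : 0 ≤ (inner ℂ u (T u)).re := by
  by_cases hu : u = 0
  · simp [hu]
  · exact (hT.strictly_accretive u hu).le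

theorem injective (hT : T.IsSectorialRoot α) : Function.Injective T := by
  rw [injective_iff_map_eq_zero]
  intro x hx
  by_contra hne
  have := hT.strictly_accretive x hne
  rw [hx, inner_zero_right] at this
  simp at this

theorem injective_sq (hT : T.IsSectorialRoot α) : Function.Injective (T * T) :=
  hT.injective.comp hT.injective

theorem re_sq_nonneg (hα : 0 < Real.tan α) (hT : T.IsSectorialRoot α) (u : H) :
    0 ≤ (inner ℂ u (T (T u))).re :=
  nonneg_of_mul_nonneg_right ((abs_nonneg _).trans (hT.sectorial_sq u)) hα

/-- For `w = T⁻²u` the bound `‖T²w‖² ≤ C Re (T²w, w)` is coercivity at `u = T²w`. -/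
theorem isCoercive (hα : 0 < Real.tan α) (hT : T.IsSectorialRoot α) :
    (T * T).invPMap.IsCoercive := by
  obtain ⟨C, hC, hGC⟩ := exists_norm_sq_le_of_sectorial (G := T * T) hα hT.sectorial_sq
  refine ⟨C⁻¹, by positivity, fun u => ?_⟩
  have h := hGC ((T * T).invPMap u)
  rw [apply_invPMap hT.injective_sq, ← inner_conj_symm, Complex.conj_re] at h
  rw [inv_mul_le_iff₀ hC]
  exact h

/-- Approximate null vectors of `T` are approximate null vectors of `T²`, on whose images the
inverse has no norm bound. -/
theorem isUnbounded (hT : T.IsSectorialRoot α)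
    (hinf : ∀ ε : ℝ, 0 < ε → ∃ w, w ≠ 0 ∧ ‖T w‖ ≤ ε * ‖w‖) : (T * T).invPMap.IsUnbounded := by
  rintro ⟨C, hC⟩
  obtain ⟨w, hw, hTw⟩ := hinf (1 / ((|C| + 1) * (‖T‖ + 1))) (by positivity)
  obtain ⟨u, hu, hu'⟩ := exists_invPMap_eq hT.injective_sq w
  have h1 := hC u
  rw [hu', hu] at h1
  have h2 : ‖(T * T) w‖ ≤ ‖T‖ * ‖T w‖ := T.le_opNorm (T w)
  have h3 : 0 < ‖w‖ := norm_pos_iff.2 hw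
  have h4 : ‖T w‖ * ((|C| + 1) * (‖T‖ + 1)) ≤ ‖w‖ := by
    rw [div_mul_eq_mul_div, one_mul, le_div_iff₀ (by positivity)] at hTw
    exact hTw
  have h5 : C * ‖(T * T) w‖ ≤ |C| * (‖T‖ * ‖T w‖) :=
    mul_le_mul (le_abs_self C) h2 (norm_nonneg _) (abs_nonneg _)
  have h6 := norm_nonneg (T w)
  have h7 := norm_nonneg T
  have h8 := abs_nonneg C
  have h9 : 0 < ‖T w‖ := norm_pos_iff.2 fun h => hw (hT.injective (by rw [h, map_zero]))
  nlinarith [mul_nonneg h8 h6, mul_nonneg h7 h6]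

variable [CompleteSpace H]

theorem adjoint (hT : T.IsSectorialRoot α) : (adjoint T).IsSectorialRoot α := by
  constructor
  · intro u
    rw [adjoint_inner_right, adjoint_inner_right, ← inner_conj_symm, Complex.conj_im,
      Complex.conj_re, abs_neg]
    exact hT.sectorial_sq u
  · intro u hu
    rw [adjoint_inner_right, ← inner_conj_symm, Complex.conj_re]
    exact hT.strictly_accretive u hu

theorem adjoint_sq (T : H →L[ℂ] H) :
    ContinuousLinearMap.adjoint (T * T) =
      ContinuousLinearMap.adjoint T * ContinuousLinearMap.adjoint T :=
  adjoint_comp T T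

theorem adjoint_invPMap_sq (hT : T.IsSectorialRoot α) :
    (T * T).invPMap.adjoint =
      (ContinuousLinearMap.adjoint T * ContinuousLinearMap.adjoint T).invPMap := by
  rw [invPMap_adjoint hT.injective_sq (by rw [adjoint_sq]; exact hT.adjoint.injective_sq),
    adjoint_sq]

theorem dense_range (hT : T.IsSectorialRoot α) : Dense (Set.range T) :=
  dense_range_of_injective_adjoint hT.adjoint.injective

theorem dense_range_sq (hT : T.IsSectorialRoot α) : Dense (Set.range (T * T)) :=
  dense_range_of_injective_adjoint (by rw [adjoint_sq]; exact hT.adjoint.injective_sq)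

end IsSectorialRoot

/-- The inverse of a bounded injective accretive operator with dense range is `m`-accretive. -/
theorem isMAccretive_invPMap [CompleteSpace H] {B : H →L[ℂ] H} (hB : Function.Injective B)
    (hd : Dense (Set.range B)) (hacc : ∀ u, 0 ≤ (inner ℂ u (B u)).re) :
    B.invPMap.IsMAccretive := by
  refine ⟨fun u => ?_, ?_, ?_⟩
  · have h := hacc (B.invPMap u)
    rw [apply_invPMap hB, ← inner_conj_symm, Complex.conj_re] at h
    exact h
  · rw [invPMap_domain]; exact hd
  · set t : ℝ := 1 / (2 * (‖B‖ + 1)) with ht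
    have hB0 := norm_nonneg B
    have ht0 : 0 < t := by positivity
    have ht1 : t * (2 * (‖B‖ + 1)) = 1 := by rw [ht]; field_simp
    refine ⟨-(t : ℂ), by simpa using ht0, fun y => ?_⟩
    have hlt : ‖-((t : ℂ) • B)‖ < 1 := by
      rw [norm_neg, norm_smul, Complex.norm_real, Real.norm_of_nonneg ht0.le]
      nlinarith
    obtain ⟨V, hV⟩ : ∃ V : H →L[ℂ] H, (1 - -((t : ℂ) • B)) * V = 1 :=
      ⟨_, Ring.mul_inverse_cancel _ (isUnit_one_sub_of_norm_lt_one hlt)⟩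
    obtain ⟨u, hu, hu'⟩ := exists_invPMap_eq hB (V y)
    refine ⟨u, ?_⟩
    rw [hu, hu']
    have h : V y - -((t : ℂ) • B (V y)) = y := DFunLike.congr_fun hV y
    rw [← h, neg_smul, h]
    exact h

namespace IsSectorialRoot

variable [CompleteSpace H] {α : ℝ} {T : H →L[ℂ] H}

theorem isMSectorial (hα : 0 < Real.tan α) (hT : T.IsSectorialRoot α) :
    (T * T).invPMap.IsMSectorial α := by
  refine ⟨fun u => ?_, isMAccretive_invPMap hT.injective_sq hT.dense_range_sq
    (hT.re_sq_nonneg hα)⟩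
  set w := (T * T).invPMap u with hw
  have h : T (T w) = u := apply_invPMap hT.injective_sq u
  have h1 := hT.sectorial_sq w
  have h2 := hT.re_sq_nonneg hα w
  rw [h, ← inner_conj_symm, Complex.conj_im, Complex.conj_re, abs_neg] at h1
  rw [h, ← inner_conj_symm, Complex.conj_re] at h2
  exact ⟨h2, h1⟩

theorem isMAccretiveSqrt (hT : T.IsSectorialRoot α) :
    LinearPMap.IsMAccretiveSqrt T.invPMap (T * T).invPMap := by
  refine ⟨isMAccretive_invPMap hT.injective hT.dense_range hT.accretive, fun x z => ?_⟩
  simp only [mem_invPMap_graph hT.injective, mem_invPMap_graph hT.injective_sq]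
  constructor
  · intro h
    exact ⟨T z, h, rfl⟩
  · rintro ⟨y, h1, h2⟩
    rw [← h1, ← h2]; rfl

/-- A root `B` of `T⁻²` is injective and onto, so `B⁻¹` is an everywhere defined accretive linear
map whose square is `T²`; uniqueness of the bounded root applies to it. -/
theorem eq_invPMap_of_isMAccretiveSqrt (hα : 0 < Real.tan α) (hT : T.IsSectorialRoot α)
    {B : H →ₗ.[ℂ] H} (hB : LinearPMap.IsMAccretiveSqrt B (T * T).invPMap) : B = T.invPMap := by
  obtain ⟨⟨hacc, -, -⟩, hsq⟩ := hB
  simp only [mem_invPMap_graph hT.injective_sq] at hsq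
  have hinj : ∀ x y w, (x, w) ∈ B.graph → (y, w) ∈ B.graph → x = y := by
    intro x y w hx hy
    have h1 : (x - y, (0 : H)) ∈ B.graph := by
      have := B.graph.sub_mem hx hy
      rwa [Prod.mk_sub_mk, sub_self] at this
    have h2 := (hsq (x - y) 0).2 ⟨0, h1, B.graph.zero_mem⟩
    rw [map_zero] at h2
    exact sub_eq_zero.1 h2.symm
  have hsurj : ∀ w, ∃ x, (x, w) ∈ B.graph := by
    intro w
    obtain ⟨y, -, hy⟩ := (hsq ((T * T) w) w).1 rfl
    exact ⟨y, hy⟩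
  choose R hR using hsurj
  set R' : H →ₗ[ℂ] H :=
    { toFun := R
      map_add' := fun x y => hinj _ _ _ (hR (x + y)) (B.graph.add_mem (hR x) (hR y))
      map_smul' := fun c x => hinj _ _ _ (hR (c • x)) (B.graph.smul_mem c (hR x)) } with hR'
  have hRacc : ∀ w, 0 ≤ (inner ℂ w (R' w)).re := by
    intro w
    obtain ⟨u, hu, hu'⟩ := (LinearPMap.mem_graph_iff B).1 (hR w)
    have h1 := hacc u
    simp only at hu hu'
    rw [hu, hu', ← inner_conj_symm, Complex.conj_re] at h1
    exact h1
  have hRR : ∀ w, R' (R' w) = T (T w) := by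
    intro w
    exact ((hsq (R (R w)) w).2 ⟨R w, hR (R w), hR w⟩).symm
  have hRT := eq_of_accretive_of_sq_eq hα hT.sectorial_sq hT.strictly_accretive R' hRacc hRR
  refine eq_invPMap_of_graph hT.injective fun x w => ?_
  rw [← hRT]
  constructor
  · intro h
    exact hinj _ _ _ (hR w) h
  · rintro rfl
    exact hR w

theorem msqrt_eq (hα : 0 < Real.tan α) (hT : T.IsSectorialRoot α) :
    (T * T).invPMap.msqrt = T.invPMap := by
  have h : ∃ B : H →ₗ.[ℂ] H, LinearPMap.IsMAccretiveSqrt B (T * T).invPMap :=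
    ⟨_, hT.isMAccretiveSqrt⟩
  rw [LinearPMap.msqrt, dif_pos h]
  exact hT.eq_invPMap_of_isMAccretiveSqrt hα h.choose_spec

theorem adjoint_msqrt_eq (hα : 0 < Real.tan α) (hT : T.IsSectorialRoot α) :
    (T * T).invPMap.adjoint.msqrt = (ContinuousLinearMap.adjoint T).invPMap := by
  rw [hT.adjoint_invPMap_sq, hT.adjoint.msqrt_eq hα]

theorem invSqrt_eq (hα : 0 < Real.tan α) (hT : T.IsSectorialRoot α) :
    (T * T).invPMap.invSqrt = T.asPMap := by
  rw [LinearPMap.invSqrt, hT.msqrt_eq hα, invPMap_inverse hT.injective]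

end IsSectorialRoot

/-- The operator `Q + i K`. -/
def cart (Q K : H →L[ℂ] H) : H →L[ℂ] H := Q + Complex.I • K

theorem cart_apply (Q K : H →L[ℂ] H) (u : H) : cart Q K u = Q u + Complex.I • K u := rfl

theorem adjoint_cart [CompleteSpace H] {Q K : H →L[ℂ] H} (hQ : adjoint Q = Q)
    (hK : adjoint K = K) : adjoint (cart Q K) = cart Q (-K) := by
  ext u
  refine ext_inner_left ℂ fun v => ?_
  have h1 : inner ℂ (Q v) u = inner ℂ v (Q u) := by rw [← adjoint_inner_right, hQ]
  have h2 : inner ℂ (K v) u = inner ℂ v (K u) := by rw [← adjoint_inner_right, hK]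
  rw [adjoint_inner_right, cart_apply, cart_apply, inner_add_left, inner_add_right,
    inner_smul_left, inner_smul_right, h1, h2, neg_apply, inner_neg_right, Complex.conj_I]
  ring

theorem cart_rePart [CompleteSpace H] {Q K : H →L[ℂ] H} (hQ : adjoint Q = Q)
    (hK : adjoint K = K) : (cart Q K).asPMap.rePart = Q.asPMap := by
  rw [asPMap_rePart, adjoint_cart hQ hK]
  congr 1
  rw [cart, cart, smul_neg, add_add_add_comm, add_neg_cancel, add_zero, ← two_smul ℂ, smul_smul]
  norm_num

theorem mem_ran_cart_imPart [CompleteSpace H] {Q K : H →L[ℂ] H} (hQ : adjoint Q = Q)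
    (hK : adjoint K = K) {x : H} : x ∈ (cart Q K).asPMap.imPart.ran ↔ ∃ y, K y = x := by
  have h : (1 / (2 * Complex.I) : ℂ) • (cart Q K - cart Q (-K)) = K := by
    have h1 : cart Q K - cart Q (-K) = (2 * Complex.I) • K := by
      rw [cart, cart, smul_neg, two_mul, add_smul]; abel
    rw [h1, smul_smul, one_div_mul_cancel (by simp), one_smul]
  rw [mem_ran_asPMap_imPart, adjoint_cart hQ hK, h]

/-- A criterion for `Q + i K` to have a sectorial square. -/
theorem isSectorialRoot_cart [CompleteSpace H] {Q K : H →L[ℂ] H} {α : ℝ} (hQ : adjoint Q = Q)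
    (hK : adjoint K = K) (hpos : ∀ u, u ≠ 0 → 0 < (inner ℂ u (Q u)).re)
    (h : ∀ u, 2 * |(inner ℂ (Q u) (K u)).re| ≤ Real.tan α * (‖Q u‖ ^ 2 - ‖K u‖ ^ 2)) :
    (cart Q K).IsSectorialRoot α := by
  constructor
  · intro u
    -- `(T²u, u) = (Tu, T*u)` with `T*u = Qu - iKu`. Its real part is `‖Qu‖² - ‖Ku‖²` and its
    -- imaginary part `2 Re (Qu, Ku)`, the two quantities compared in the hypothesis.
    have h1 : inner ℂ u (cart Q K (cart Q K u)) =
        inner ℂ (Q u) (Q u) - inner ℂ (K u) (K u) +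
          Complex.I * (inner ℂ (Q u) (K u) + inner ℂ (K u) (Q u)) := by
      rw [← adjoint_inner_left, adjoint_cart hQ hK, cart_apply, cart_apply, neg_apply]
      simp only [inner_add_left, inner_add_right, inner_smul_left, inner_smul_right,
        inner_neg_left, smul_neg, Complex.conj_I]
      linear_combination inner ℂ (K u) (K u) * Complex.I_sq
    have h2 : inner ℂ (Q u) (K u) + inner ℂ (K u) (Q u) =
        ((2 * (inner ℂ (Q u) (K u)).re : ℝ) : ℂ) := by
      rw [← inner_conj_symm (K u) (Q u), Complex.add_conj]
    have h3 : (inner ℂ (Q u) (Q u)).im = 0 := inner_self_im (𝕜 := ℂ) (Q u)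
    have h4 : (inner ℂ (K u) (K u)).im = 0 := inner_self_im (𝕜 := ℂ) (K u)
    have h5 := h u
    rw [h1, h2]
    simp only [Complex.add_im, Complex.sub_im, Complex.add_re, Complex.sub_re, h3, h4,
      re_inner_self_eq, Complex.mul_re, Complex.mul_im, Complex.I_re, Complex.I_im,
      Complex.ofReal_re, Complex.ofReal_im]
    ring_nf at h5 ⊢
    rwa [abs_mul, abs_two]
  · intro u hu
    have h1 : (inner ℂ u (K u)).im = 0 := by
      have h2 : (starRingEnd ℂ) (inner ℂ u (K u)) = inner ℂ u (K u) := by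
        rw [inner_conj_symm, ← adjoint_inner_right, hK]
      exact Complex.conj_eq_iff_im.1 h2
    rw [cart_apply, inner_add_right, inner_smul_right]
    simp only [Complex.add_re, Complex.mul_re, Complex.I_re, Complex.I_im, h1]
    have := hpos u hu
    linarith

end ContinuousLinearMap

end

/-! ### Block operators on `H ⊕ H` and Douglas' range lemma. -/

noncomputable section

open ContinuousLinearMap

/-- Two isometries of `H` with orthogonal ranges that span `H`: a way of regarding `H` as
`H ⊕ H`. -/
structure Doubling (H : Type*) [NormedAddCommGroup H] [InnerProductSpace ℂ H]
    [CompleteSpace H] where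
  J₁ : H →L[ℂ] H
  J₂ : H →L[ℂ] H
  adj₁₁ : ∀ x, adjoint J₁ (J₁ x) = x
  adj₁₂ : ∀ x, adjoint J₁ (J₂ x) = 0
  adj₂₁ : ∀ x, adjoint J₂ (J₁ x) = 0
  adj₂₂ : ∀ x, adjoint J₂ (J₂ x) = x
  sum_eq : ∀ x, J₁ (adjoint J₁ x) + J₂ (adjoint J₂ x) = x

namespace Doubling

variable {H : Type*} [NormedAddCommGroup H] [InnerProductSpace ℂ H] [CompleteSpace H]
  (J : Doubling H)

/-- The first component. -/
def p₁ : H →L[ℂ] H := adjoint J.J₁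

/-- The second component. -/
def p₂ : H →L[ℂ] H := adjoint J.J₂

@[simp] theorem p₁_J₁ (x : H) : J.p₁ (J.J₁ x) = x := J.adj₁₁ x
@[simp] theorem p₁_J₂ (x : H) : J.p₁ (J.J₂ x) = 0 := J.adj₁₂ x
@[simp] theorem p₂_J₁ (x : H) : J.p₂ (J.J₁ x) = 0 := J.adj₂₁ x
@[simp] theorem p₂_J₂ (x : H) : J.p₂ (J.J₂ x) = x := J.adj₂₂ x

theorem ext {u v : H} (h1 : J.p₁ u = J.p₁ v) (h2 : J.p₂ u = J.p₂ v) : u = v := by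
  rw [← J.sum_eq u, ← J.sum_eq v]
  change J.J₁ (J.p₁ u) + J.J₂ (J.p₂ u) = J.J₁ (J.p₁ v) + J.J₂ (J.p₂ v)
  rw [h1, h2]

theorem inner_eq (u v : H) :
    inner ℂ u v = inner ℂ (J.p₁ u) (J.p₁ v) + inner ℂ (J.p₂ u) (J.p₂ v) := by
  conv_lhs => rw [← J.sum_eq v]
  rw [inner_add_right, ← adjoint_inner_left J.J₁, ← adjoint_inner_left J.J₂]
  rfl

theorem norm_sq_eq (u : H) : ‖u‖ ^ 2 = ‖J.p₁ u‖ ^ 2 + ‖J.p₂ u‖ ^ 2 := by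
  rw [← re_inner_self_eq, J.inner_eq, Complex.add_re, re_inner_self_eq, re_inner_self_eq]

theorem norm_p₁_le (u : H) : ‖J.p₁ u‖ ≤ ‖u‖ := by
  refine le_of_sq_le_sq ?_ (norm_nonneg u)
  rw [J.norm_sq_eq u]
  nlinarith [sq_nonneg ‖J.p₂ u‖]

theorem norm_J₁ (x : H) : ‖J.J₁ x‖ = ‖x‖ := by
  have h := J.norm_sq_eq (J.J₁ x)
  rw [p₁_J₁, p₂_J₁, norm_zero] at h
  exact (sq_eq_sq₀ (norm_nonneg _) (norm_nonneg _)).1 (by linarith)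

/-- The operator with block matrix `[[a, b], [c, d]]`. -/
def blk (a b c d : H →L[ℂ] H) : H →L[ℂ] H :=
  J.J₁ * a * J.p₁ + J.J₁ * b * J.p₂ + J.J₂ * c * J.p₁ + J.J₂ * d * J.p₂

variable (a b c d : H →L[ℂ] H)

theorem blk_apply (u : H) : J.blk a b c d u =
    J.J₁ (a (J.p₁ u)) + J.J₁ (b (J.p₂ u)) + J.J₂ (c (J.p₁ u)) + J.J₂ (d (J.p₂ u)) := rfl

@[simp] theorem p₁_blk (u : H) : J.p₁ (J.blk a b c d u) = a (J.p₁ u) + b (J.p₂ u) := by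
  simp [blk_apply]

@[simp] theorem p₂_blk (u : H) : J.p₂ (J.blk a b c d u) = c (J.p₁ u) + d (J.p₂ u) := by
  simp [blk_apply]

theorem adjoint_blk :
    adjoint (J.blk a b c d) = J.blk (adjoint a) (adjoint c) (adjoint b) (adjoint d) := by
  ext u
  refine ext_inner_left ℂ fun v => ?_
  rw [adjoint_inner_right, J.inner_eq, J.inner_eq v]
  simp only [p₁_blk, p₂_blk, inner_add_left, inner_add_right, adjoint_inner_right]
  ring

end Doubling

/-- A bounded operator `T` dominates, in norm, the adjoint of every operator whose range it
contains. -/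
theorem ContinuousLinearMap.exists_norm_adjoint_le_of_range_subset {H : Type*}
    [NormedAddCommGroup H] [InnerProductSpace ℂ H] [CompleteSpace H] {S T : H →L[ℂ] H}
    (hT : Function.Injective T) (h : ∀ x, ∃ y, T y = S x) :
    ∃ C : ℝ, ∀ x, ‖adjoint S x‖ ≤ C * ‖adjoint T x‖ := by
  choose W hW using h
  set W' : H →ₗ[ℂ] H :=
    { toFun := W
      map_add' := fun x y => hT (by rw [map_add, hW, hW, hW, map_add])
      map_smul' := fun c x => hT (by rw [hW, map_smul, map_smul, RingHom.id_apply, hW]) } with hW'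
  have hc : Continuous W' := by
    refine W'.continuous_of_seq_closed_graph fun u x y hu hWu => ?_
    apply hT
    have h1 : Tendsto (fun n => T (W (u n))) atTop (𝓝 (T y)) := (T.continuous.tendsto y).comp hWu
    have h2 : Tendsto (fun n => S (u n)) atTop (𝓝 (S x)) := (S.continuous.tendsto x).comp hu
    change T y = T (W x)
    rw [hW]
    exact tendsto_nhds_unique (h1.congr fun n => hW (u n)) h2
  set W'' : H →L[ℂ] H := ⟨W', hc⟩ with hW''
  -- `W'' = T⁻¹S` is bounded by the closed graph theorem; taking adjoints in this factorization
  -- gives the norm bound.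
  have hS : S = T * W'' := by
    ext x
    exact (hW x).symm
  refine ⟨‖adjoint W''‖, fun x => ?_⟩
  have h1 : adjoint S = adjoint W'' * adjoint T := by rw [hS]; exact adjoint_comp T W''
  rw [h1]
  exact (adjoint W'').le_opNorm _

end

/-! ### The coupled operator `Q + iK`: disjointness of ranges and sectoriality. -/

noncomputable section

open ContinuousLinearMap

/-- The ingredients of the construction: a rapidly decreasing operator `R` with
`ran R ∩ U ran R = {0}`, a positive operator `A = R² A₁`, and a self-adjoint `K₀ = R² K₁` that is
strictly dominated by `A` in a quantitative way measured by the form `η`. -/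
structure CouplingData (H : Type*) [NormedAddCommGroup H] [InnerProductSpace ℂ H]
    [CompleteSpace H] (τ : ℝ) where
  R : H →L[ℂ] H
  A₁ : H →L[ℂ] H
  K₁ : H →L[ℂ] H
  U : H →L[ℂ] H
  A : H →L[ℂ] H
  K₀ : H →L[ℂ] H
  A_eq : ∀ x, A x = R (R (A₁ x))
  K₀_eq : ∀ x, K₀ x = R (R (K₁ x))
  R_adj : adjoint R = R
  U_adj : adjoint U = U
  A_adj : adjoint A = A
  K₀_adj : adjoint K₀ = K₀
  R_A : ∀ x, R (A x) = A (R x)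
  R_inj : Function.Injective R
  A_pos : ∀ u, u ≠ 0 → 0 < (inner ℂ u (A u)).re
  U_R : ∀ x y, U (R x) = R y → x = 0
  norm_U : ∀ x, ‖U x‖ ≤ 4 * ‖x‖
  norm_A : ∀ x, ‖A x‖ ≤ ‖x‖
  A_small : ∀ ε : ℝ, 0 < ε → ∃ w, w ≠ 0 ∧ ‖A w‖ ≤ ε * ‖w‖
  κ : ℝ
  κ_pos : 0 < κ
  κ_le : 20 * κ ^ 2 ≤ 1
  κ_le' : 40 * κ ^ 2 ≤ τ
  norm_R : ∀ x, ‖R x‖ ≤ κ * ‖x‖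
  η : H → ℝ
  η_nonneg : ∀ x, 0 ≤ η x
  norm_RA : ∀ x, ‖R (A x)‖ ^ 2 ≤ κ ^ 2 * η x
  norm_K₀ : ∀ x, ‖K₀ x‖ ^ 2 ≤ ‖A x‖ ^ 2 - η x
  inner_K₀ : ∀ x, 2 * |(inner ℂ (A x) (K₀ x)).re| ≤ τ / 4 * η x
  norm_RK₀ : ∀ x, ‖R (K₀ x)‖ ≤ ‖R (A x)‖

namespace CouplingData

variable {H : Type*} [NormedAddCommGroup H] [InnerProductSpace ℂ H] [CompleteSpace H] {τ : ℝ}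

/-- The data with `K₀` replaced by `0`. -/
def decoupled (D : CouplingData H τ) : CouplingData H τ :=
  { D with
    K₁ := 0
    K₀ := 0
    K₀_eq := fun x => by simp
    K₀_adj := by simp
    norm_K₀ := fun x => by
      have h1 := D.norm_K₀ x
      have h2 := sq_nonneg ‖D.K₀ x‖
      simp only [zero_apply, norm_zero]
      nlinarith
    inner_K₀ := fun x => by
      have h1 := (mul_nonneg zero_le_two (abs_nonneg _)).trans (D.inner_K₀ x)
      simpa using h1
    norm_RK₀ := fun x => by simp }

variable (D : CouplingData H τ)

theorem A_inj : Function.Injective D.A := by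
  rw [injective_iff_map_eq_zero]
  intro x hx
  by_contra hne
  have := D.A_pos x hne
  rw [hx, inner_zero_right] at this
  simp at this

/-- `W a = R (U + a) R A`. -/
def W (a : ℂ) : H →L[ℂ] H := D.R * (D.U + a • 1) * D.R * D.A

/-- The off-diagonal block `M a = A R (U + a) R A`. -/
def M (a : ℂ) : H →L[ℂ] H := D.A * D.W a

theorem W_apply (a : ℂ) (x : H) :
    D.W a x = D.R (D.U (D.R (D.A x)) + a • D.R (D.A x)) := rfl

theorem M_apply (a : ℂ) (x : H) : D.M a x = D.A (D.W a x) := rfl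

theorem M_adj (a : ℂ) : adjoint (D.M a) = D.M (starRingEnd ℂ a) := by
  ext u
  refine ext_inner_left ℂ fun v => ?_
  have hR : ∀ x y, inner ℂ (D.R x) y = inner ℂ x (D.R y) := fun x y => by
    rw [← adjoint_inner_right, D.R_adj]
  have hU : ∀ x y, inner ℂ (D.U x) y = inner ℂ x (D.U y) := fun x y => by
    rw [← adjoint_inner_right, D.U_adj]
  have hA : ∀ x y, inner ℂ (D.A x) y = inner ℂ x (D.A y) := fun x y => by
    rw [← adjoint_inner_right, D.A_adj]
  rw [adjoint_inner_right]
  simp only [M_apply, W_apply, hA, hR, hU, inner_add_left, inner_add_right, map_add, map_smul,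
    inner_smul_left, inner_smul_right, D.R_A]

/-- Cancelling `R` and separating the `U`-part puts `U R A (x - y)` in `ran R`, so `x = y`; what
remains is `(a - b) R A x = 0`. -/
theorem W_disjoint {a b : ℂ} (hab : a ≠ b) {x y : H} (h : D.W a x = D.W b y) :
    x = 0 ∧ y = 0 := by
  have h1 : D.U (D.R (D.A x)) + a • D.R (D.A x) = D.U (D.R (D.A y)) + b • D.R (D.A y) :=
    D.R_inj h
  have h2 : D.U (D.R (D.A (x - y))) = D.R (b • D.A y - a • D.A x) := by
    simp only [map_sub, map_smul]
    rw [sub_eq_sub_iff_add_eq_add, h1, add_comm]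
  have h3 : x = y := by
    have h4 := D.U_R _ _ h2
    exact sub_eq_zero.1 (D.A_inj (by rw [h4, map_zero]))
  subst h3
  have h4 : (a - b) • D.R (D.A x) = 0 := by
    rw [sub_smul, sub_eq_zero]
    exact add_left_cancel h1
  have h5 : D.R (D.A x) = 0 := (smul_eq_zero.1 h4).resolve_left (sub_ne_zero.2 hab)
  have h6 : x = 0 := D.A_inj (D.R_inj (by rw [h5, map_zero, map_zero]))
  exact ⟨h6, h6⟩

theorem M_disjoint {a b : ℂ} (hab : a ≠ b) {x y : H} (h : D.M a x = D.M b y) :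
    x = 0 ∧ y = 0 :=
  D.W_disjoint hab (D.A_inj h)

theorem norm_V_le {a : ℂ} (ha : ‖a‖ ≤ 1) (x : H) : ‖D.U x + a • x‖ ≤ 5 * ‖x‖ := by
  have h1 := norm_add_le (D.U x) (a • x)
  have h2 := D.norm_U x
  rw [norm_smul] at h1
  nlinarith [norm_nonneg x]

theorem norm_W_le {a : ℂ} (ha : ‖a‖ ≤ 1) (x : H) : ‖D.W a x‖ ≤ 5 * D.κ * ‖D.R (D.A x)‖ := by
  rw [W_apply]
  have h1 := D.norm_R (D.U (D.R (D.A x)) + a • D.R (D.A x))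
  have h2 := D.norm_V_le ha (D.R (D.A x))
  nlinarith [mul_le_mul_of_nonneg_left h2 D.κ_pos.le]

theorem norm_W_le' {a : ℂ} (ha : ‖a‖ ≤ 1) (x : H) :
    ‖D.W a x‖ ≤ 5 * D.κ ^ 2 * ‖D.A x‖ := by
  have h1 := D.norm_W_le ha x
  have h2 := D.norm_R (D.A x)
  nlinarith [mul_le_mul_of_nonneg_left h2 D.κ_pos.le]

variable (J : Doubling H)

/-- The real part `Q = A ⊕ A`. -/
def Q : H →L[ℂ] H := J.blk D.A 0 0 D.A

/-- The imaginary part, with block matrix `[[K₀, M a], [M a*, 0]]`. -/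
def K (a : ℂ) : H →L[ℂ] H := J.blk D.K₀ (D.M a) (D.M (starRingEnd ℂ a)) 0

theorem Q_adj : adjoint (D.Q J) = D.Q J := by
  rw [Q, Doubling.adjoint_blk, D.A_adj, map_zero]

theorem K_adj (a : ℂ) : adjoint (D.K J a) = D.K J a := by
  rw [K, Doubling.adjoint_blk, D.K₀_adj, D.M_adj, D.M_adj, Complex.conj_conj, map_zero]

@[simp] theorem p₁_Q (u : H) : J.p₁ (D.Q J u) = D.A (J.p₁ u) := by simp [Q]
@[simp] theorem p₂_Q (u : H) : J.p₂ (D.Q J u) = D.A (J.p₂ u) := by simp [Q]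
@[simp] theorem p₁_K (a : ℂ) (u : H) :
    J.p₁ (D.K J a u) = D.K₀ (J.p₁ u) + D.M a (J.p₂ u) := by simp [K]
@[simp] theorem p₂_K (a : ℂ) (u : H) :
    J.p₂ (D.K J a u) = D.M (starRingEnd ℂ a) (J.p₁ u) := by simp [K]

theorem Q_pos (u : H) (hu : u ≠ 0) : 0 < (inner ℂ u (D.Q J u)).re := by
  have hA : ∀ x, 0 ≤ (inner ℂ x (D.A x)).re := fun x => by
    by_cases hx : x = 0
    · simp [hx]
    · exact (D.A_pos x hx).le
  rw [J.inner_eq, Complex.add_re, p₁_Q, p₂_Q]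
  by_cases h1 : J.p₁ u = 0
  · have h2 : J.p₂ u ≠ 0 := fun h2 => hu (J.ext (by rw [h1, map_zero]) (by rw [h2, map_zero]))
    exact add_pos_of_nonneg_of_pos (hA _) (D.A_pos _ h2)
  · exact add_pos_of_pos_of_nonneg (D.A_pos _ h1) (hA _)

/-- In the application `e² = η x`, `f = ‖A y‖`, `δ = 5κ²`. The small coupling leaves at least `(e² +
f²)/2` of the gap `‖Qu‖² - ‖Ku‖²`, while the mixed term is at most `τ/2 (e² + f²)`: one `τ/4` comes
from `K₀` and one from the coupling. -/
theorem coupling_estimate {τ δ e f a k r s t : ℝ} (he : 0 ≤ e) (hf : 0 ≤ f) (hδ : 0 ≤ δ)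
    (hδ1 : 4 * δ ≤ 1) (hδ2 : 8 * δ ≤ τ) (h1 : k ≤ a - e ^ 2)
    (h2 : s ≤ k + 2 * (δ * (e * f)) + (δ * f) ^ 2) (h3 : t ≤ (δ * e) ^ 2)
    (h4 : r ≤ τ / 4 * e ^ 2 + 4 * (δ * (e * f))) : r ≤ τ * (a + f ^ 2 - (s + t)) := by
  have h11 : 2 * (e * f) ≤ e ^ 2 + f ^ 2 := by nlinarith [sq_nonneg (e - f)]
  have h12 : (e ^ 2 + f ^ 2) / 2 ≤ a + f ^ 2 - (s + t) := by
    have h13 : δ * (2 * (e * f)) ≤ 1 / 4 * (e ^ 2 + f ^ 2) :=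
      mul_le_mul (by linarith) h11 (by positivity) (by norm_num)
    have h14 : δ ^ 2 * (e ^ 2 + f ^ 2) ≤ 1 / 4 * (e ^ 2 + f ^ 2) := by
      gcongr
      nlinarith
    linarith
  have hτ : 0 ≤ τ := by linarith
  have h13 : δ * (2 * (e * f)) ≤ τ / 8 * (e ^ 2 + f ^ 2) :=
    mul_le_mul (by linarith) h11 (by positivity) (by linarith)
  have h14 : τ * ((e ^ 2 + f ^ 2) / 2) ≤ _ := mul_le_mul_of_nonneg_left h12 hτ
  have h15 := mul_nonneg hτ (sq_nonneg f)
  linarith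

/-- The domination of `K₀` by `A` has only the margin `η`, which may degenerate relative to `‖A
x‖²`. The coupling is harmless because it contains `R`, and `‖R A x‖ ≤ κ √(η x)`. -/
theorem cart_sectorial_bound {a : ℂ} (ha : ‖a‖ ≤ 1) (u : H) :
    2 * |(inner ℂ (D.Q J u) (D.K J a u)).re| ≤ τ * (‖D.Q J u‖ ^ 2 - ‖D.K J a u‖ ^ 2) := by
  have ha' : ‖starRingEnd ℂ a‖ ≤ 1 := by rwa [RCLike.norm_conj]
  rw [J.inner_eq, J.norm_sq_eq, J.norm_sq_eq (D.K J a u)]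
  simp only [p₁_Q, p₂_Q, p₁_K, p₂_K]
  set x := J.p₁ u
  set y := J.p₂ u
  set e := Real.sqrt (D.η x) with he
  have he0 : 0 ≤ e := Real.sqrt_nonneg _
  have hee : D.η x = e ^ 2 := (Real.sq_sqrt (D.η_nonneg x)).symm
  set f := ‖D.A y‖ with hf
  have hf0 : 0 ≤ f := norm_nonneg _
  set δ := 5 * D.κ ^ 2 with hδ
  have hδ0 : 0 ≤ δ := by positivity
  have hδ1 : 4 * δ ≤ 1 := by have := D.κ_le; linarith
  have hδ2 : 8 * δ ≤ τ := by have := D.κ_le'; linarith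
  have hκ := D.κ_pos
  have hr : ‖D.R (D.A x)‖ ≤ D.κ * e := by
    refine le_of_sq_le_sq ?_ (by positivity)
    rw [mul_pow, ← hee]
    exact D.norm_RA x
  have hRadj : ∀ x y, inner ℂ x (D.R y) = inner ℂ (D.R x) y := fun x y => by
    rw [← adjoint_inner_right, D.R_adj]
  -- Commuting `A` past the outer `R` lets that `R` move to the other side of an inner product,
  -- where it supplies the factor `√η`.
  have hMR : D.M a y = D.R (D.A (D.U (D.R (D.A y)) + a • D.R (D.A y))) := by
    rw [M_apply, W_apply, ← D.R_A]
  have hMR' : ‖D.A (D.U (D.R (D.A y)) + a • D.R (D.A y))‖ ≤ 5 * D.κ * f := by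
    have h1 := D.norm_A (D.U (D.R (D.A y)) + a • D.R (D.A y))
    have h2 := D.norm_V_le ha (D.R (D.A y))
    have h3 := D.norm_R (D.A y)
    linarith
  have hcross : ∀ z, ‖D.R z‖ ≤ D.κ * e → ‖inner ℂ z (D.M a y)‖ ≤ δ * (e * f) := by
    intro z hz
    rw [hMR, hRadj]
    calc _ ≤ ‖D.R z‖ * ‖D.A (D.U (D.R (D.A y)) + a • D.R (D.A y))‖ := norm_inner_le_norm _ _
      _ ≤ (D.κ * e) * (5 * D.κ * f) := by gcongr
      _ = δ * (e * f) := by rw [hδ]; ring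
  have h1 : ‖inner ℂ (D.A x) (D.M a y)‖ ≤ δ * (e * f) := hcross _ hr
  have h2 : ‖inner ℂ (D.K₀ x) (D.M a y)‖ ≤ δ * (e * f) := hcross _ ((D.norm_RK₀ x).trans hr)
  have h3 : ‖D.M a y‖ ≤ δ * f := (D.norm_A _).trans (D.norm_W_le' ha y)
  have h4 : ‖D.M (starRingEnd ℂ a) x‖ ≤ δ * e := by
    have h5 := (D.norm_A _).trans (D.norm_W_le ha' x)
    rw [M_apply]
    have h6 := mul_le_mul_of_nonneg_left hr (by positivity : 0 ≤ 5 * D.κ)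
    refine h5.trans (h6.trans_eq ?_)
    rw [hδ]; ring
  have h5 : ‖inner ℂ (D.A y) (D.M (starRingEnd ℂ a) x)‖ ≤ δ * (e * f) := by
    refine (norm_inner_le_norm _ _).trans ?_
    rw [← hf]
    calc f * ‖D.M (starRingEnd ℂ a) x‖ ≤ f * (δ * e) := by gcongr
      _ = δ * (e * f) := by ring
  have h6 := D.inner_K₀ x
  have h7 := D.norm_K₀ x
  rw [hee] at h6 h7
  have h8 : ‖D.K₀ x + D.M a y‖ ^ 2 ≤ ‖D.K₀ x‖ ^ 2 + 2 * (δ * (e * f)) + (δ * f) ^ 2 := by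
    rw [norm_add_sq (𝕜 := ℂ)]
    have h9 := (Complex.re_le_norm _).trans h2
    have h10 : ‖D.M a y‖ ^ 2 ≤ (δ * f) ^ 2 := by gcongr
    change ‖D.K₀ x‖ ^ 2 + 2 * (inner ℂ (D.K₀ x) (D.M a y)).re + ‖D.M a y‖ ^ 2 ≤ _
    linarith
  have h9 : ‖D.M (starRingEnd ℂ a) x‖ ^ 2 ≤ (δ * e) ^ 2 := by gcongr
  have h10 : 2 * |(inner ℂ (D.A x) (D.K₀ x + D.M a y) +
      inner ℂ (D.A y) (D.M (starRingEnd ℂ a) x)).re| ≤ τ / 4 * e ^ 2 + 4 * (δ * (e * f)) := by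
    rw [inner_add_right, Complex.add_re, Complex.add_re]
    have h11 := (Complex.abs_re_le_norm _).trans h1
    have h12 := (Complex.abs_re_le_norm _).trans h5
    have h13 := abs_add_three (inner ℂ (D.A x) (D.K₀ x)).re (inner ℂ (D.A x) (D.M a y)).re
      (inner ℂ (D.A y) (D.M (starRingEnd ℂ a) x)).re
    linarith
  exact coupling_estimate he0 hf0 hδ0 hδ1 hδ2 h7 h8 h9 h10

end CouplingData

end

/-! ### Domains of `T⁻²` and of its adjoint, ranges of `T`, `T*` and `K`. -/

noncomputable section

open ContinuousLinearMap

namespace CouplingData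

variable {H : Type*} [NormedAddCommGroup H] [InnerProductSpace ℂ H] [CompleteSpace H] {τ : ℝ}
  (D : CouplingData H τ) (J : Doubling H)

/-- The operator `T a = Q + i K a`. -/
def T (a : ℂ) : H →L[ℂ] H := cart (D.Q J) (D.K J a)

theorem T_apply (a : ℂ) (u : H) : D.T J a u = D.Q J u + Complex.I • D.K J a u := rfl

theorem T_adj (a : ℂ) : adjoint (D.T J a) = cart (D.Q J) (-D.K J a) :=
  adjoint_cart (D.Q_adj J) (D.K_adj J a)

theorem T_adj_apply (a : ℂ) (u : H) :
    adjoint (D.T J a) u = D.Q J u - Complex.I • D.K J a u := by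
  rw [T_adj, cart_apply, neg_apply, smul_neg, sub_eq_add_neg]

theorem isSectorialRoot_T {D : CouplingData H τ} {α : ℝ} (hα : Real.tan α = τ) {a : ℂ}
    (ha : ‖a‖ ≤ 1) : (D.T J a).IsSectorialRoot α := by
  subst hα
  exact isSectorialRoot_cart (D.Q_adj J) (D.K_adj J a) (D.Q_pos J) (D.cart_sectorial_bound J ha)

theorem norm_K_le {a : ℂ} (ha : ‖a‖ ≤ 1) (u : H) : ‖D.K J a u‖ ≤ ‖D.Q J u‖ := by
  have hτ : 0 < τ := by
    have := D.κ_le'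
    have := sq_pos_of_pos D.κ_pos
    linarith
  have h1 := (mul_nonneg zero_le_two (abs_nonneg _)).trans (D.cart_sectorial_bound J ha u)
  have h2 := nonneg_of_mul_nonneg_right h1 hτ
  exact le_of_sq_le_sq (by linarith) (norm_nonneg _)

/-- As `K` is dominated by `Q`, `‖T u‖ ≤ 2‖Q u‖`, so approximate null vectors of `A` placed in the
first component suffice. -/
theorem exists_norm_T_le {a : ℂ} (ha : ‖a‖ ≤ 1) (ε : ℝ) (hε : 0 < ε) :
    ∃ w, w ≠ 0 ∧ ‖D.T J a w‖ ≤ ε * ‖w‖ := by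
  obtain ⟨w, hw, hAw⟩ := D.A_small (ε / 2) (by positivity)
  have hJ := J.norm_J₁ w
  refine ⟨J.J₁ w, fun h => hw ?_, ?_⟩
  · rw [h, norm_zero] at hJ
    exact norm_eq_zero.1 hJ.symm
  · have h1 : ‖D.Q J (J.J₁ w)‖ = ‖D.A w‖ := by
      have h2 : D.Q J (J.J₁ w) = J.J₁ (D.A w) := J.ext (by simp) (by simp)
      rw [h2, J.norm_J₁]
    have h2 := D.norm_K_le J ha (J.J₁ w)
    have h3 := norm_add_le (D.Q J (J.J₁ w)) (Complex.I • D.K J a (J.J₁ w))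
    rw [norm_smul, Complex.norm_I, one_mul] at h3
    rw [T_apply, hJ]
    linarith

/-- The zero corner of `K` makes the system triangular: the bottom row kills the first components,
hence the `K₀` terms, and the top row kills the second ones. -/
theorem K_disjoint {a b : ℂ} (hab : a ≠ b) {f g : H} (h : D.K J a f = D.K J b g) :
    f = 0 ∧ g = 0 := by
  have h1 := congrArg J.p₁ h
  have h2 := congrArg J.p₂ h
  rw [p₁_K, p₁_K] at h1
  rw [p₂_K, p₂_K] at h2
  obtain ⟨hf, hg⟩ := D.M_disjoint (fun h => hab ((starRingEnd ℂ).injective h)) h2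
  rw [hf, hg, map_zero, zero_add, zero_add] at h1
  obtain ⟨hf', hg'⟩ := D.M_disjoint hab h1
  exact ⟨J.ext (by rw [hf, map_zero]) (by rw [hf', map_zero]),
    J.ext (by rw [hg, map_zero]) (by rw [hg', map_zero])⟩

theorem K_inj (a : ℂ) : Function.Injective (D.K J a) := by
  rw [injective_iff_map_eq_zero]
  intro x hx
  -- Injectivity is the special case of disjointness from another member of the family with the zero
  -- vector on the other side.
  have h : D.K J a x = D.K J (a + 1) 0 := by rw [hx, map_zero]
  exact (D.K_disjoint J (by simp) h).1

theorem dense_range_K (a : ℂ) : Dense (Set.range (D.K J a)) :=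
  dense_range_of_injective_adjoint (by rw [K_adj]; exact D.K_inj J a)

/-- Cancelling one `R` from `W b s = R (U + b) R A s` leaves `U R A s` in `ran R`. -/
theorem eq_zero_of_R_R_eq {b : ℂ} {s z : H} (h : D.R (D.R z) = -Complex.I • D.W b s) : s = 0 := by
  rw [W_apply, ← map_smul] at h
  have h1 := D.R_inj h
  have h2 : D.U (D.R (D.A s)) = D.R (Complex.I • z - b • D.A s) := by
    rw [map_sub, map_smul, map_smul, h1, smul_smul]
    simp
  exact D.A_inj (by rw [D.U_R _ _ h2, map_zero])

/-- The difference `u - v` is described twice. The equation `Tu = T*v` gives `Q (u - v) = -iK (u +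
v)`, from which `A` cancels and leaves `W`; the definitions of `u` and `v` through `x`, `y` place
its components in `ran R²`. These are compatible only if `u + v = 0`, and then `u - v = 0`. -/
theorem T_sq_disjoint (a : ℂ) {x y : H}
    (h : D.T J a (D.T J a x) = adjoint (D.T J a) (adjoint (D.T J a) y)) :
    D.T J a (D.T J a x) = 0 := by
  set u := D.T J a x with hu
  set v := adjoint (D.T J a) y with hv
  rw [T_apply, T_adj_apply] at h
  have hQ : D.Q J (u - v) = -Complex.I • D.K J a (u + v) := by
    rw [map_sub, map_add, neg_smul, smul_add]
    rw [eq_sub_of_add_eq h]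
    abel
  have e1 : J.p₁ (u - v) = D.A (J.p₁ (x - y)) +
      Complex.I • (D.K₀ (J.p₁ (x + y)) + D.M a (J.p₂ (x + y))) := by
    rw [← p₁_K, ← p₁_Q, ← map_smul, ← map_add]
    congr 1
    rw [hu, hv, T_apply, T_adj_apply, map_sub, map_add, smul_add]
    abel
  have e2 : J.p₂ (u - v) = D.A (J.p₂ (x - y)) +
      Complex.I • D.M (starRingEnd ℂ a) (J.p₁ (x + y)) := by
    rw [← p₂_K, ← p₂_Q, ← map_smul, ← map_add]
    congr 1
    rw [hu, hv, T_apply, T_adj_apply, map_sub, map_add, smul_add]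
    abel
  have h2 : J.p₂ (u - v) = -Complex.I • D.W (starRingEnd ℂ a) (J.p₁ (u + v)) := by
    have h3 := congrArg J.p₂ hQ
    rw [p₂_Q, map_smul, p₂_K, M_apply, ← map_smul] at h3
    exact D.A_inj h3
  -- The bottom row comes first: once `p₁ (u + v) = 0`, the term with `K₀` disappears from the top
  -- row.
  have hs1 : J.p₁ (u + v) = 0 := by
    rw [e2, M_apply, D.A_eq, D.A_eq, ← map_smul, ← map_smul, ← map_add, ← map_add] at h2
    exact D.eq_zero_of_R_R_eq h2
  have hd2 : J.p₂ (u - v) = 0 := by rw [h2, hs1, map_zero, smul_zero]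
  have h1 : J.p₁ (u - v) = -Complex.I • D.W a (J.p₂ (u + v)) := by
    have h3 := congrArg J.p₁ hQ
    rw [p₁_Q, map_smul, p₁_K, hs1, map_zero, zero_add, M_apply, ← map_smul] at h3
    exact D.A_inj h3
  have hs2 : J.p₂ (u + v) = 0 := by
    rw [e1, M_apply, D.A_eq, D.A_eq, D.K₀_eq, ← map_add, ← map_add, ← map_smul, ← map_smul,
      ← map_add, ← map_add] at h1
    exact D.eq_zero_of_R_R_eq h1
  have hd1 : J.p₁ (u - v) = 0 := by rw [h1, hs2, map_zero, smul_zero]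
  have hs : u + v = 0 := J.ext (by rw [hs1, map_zero]) (by rw [hs2, map_zero])
  have hd : u - v = 0 := J.ext (by rw [hd1, map_zero]) (by rw [hd2, map_zero])
  have hu0 : u = 0 := by
    have h3 : (2 : ℂ) • u = 0 := by
      rw [two_smul]
      calc u + u = (u + v) + (u - v) := by abel
        _ = 0 := by rw [hs, hd, add_zero]
    exact (smul_eq_zero.1 h3).resolve_left two_ne_zero
  rw [hu0, map_zero]

theorem domain_inf_adjoint_domain {α : ℝ} (hα : Real.tan α = τ) {a : ℂ} (ha : ‖a‖ ≤ 1) :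
    (D.T J a * D.T J a).invPMap.domain ⊓ (D.T J a * D.T J a).invPMap.adjoint.domain = ⊥ := by
  rw [(isSectorialRoot_T J hα ha).adjoint_invPMap_sq, Submodule.eq_bot_iff]
  rintro z ⟨h1, h2⟩
  obtain ⟨x, rfl⟩ := mem_invPMap_domain.1 h1
  obtain ⟨y, hy⟩ := mem_invPMap_domain.1 h2
  exact D.T_sq_disjoint J a hy.symm

theorem range_T_ne {a : ℂ} (ha : ‖a‖ ≤ 1) (hTinj : Function.Injective (adjoint (D.T J a)))
    (hD : ∀ n : ℕ, ∃ w, D.A w ≠ 0 ∧ (n + 1) * ‖D.A w + Complex.I • D.K₀ w‖ ≤ ‖D.A w‖ ∧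
      ‖D.A w‖ ≤ ‖D.A w - Complex.I • D.K₀ w‖ ∧ (n + 1) * ‖D.R (D.A w)‖ ≤ ‖D.A w‖) :
    (D.T J a).invPMap.domain ≠ (adjoint (D.T J a)).invPMap.domain := by
  intro h
  have ha' : ‖starRingEnd ℂ a‖ ≤ 1 := by rwa [RCLike.norm_conj]
  -- `ran T ⊆ ran T*` gives `‖T*x‖ ≤ C ‖Tx‖`. It fails at `J₁ w`, where `‖T*J₁w‖ ≥ ‖Aw‖` and `(n +
  -- 1) ‖T J₁w‖ ≤ (1 + 5) ‖Aw‖`, the `5` coming from the coupling `M`.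
  obtain ⟨C, hC⟩ := exists_norm_adjoint_le_of_range_subset (S := D.T J a)
    (T := adjoint (D.T J a)) hTinj fun x => by
      rw [← mem_invPMap_domain, ← h, mem_invPMap_domain]
      exact ⟨x, rfl⟩
  rw [adjoint_adjoint] at hC
  obtain ⟨n, hn⟩ := exists_nat_gt (6 * |C|)
  obtain ⟨w, hw, h1, h2, h3⟩ := hD n
  have h4 := hC (J.J₁ w)
  have h5 : ‖D.A w‖ ≤ ‖adjoint (D.T J a) (J.J₁ w)‖ := by
    refine h2.trans (le_trans (le_of_eq ?_) (J.norm_p₁_le _))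
    rw [T_adj_apply, map_sub, map_smul, p₁_Q, p₁_K]
    simp
  have h6 : ‖D.T J a (J.J₁ w)‖ ≤ ‖D.A w + Complex.I • D.K₀ w‖ + ‖D.M (starRingEnd ℂ a) w‖ := by
    refine le_of_sq_le_sq ?_ (by positivity)
    rw [J.norm_sq_eq, T_apply, map_add, map_add, map_smul, map_smul, p₁_Q, p₁_K, p₂_Q, p₂_K]
    simp only [Doubling.p₁_J₁, Doubling.p₂_J₁, map_zero, add_zero, zero_add, norm_smul,
      Complex.norm_I, one_mul]
    nlinarith [norm_nonneg (D.A w + Complex.I • D.K₀ w), norm_nonneg (D.M (starRingEnd ℂ a) w)]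
  have h7 : ‖D.M (starRingEnd ℂ a) w‖ ≤ 5 * ‖D.R (D.A w)‖ := by
    have h8 := (D.norm_A _).trans (D.norm_W_le ha' w)
    rw [M_apply]
    have h9 : D.κ ≤ 1 := by nlinarith [D.κ_le, D.κ_pos]
    have h10 := norm_nonneg (D.R (D.A w))
    nlinarith
  have h8 : 0 < ‖D.A w‖ := norm_pos_iff.2 hw
  have h9 : ((n : ℝ) + 1) * ‖D.T J a (J.J₁ w)‖ ≤ 6 * ‖D.A w‖ := by
    have h10 : (0 : ℝ) ≤ (n : ℝ) + 1 := by positivity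
    nlinarith [mul_le_mul_of_nonneg_left h6 h10, mul_le_mul_of_nonneg_left h7 h10]
  have h10 : ‖D.A w‖ ≤ |C| * ‖D.T J a (J.J₁ w)‖ :=
    (h5.trans h4).trans (mul_le_mul_of_nonneg_right (le_abs_self C) (norm_nonneg _))
  have h11 : ((n : ℝ) + 1) * ‖D.A w‖ ≤ |C| * (6 * ‖D.A w‖) := by
    calc ((n : ℝ) + 1) * ‖D.A w‖ ≤ ((n : ℝ) + 1) * (|C| * ‖D.T J a (J.J₁ w)‖) := by gcongr
      _ = |C| * (((n : ℝ) + 1) * ‖D.T J a (J.J₁ w)‖) := by ring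
      _ ≤ |C| * (6 * ‖D.A w‖) := by gcongr
  nlinarith

section Decoupled

variable {D : CouplingData H τ}

/-- `Z` with `K = Q Z`, when `K₀ = 0`. -/
def Z (D : CouplingData H τ) (J : Doubling H) (a : ℂ) : H →L[ℂ] H :=
  J.blk 0 (D.W a) (D.W (starRingEnd ℂ a)) 0

theorem K_eq_Q_mul_Z (hK₀ : D.K₀ = 0) (a : ℂ) : D.K J a = D.Q J * D.Z J a := by
  ext u
  refine J.ext ?_ ?_
  · rw [p₁_K, hK₀]
    simp [Z, M_apply]
  · rw [p₂_K]
    simp [Z, M_apply]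

theorem norm_Z_lt {a : ℂ} (ha : ‖a‖ ≤ 1) : ‖D.Z J a‖ < 1 := by
  have ha' : ‖starRingEnd ℂ a‖ ≤ 1 := by rwa [RCLike.norm_conj]
  have h : ‖D.Z J a‖ ≤ 1 / 2 := by
    refine opNorm_le_bound _ (by norm_num) fun u => ?_
    refine le_of_sq_le_sq ?_ (by positivity)
    rw [mul_pow, J.norm_sq_eq, J.norm_sq_eq u]
    simp only [Z, Doubling.p₁_blk, Doubling.p₂_blk, zero_apply, zero_add, add_zero]
    have key : ∀ b : ℂ, ‖b‖ ≤ 1 → ∀ x, ‖D.W b x‖ ^ 2 ≤ (1 / 2) ^ 2 * ‖x‖ ^ 2 := by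
      intro b hb x
      rw [← mul_pow]
      refine pow_le_pow_left₀ (norm_nonneg _) ?_ 2
      refine (D.norm_W_le' hb x).trans ?_
      have h1 := D.κ_le
      have h2 := D.norm_A x
      have h3 := norm_nonneg (D.A x)
      nlinarith
    have h1 := key a ha (J.p₂ u)
    have h2 := key _ ha' (J.p₁ u)
    linarith
  linarith

/-- A Neumann series makes `1 - Z` onto, so right multiplication by it leaves the range of `Q`
unchanged. -/
theorem range_Q_mul (Z : H →L[ℂ] H) (hZ : ‖Z‖ < 1) :
    LinearMap.range (D.Q J * (1 - Z)).toLinearMap = LinearMap.range (D.Q J).toLinearMap := by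
  obtain ⟨V, hV⟩ : ∃ V : H →L[ℂ] H, (1 - Z) * V = 1 :=
    ⟨_, Ring.mul_inverse_cancel _ (isUnit_one_sub_of_norm_lt_one hZ)⟩
  ext x
  constructor
  · rintro ⟨y, rfl⟩
    exact ⟨(1 - Z) y, rfl⟩
  · rintro ⟨y, rfl⟩
    refine ⟨V y, ?_⟩
    have h : (1 - Z) (V y) = y := DFunLike.congr_fun hV y
    change D.Q J ((1 - Z) (V y)) = D.Q J y
    rw [h]

theorem domain_invPMap_T (hK₀ : D.K₀ = 0) {a : ℂ} (ha : ‖a‖ ≤ 1) :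
    (D.T J a).invPMap.domain = LinearMap.range (D.Q J).toLinearMap := by
  rw [invPMap_domain, ← range_Q_mul J (-Complex.I • D.Z J a)
    (by rw [norm_smul]; simpa using norm_Z_lt J ha)]
  congr 2
  rw [T, cart, K_eq_Q_mul_Z J hK₀, mul_sub, mul_one, mul_smul_comm, neg_smul, sub_neg_eq_add]

theorem domain_invPMap_T_adjoint (hK₀ : D.K₀ = 0) {a : ℂ} (ha : ‖a‖ ≤ 1) :
    (adjoint (D.T J a)).invPMap.domain = LinearMap.range (D.Q J).toLinearMap := by
  rw [invPMap_domain, ← range_Q_mul J (Complex.I • D.Z J a)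
    (by rw [norm_smul]; simpa using norm_Z_lt J ha)]
  congr 2
  rw [T_adj, cart, K_eq_Q_mul_Z J hK₀, mul_sub, mul_one, mul_smul_comm, smul_neg,
    sub_eq_add_neg]

/-- The part `A R U R A` of the off-diagonal block. -/
def N₀ (D : CouplingData H τ) : H →L[ℂ] H := D.A * D.R * D.U * D.R * D.A

/-- The part `A R R A` of the off-diagonal block. -/
def N₁ (D : CouplingData H τ) : H →L[ℂ] H := D.A * D.R * D.R * D.A

theorem M_apply_eq (a : ℂ) (x : H) : D.M a x = D.N₀ x + a • D.N₁ x := by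
  rw [M_apply, W_apply, map_add, map_add, map_smul, map_smul]
  rfl

/-- Since `M a x + M b y = N₀ (x + y) + N₁ (a x + b y)`, the arguments solve the system `x + y = s`,
`a x + b y = t`, whose determinant vanishes only for `a = b`. -/
theorem N_solve {a b : ℂ} (hab : a ≠ b) (s t : H) :
    D.M a ((a - b)⁻¹ • (t - b • s)) + D.M b ((a - b)⁻¹ • (a • s - t)) = D.N₀ s + D.N₁ t := by
  have h : a - b ≠ 0 := sub_ne_zero.2 hab
  have h1 : (a - b)⁻¹ • (t - b • s) + (a - b)⁻¹ • (a • s - t) = s := by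
    rw [← smul_add, inv_smul_eq_iff₀ h, sub_smul]; abel
  have h2 : a • (a - b)⁻¹ • (t - b • s) + b • (a - b)⁻¹ • (a • s - t) = t := by
    rw [smul_comm a, smul_comm b, ← smul_add, inv_smul_eq_iff₀ h, sub_smul, smul_sub, smul_sub,
      smul_comm a b]
    abel
  have h3 := congrArg D.N₀ h1
  have h4 := congrArg D.N₁ h2
  rw [map_add] at h3 h4
  rw [M_apply_eq, M_apply_eq, ← map_smul, ← map_smul, ← h3, ← h4]
  abel

/-- The common direct sum of the ranges of `K a` and `K b`. -/
def rangeSum (D : CouplingData H τ) (J : Doubling H) : Submodule ℂ H :=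
  LinearMap.range (J.blk 0 D.N₀ D.N₀ 0).toLinearMap ⊔
    LinearMap.range (J.blk 0 D.N₁ D.N₁ 0).toLinearMap

theorem mem_rangeSum {u : H} : u ∈ D.rangeSum J ↔ ∃ s t : H,
    J.p₁ u = D.N₀ (J.p₂ s) + D.N₁ (J.p₂ t) ∧ J.p₂ u = D.N₀ (J.p₁ s) + D.N₁ (J.p₁ t) := by
  rw [rangeSum, Submodule.mem_sup]
  constructor
  · rintro ⟨_, ⟨s, rfl⟩, _, ⟨t, rfl⟩, rfl⟩
    exact ⟨s, t, by simp, by simp⟩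
  · rintro ⟨s, t, h1, h2⟩
    exact ⟨_, ⟨s, rfl⟩, _, ⟨t, rfl⟩, J.ext (by simp [h1]) (by simp [h2])⟩

theorem range_K_sup (hK₀ : D.K₀ = 0) {a b : ℂ} (hab : a ≠ b) :
    LinearMap.range (D.K J a).toLinearMap ⊔ LinearMap.range (D.K J b).toLinearMap =
      D.rangeSum J := by
  have hab' : starRingEnd ℂ a ≠ starRingEnd ℂ b := fun h => hab ((starRingEnd ℂ).injective h)
  have hp : ∀ (a : ℂ) (u : H), J.p₁ (D.K J a u) = D.M a (J.p₂ u) := fun a u => by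
    rw [p₁_K, hK₀, zero_apply, zero_add]
  ext u
  rw [mem_rangeSum, Submodule.mem_sup]
  constructor
  · rintro ⟨_, ⟨x, rfl⟩, _, ⟨y, rfl⟩, rfl⟩
    -- The first component carries conjugated parameters because it enters the bottom row, which
    -- contains `M ā`.
    refine ⟨x + y, J.J₁ (starRingEnd ℂ a • J.p₁ x + starRingEnd ℂ b • J.p₁ y) +
      J.J₂ (a • J.p₂ x + b • J.p₂ y), ?_, ?_⟩
    · rw [map_add, coe_coe, coe_coe, hp, hp, M_apply_eq, M_apply_eq]
      simp
      abel
    · rw [map_add, coe_coe, coe_coe, p₂_K, p₂_K, M_apply_eq, M_apply_eq]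
      simp
      abel
  · rintro ⟨s, t, h1, h2⟩
    set a' := starRingEnd ℂ a
    set b' := starRingEnd ℂ b
    refine ⟨_, ⟨J.J₁ ((a' - b')⁻¹ • (J.p₁ t - b' • J.p₁ s)) +
      J.J₂ ((a - b)⁻¹ • (J.p₂ t - b • J.p₂ s)), rfl⟩, _,
      ⟨J.J₁ ((a' - b')⁻¹ • (a' • J.p₁ s - J.p₁ t)) +
      J.J₂ ((a - b)⁻¹ • (a • J.p₂ s - J.p₂ t)), rfl⟩, J.ext ?_ ?_⟩
    · rw [map_add, coe_coe, coe_coe, hp, hp, h1, ← N_solve hab]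
      simp only [map_add, Doubling.p₂_J₁, Doubling.p₂_J₂, zero_add]
    · rw [map_add, coe_coe, coe_coe, p₂_K, p₂_K, h2, ← N_solve hab']
      simp only [map_add, Doubling.p₁_J₁, Doubling.p₁_J₂, add_zero, a', b']

end Decoupled

theorem continuous_T : Continuous fun a => D.T J a := by
  unfold T cart K M W Doubling.blk
  have h1 : Continuous fun a : ℂ => D.U + a • (1 : H →L[ℂ] H) := by fun_prop
  have h2 : Continuous fun a : ℂ => D.A * (D.R * (D.U + a • (1 : H →L[ℂ] H)) * D.R * D.A) :=
    continuous_const.mul (((continuous_const.mul h1).mul continuous_const).mul continuous_const)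
  have h3 := h2.comp Complex.continuous_conj
  refine continuous_const.add (Continuous.const_smul ?_ Complex.I)
  exact (((continuous_const.add ((continuous_const.mul h2).mul continuous_const))).add
    ((continuous_const.mul h3).mul continuous_const)).add continuous_const

end CouplingData

end

/-! ### Parametrization by the unit disc and the two families. -/

noncomputable section

open ContinuousLinearMap

/-- An injective continuous map of `ℂ` into the unit disc. -/
def discMap (ξ : ℂ) : ℂ := (((1 + ‖ξ‖)⁻¹ : ℝ) : ℂ) * ξ

theorem norm_discMap (ξ : ℂ) : ‖discMap ξ‖ = (1 + ‖ξ‖)⁻¹ * ‖ξ‖ := by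
  rw [discMap, norm_mul, Complex.norm_real, Real.norm_of_nonneg (by positivity)]

theorem norm_discMap_le (ξ : ℂ) : ‖discMap ξ‖ ≤ 1 := by
  rw [norm_discMap, inv_mul_le_iff₀ (by positivity)]
  linarith

theorem discMap_injective : Function.Injective discMap := by
  intro ξ ζ h
  have h1 : (1 + ‖ξ‖)⁻¹ * ‖ξ‖ = (1 + ‖ζ‖)⁻¹ * ‖ζ‖ := by
    rw [← norm_discMap, ← norm_discMap, h]
  have h2 : ‖ξ‖ = ‖ζ‖ := by
    have hx := norm_nonneg ξ
    have hz := norm_nonneg ζ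
    field_simp at h1
    linarith
  rw [discMap, discMap, h2] at h
  refine mul_left_cancel₀ ?_ h
  exact_mod_cast (by positivity : (0 : ℝ) < (1 + ‖ζ‖)⁻¹).ne'

theorem continuous_discMap : Continuous discMap := by
  unfold discMap
  have h : Continuous fun ξ : ℂ => (1 + ‖ξ‖)⁻¹ :=
    (continuous_const.add continuous_norm).inv₀ fun ξ => (by positivity : (0 : ℝ) < 1 + ‖ξ‖).ne'
  exact (Complex.continuous_ofReal.comp h).mul continuous_id

namespace CouplingData

variable {H : Type*} [NormedAddCommGroup H] [InnerProductSpace ℂ H] [CompleteSpace H]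

/-- The family of operators `(T (discMap ξ))⁻²`. -/
def family {τ : ℝ} (D : CouplingData H τ) (J : Doubling H) (ξ : ℂ) : H →ₗ.[ℂ] H :=
  (D.T J (discMap ξ) * D.T J (discMap ξ)).invPMap

variable {α : ℝ} (D : CouplingData H (Real.tan α)) (J : Doubling H)

theorem isSectorialRoot_T_discMap (ξ : ℂ) : (D.T J (discMap ξ)).IsSectorialRoot α :=
  isSectorialRoot_T J rfl (norm_discMap_le ξ)

theorem family_spec (hα : 0 < Real.tan α) (ξ : ℂ) :
    (D.family J ξ).IsUnbounded ∧ (D.family J ξ).IsCoercive ∧ (D.family J ξ).IsMSectorial α :=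
  ⟨(D.isSectorialRoot_T_discMap J ξ).isUnbounded (D.exists_norm_T_le J (norm_discMap_le ξ)),
    (D.isSectorialRoot_T_discMap J ξ).isCoercive hα,
    (D.isSectorialRoot_T_discMap J ξ).isMSectorial hα⟩

theorem family_domain_inf (ξ : ℂ) :
    (D.family J ξ).domain ⊓ (D.family J ξ).adjoint.domain = ⊥ :=
  D.domain_inf_adjoint_domain J rfl (norm_discMap_le ξ)

theorem family_rePart (hα : 0 < Real.tan α) (ξ : ℂ) :
    (D.family J ξ).invSqrt.rePart = (D.Q J).asPMap := by
  rw [family, (D.isSectorialRoot_T_discMap J ξ).invSqrt_eq hα]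
  exact cart_rePart (D.Q_adj J) (D.K_adj J _)

theorem family_imPart_ran (hα : 0 < Real.tan α) (ξ : ℂ) :
    (D.family J ξ).invSqrt.imPart.ran = LinearMap.range (D.K J (discMap ξ)).toLinearMap := by
  rw [family, (D.isSectorialRoot_T_discMap J ξ).invSqrt_eq hα]
  ext x
  exact mem_ran_cart_imPart (D.Q_adj J) (D.K_adj J _)

theorem family_imPart_ran_inf (hα : 0 < Real.tan α) {ξ ζ : ℂ} (h : ξ ≠ ζ) :
    (D.family J ξ).invSqrt.imPart.ran ⊓ (D.family J ζ).invSqrt.imPart.ran = ⊥ := by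
  rw [family_imPart_ran D J hα, family_imPart_ran D J hα, Submodule.eq_bot_iff]
  rintro _ ⟨⟨f, rfl⟩, ⟨g, hg⟩⟩
  have h1 := (D.K_disjoint J (discMap_injective.ne h) hg.symm).1
  rw [h1, map_zero]

/-- The family of operators with distinct form domains of `S(ξ)` and of its adjoint. -/
theorem exists_family_sqrt_domain_ne (J : Doubling H) (hα : 0 < Real.tan α)
    (hD : ∀ n : ℕ, ∃ w, D.A w ≠ 0 ∧ (n + 1) * ‖D.A w + Complex.I • D.K₀ w‖ ≤ ‖D.A w‖ ∧
      ‖D.A w‖ ≤ ‖D.A w - Complex.I • D.K₀ w‖ ∧ (n + 1) * ‖D.R (D.A w)‖ ≤ ‖D.A w‖) :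
    ∃ S : ℂ → (H →ₗ.[ℂ] H),
      (∀ ξ : ℂ, (S ξ).IsUnbounded ∧ (S ξ).IsCoercive ∧ (S ξ).IsMSectorial α) ∧
      (∀ ξ : ℂ, (S ξ).domain ⊓ (S ξ).adjoint.domain = ⊥) ∧
      (∀ ξ : ℂ, (S ξ).msqrt.domain ≠ (S ξ).adjoint.msqrt.domain) ∧
      (∃ Q : H →ₗ.[ℂ] H, ∀ ξ : ℂ, (S ξ).invSqrt.rePart = Q) ∧
      (∀ ξ ζ : ℂ, ξ ≠ ζ → (S ξ).invSqrt.imPart.ran ⊓ (S ζ).invSqrt.imPart.ran = ⊥) := by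
  refine ⟨D.family J, D.family_spec J hα, D.family_domain_inf J, fun ξ => ?_,
    ⟨_, D.family_rePart J hα⟩, fun ξ ζ h => D.family_imPart_ran_inf J hα h⟩
  have hT := D.isSectorialRoot_T_discMap J ξ
  rw [family, hT.msqrt_eq hα, hT.adjoint_msqrt_eq hα]
  exact D.range_T_ne J (norm_discMap_le ξ) hT.adjoint.injective hD

/-- The norm-resolvent continuous family with constant form domain. -/
theorem exists_family_sqrt_domain_eq (J : Doubling H) (hα : 0 < Real.tan α) (hK₀ : D.K₀ = 0) :
    ∃ X : ℂ → (H →ₗ.[ℂ] H),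
      LinearPMap.NormResolventContinuous X ∧
      (∀ ξ : ℂ, (X ξ).IsUnbounded ∧ (X ξ).IsCoercive ∧ (X ξ).IsMSectorial α) ∧
      (∀ ξ : ℂ, (X ξ).domain ⊓ (X ξ).adjoint.domain = ⊥) ∧
      (∃ D : Submodule ℂ H, ∀ ξ : ℂ,
        (X ξ).msqrt.domain = D ∧ (X ξ).adjoint.msqrt.domain = D) ∧
      (∀ ξ : ℂ, Dense ((X ξ).invSqrt.imPart.ran : Set H)) ∧
      (∀ ξ ζ : ℂ, ξ ≠ ζ → (X ξ).invSqrt.imPart.ran ⊓ (X ζ).invSqrt.imPart.ran = ⊥) ∧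
      (∃ L : Submodule ℂ H, ∀ ξ ζ : ℂ, ξ ≠ ζ →
        (X ξ).invSqrt.imPart.ran ⊔ (X ζ).invSqrt.imPart.ran = L) := by
  refine ⟨D.family J, ?_, D.family_spec J hα, D.family_domain_inf J,
    ⟨LinearMap.range (D.Q J).toLinearMap, fun ξ => ?_⟩, fun ξ => ?_,
    fun ξ ζ h => D.family_imPart_ran_inf J hα h, ⟨D.rangeSum J, fun ξ ζ h => ?_⟩⟩
  · have hc : Continuous fun ξ => D.T J (discMap ξ) := (D.continuous_T J).comp continuous_discMap
    exact normResolventContinuous_invPMap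
      (fun ξ => (D.isSectorialRoot_T_discMap J ξ).injective_sq) (hc.mul hc)
  · have hT := D.isSectorialRoot_T_discMap J ξ
    rw [family, hT.msqrt_eq hα, hT.adjoint_msqrt_eq hα]
    exact ⟨domain_invPMap_T J hK₀ (norm_discMap_le ξ),
      domain_invPMap_T_adjoint J hK₀ (norm_discMap_le ξ)⟩
  · rw [family_imPart_ran D J hα]
    exact D.dense_range_K J _
  · rw [family_imPart_ran D J hα, family_imPart_ran D J hα]
    exact range_K_sup J hK₀ (discMap_injective.ne h)

end CouplingData

end

/-! ### Hilbert's inequality. -/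

noncomputable section

section HilbertInequality

open Complex Finset

theorem integral_exp_two_pi (m : ℤ) (hm : m ≠ 0) :
    ∫ t in (0 : ℝ)..1, Complex.exp (2 * Real.pi * I * m * t) = 0 := by
  have hc : (2 * Real.pi * I * m : ℂ) ≠ 0 := by
    simp [hm, Real.pi_ne_zero]
  rw [integral_exp_mul_complex hc]
  have h : Complex.exp (2 * Real.pi * I * m * (1 : ℝ)) = 1 := by
    rw [Complex.exp_eq_one_iff]
    exact ⟨m, by push_cast; ring⟩
  rw [h]
  simp

theorem integral_mul_exp_two_pi (m : ℤ) (hm : m ≠ 0) :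
    ∫ t in (0 : ℝ)..1, (t : ℂ) * Complex.exp (2 * Real.pi * I * m * t) =
      1 / (2 * Real.pi * I * m) := by
  set c : ℂ := 2 * Real.pi * I * m with hcdef
  have hc : c ≠ 0 := by
    simp [hcdef, hm, Real.pi_ne_zero]
  have hd : ∀ t : ℝ, HasDerivAt (fun t : ℝ => ((t : ℂ) / c - 1 / c ^ 2) * Complex.exp (c * t))
      ((t : ℂ) * Complex.exp (c * t)) t := by
    intro t
    have h1 : HasDerivAt (fun t : ℂ => (t / c - 1 / c ^ 2) * Complex.exp (c * t))
        ((t : ℂ) * Complex.exp (c * t)) (t : ℂ) := by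
      have h2 : HasDerivAt (fun t : ℂ => t / c - 1 / c ^ 2) (1 / c) (t : ℂ) :=
        ((hasDerivAt_id (t : ℂ)).div_const c).sub_const _
      have h3 : HasDerivAt (fun t : ℂ => Complex.exp (c * t)) (Complex.exp (c * t) * (c * 1))
          (t : ℂ) := ((hasDerivAt_id (t : ℂ)).const_mul c).cexp
      refine (h2.mul h3).congr_deriv ?_
      have h4 : c / c ^ 2 = 1 / c := by field_simp
      have h5 : c * (1 / c) = 1 := by field_simp
      clear_value c
      linear_combination (-Complex.exp (c * t)) * h4 + t * Complex.exp (c * t) * h5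
    exact h1.comp_ofReal
  rw [intervalIntegral.integral_eq_sub_of_hasDerivAt (fun t _ => hd t)]
  · have h : Complex.exp (c * (1 : ℝ)) = 1 := by
      rw [Complex.exp_eq_one_iff]
      exact ⟨m, by rw [hcdef]; push_cast; ring⟩
    rw [h]
    simp
  · exact Continuous.intervalIntegrable (by fun_prop) _ _

/-- The trigonometric polynomial with coefficients `V 0, …, V (N - 1)`. -/
def trigPoly (V : ℕ → ℂ) (N : ℕ) (t : ℝ) : ℂ :=
  ∑ j ∈ range N, V j * Complex.exp (2 * Real.pi * I * j * t)

theorem continuous_trigPoly (V : ℕ → ℂ) (N : ℕ) : Continuous (trigPoly V N) := by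
  unfold trigPoly
  fun_prop

theorem norm_sq_trigPoly (V : ℕ → ℂ) (N : ℕ) (t : ℝ) :
    ((‖trigPoly V N t‖ ^ 2 : ℝ) : ℂ) = ∑ j ∈ range N, ∑ k ∈ range N,
      (starRingEnd ℂ (V j) * V k) * Complex.exp (2 * Real.pi * I * ((k : ℤ) - (j : ℤ) : ℤ) * t) := by
  rw [← Complex.normSq_eq_norm_sq, Complex.normSq_eq_conj_mul_self, trigPoly, map_sum,
    sum_mul_sum]
  refine sum_congr rfl fun j _ => sum_congr rfl fun k _ => ?_
  rw [map_mul, ← Complex.exp_conj]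
  have h : starRingEnd ℂ (2 * Real.pi * I * j * t) = -(2 * Real.pi * I * j * t) := by
    simp only [map_mul, Complex.conj_ofReal, Complex.conj_I, map_natCast, map_ofNat]
    ring
  rw [h]
  have h2 : (2 * Real.pi * I * ((k : ℤ) - (j : ℤ) : ℤ) * t : ℂ) =
      -(2 * Real.pi * I * j * t) + 2 * Real.pi * I * k * t := by
    push_cast; ring
  rw [h2, Complex.exp_add]
  ring

theorem integral_norm_sq_trigPoly (V : ℕ → ℂ) (N : ℕ) :
    ((∫ t in (0 : ℝ)..1, ‖trigPoly V N t‖ ^ 2 : ℝ) : ℂ) = ∑ j ∈ range N, ∑ k ∈ range N,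
      if j = k then starRingEnd ℂ (V j) * V k else 0 := by
  rw [← intervalIntegral.integral_ofReal]
  simp_rw [norm_sq_trigPoly]
  rw [intervalIntegral.integral_finsetSum]
  · refine sum_congr rfl fun j _ => ?_
    rw [intervalIntegral.integral_finsetSum]
    · refine sum_congr rfl fun k _ => ?_
      rw [intervalIntegral.integral_const_mul]
      split_ifs with h
      · subst h; simp
      · rw [integral_exp_two_pi _ (by omega), mul_zero]
    · exact fun k _ => Continuous.intervalIntegrable (by fun_prop) _ _
  · exact fun k _ => Continuous.intervalIntegrable (by fun_prop) _ _

theorem integral_mul_norm_sq_trigPoly (V : ℕ → ℂ) (N : ℕ) :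
    ((∫ t in (0 : ℝ)..1, t * ‖trigPoly V N t‖ ^ 2 : ℝ) : ℂ) = ∑ j ∈ range N, ∑ k ∈ range N,
      (starRingEnd ℂ (V j) * V k) *
        if j = k then 1 / 2 else 1 / (2 * Real.pi * I * ((k : ℤ) - (j : ℤ) : ℤ)) := by
  rw [← intervalIntegral.integral_ofReal]
  have h : ∀ t : ℝ, ((t * ‖trigPoly V N t‖ ^ 2 : ℝ) : ℂ) = ∑ j ∈ range N, ∑ k ∈ range N,
      (starRingEnd ℂ (V j) * V k) *
        (t * Complex.exp (2 * Real.pi * I * ((k : ℤ) - (j : ℤ) : ℤ) * t)) := by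
    intro t
    rw [Complex.ofReal_mul, norm_sq_trigPoly, mul_sum]
    refine sum_congr rfl fun j _ => ?_
    rw [mul_sum]
    exact sum_congr rfl fun k _ => by ring
  simp_rw [h]
  rw [intervalIntegral.integral_finsetSum]
  · refine sum_congr rfl fun j _ => ?_
    rw [intervalIntegral.integral_finsetSum]
    · refine sum_congr rfl fun k _ => ?_
      rw [intervalIntegral.integral_const_mul]
      split_ifs with h
      · subst h
        have h2 : ∫ x in (0 : ℝ)..1, (x : ℂ) = 1 / 2 := by
          rw [intervalIntegral.integral_ofReal, integral_id]
          norm_num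
        simp [h2]
      · rw [integral_mul_exp_two_pi _ (by omega)]
    · exact fun k _ => Continuous.intervalIntegrable (by fun_prop) _ _
  · exact fun k _ => Continuous.intervalIntegrable (by fun_prop) _ _

/-- Hilbert's inequality. -/
theorem abs_im_hilbert_sum_le (V : ℕ → ℂ) (N : ℕ) :
    |(∑ j ∈ range N, ∑ k ∈ range N,
      if j < k then starRingEnd ℂ (V j) * V k / ((k : ℂ) - j) else 0).im| ≤
      Real.pi / 2 * ∑ j ∈ range N, ‖V j‖ ^ 2 := by
  set B := ∑ j ∈ range N, ‖V j‖ ^ 2 with hB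
  have h0 : ∫ t in (0 : ℝ)..1, ‖trigPoly V N t‖ ^ 2 = B := by
    have h := integral_norm_sq_trigPoly V N
    have h1 : ∀ j ∈ range N, (∑ k ∈ range N, if j = k then starRingEnd ℂ (V j) * V k else 0) =
        ((‖V j‖ ^ 2 : ℝ) : ℂ) := by
      intro j hj
      rw [sum_ite_eq, if_pos hj, ← Complex.normSq_eq_norm_sq, Complex.normSq_eq_conj_mul_self]
    rw [sum_congr rfl h1, ← Complex.ofReal_sum] at h
    exact Complex.ofReal_injective h
  have hcont := continuous_trigPoly V N
  -- The weight `t` lies in `[0, 1]`, so the weighted integral of `|p|²` lies between `0` and `B`.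
  have hl : 0 ≤ ∫ t in (0 : ℝ)..1, t * ‖trigPoly V N t‖ ^ 2 := by
    refine intervalIntegral.integral_nonneg zero_le_one fun t ht => ?_
    exact mul_nonneg ht.1 (sq_nonneg _)
  have hu : ∫ t in (0 : ℝ)..1, t * ‖trigPoly V N t‖ ^ 2 ≤ B := by
    rw [← h0]
    refine intervalIntegral.integral_mono_on zero_le_one
      (Continuous.intervalIntegrable (by fun_prop) _ _)
      (Continuous.intervalIntegrable (by fun_prop) _ _) fun t ht => ?_
    exact mul_le_of_le_one_left (sq_nonneg _) ht.2
  have key := congrArg Complex.re (integral_mul_norm_sq_trigPoly V N)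
  rw [Complex.ofReal_re] at key
  set S := ∑ j ∈ range N, ∑ k ∈ range N,
      if j < k then starRingEnd ℂ (V j) * V k / ((k : ℂ) - j) else 0 with hS
  set g : ℕ → ℕ → ℝ := fun j k =>
    if j < k then (starRingEnd ℂ (V j) * V k / ((k : ℂ) - j)).im / (2 * Real.pi) else 0 with hg
  have hgS : ∑ j ∈ range N, ∑ k ∈ range N, g j k = S.im / (2 * Real.pi) := by
    rw [hS, Complex.im_sum, sum_div]
    refine sum_congr rfl fun j _ => ?_
    rw [Complex.im_sum, sum_div]
    refine sum_congr rfl fun k _ => ?_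
    simp only [hg]
    split_ifs <;> simp
  -- The Fourier coefficients of `t` are `1/2` on the diagonal and `1/(2πi(k - j))` off it; the
  -- entries at `(j, k)` and `(k, j)` are conjugate and have the same real part.
  have hterm : ∀ j k : ℕ, ((starRingEnd ℂ (V j) * V k) *
      if j = k then 1 / 2 else 1 / (2 * Real.pi * I * ((k : ℤ) - (j : ℤ) : ℤ))).re =
      (if j = k then ‖V j‖ ^ 2 / 2 else 0) + g j k + g k j := by
    intro j k
    have hlt : ∀ j k : ℕ, j < k → ((starRingEnd ℂ (V j) * V k) *
        (1 / (2 * Real.pi * I * ((k : ℤ) - (j : ℤ) : ℤ)))).re = g j k := by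
      intro j k hjk
      simp only [hg, if_pos hjk]
      have h1 : (starRingEnd ℂ (V j) * V k) *
        (1 / (2 * Real.pi * I * ((k : ℤ) - (j : ℤ) : ℤ))) =
        -I * ((starRingEnd ℂ (V j) * V k / ((k : ℂ) - j)) / ((2 * Real.pi : ℝ) : ℂ)) := by
        push_cast
        have h2 : ((k : ℂ) - j) ≠ 0 := sub_ne_zero.2 (by exact_mod_cast hjk.ne')
        have h3 : (Real.pi : ℂ) ≠ 0 := by exact_mod_cast Real.pi_ne_zero
        field_simp
        rw [Complex.I_sq]
        ring
      rw [h1]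
      simp only [Complex.mul_re, Complex.neg_re, Complex.neg_im, Complex.I_re, Complex.I_im,
        Complex.div_ofReal_im]
      ring
    rcases lt_trichotomy j k with h | h | h
    · rw [if_neg h.ne, if_neg h.ne, hlt j k h]
      simp [hg, not_lt.2 h.le]
    · subst h
      rw [if_pos rfl, if_pos rfl, ← Complex.normSq_eq_conj_mul_self]
      simp [hg, Complex.normSq_eq_norm_sq]
      norm_cast
    · rw [if_neg h.ne', if_neg h.ne']
      have h1 : (starRingEnd ℂ (V j) * V k) *
          (1 / (2 * Real.pi * I * ((k : ℤ) - (j : ℤ) : ℤ))) =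
          starRingEnd ℂ ((starRingEnd ℂ (V k) * V j) *
          (1 / (2 * Real.pi * I * ((j : ℤ) - (k : ℤ) : ℤ)))) := by
        simp only [map_mul, map_div₀, map_one, Complex.conj_conj, Complex.conj_ofReal,
          Complex.conj_I, map_ofNat, map_intCast]
        push_cast
        have h2 : (2 * Real.pi * -I * ((j : ℂ) - k)) = 2 * Real.pi * I * ((k : ℂ) - j) := by ring
        rw [h2]
        ring
      rw [h1, Complex.conj_re, hlt k j h]
      simp [hg, not_lt.2 h.le]
  -- The weighted integral equals `B/2 + Im S / π`; lying in `[0, B]`, it yields `|Im S| ≤ πB/2`.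
  have key2 : ∫ t in (0 : ℝ)..1, t * ‖trigPoly V N t‖ ^ 2 =
      B / 2 + S.im / (2 * Real.pi) + S.im / (2 * Real.pi) := by
    rw [key, Complex.re_sum]
    simp_rw [Complex.re_sum, hterm, sum_add_distrib]
    rw [hgS]
    congr 1
    · congr 1
      rw [hB, sum_div]
      refine sum_congr rfl fun j hj => ?_
      rw [sum_ite_eq, if_pos hj]
    · rw [sum_comm, hgS]
  rw [key2] at hl hu
  have hpi := Real.pi_pos
  have e : S.im / (2 * Real.pi) + S.im / (2 * Real.pi) = S.im / Real.pi := by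
    field_simp; ring
  rw [add_assoc, e] at hl hu
  rw [abs_le]
  constructor
  · have : -(B / 2) ≤ S.im / Real.pi := by linarith
    rw [le_div_iff₀ hpi] at this
    linarith
  · have : S.im / Real.pi ≤ B / 2 := by linarith
    rw [div_le_iff₀ hpi] at this
    linarith

end HilbertInequality

end

/-! ### Finite-dimensional blocks on which `Q + iK` is much smaller than `Q - iK`. -/

noncomputable section

open ContinuousLinearMap

/-- A positive contraction `Q` and a self-adjoint `K`, with `‖K u‖² ≤ (1 - ε) ‖Q u‖²`, such that
the numerical range of `(Q + i K)²` is in a thin sector (measured by `τ`), while `Q + i K` is much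
smaller (measured by `m`) than `Q - i K` on some vector. -/
structure SkewBlock (E : Type*) [NormedAddCommGroup E] [InnerProductSpace ℂ E] [CompleteSpace E]
    (τ m : ℝ) where
  Q : E →L[ℂ] E
  K : E →L[ℂ] E
  Q_adj : adjoint Q = Q
  K_adj : adjoint K = K
  Q_pos : ∀ x, x ≠ 0 → 0 < (inner ℂ x (Q x)).re
  norm_Q : ∀ x, ‖Q x‖ ≤ ‖x‖
  ε : ℝ
  ε_pos : 0 < ε
  ε_le : ε ≤ 1
  norm_K : ∀ x, ‖K x‖ ^ 2 ≤ ‖Q x‖ ^ 2 - ε * ‖Q x‖ ^ 2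
  inner_K : ∀ x, 2 * |(inner ℂ (Q x) (K x)).re| ≤ τ * (ε * ‖Q x‖ ^ 2)
  w : E
  Q_w : Q w ≠ 0
  norm_add : m * ‖Q w + Complex.I • K w‖ ≤ ‖Q w‖
  norm_sub : ‖Q w‖ ≤ ‖Q w - Complex.I • K w‖

section Construction

variable {E : Type*} [NormedAddCommGroup E] [InnerProductSpace ℂ E] [CompleteSpace E]

/-- A skew block from an almost triangular contraction `y`. -/
def SkewBlock.ofTriangular {τ m : ℝ} (hm : 1 ≤ m) (y d f : E →L[ℂ] E) (hd : adjoint d = d)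
    (hyd : y * d = d * f) (hdpos : ∀ x, x ≠ 0 → 0 < (inner ℂ x (d x)).re)
    (hdn : ∀ x, ‖d x‖ ≤ ‖x‖) {ε η σ ρ : ℝ} (hε : 0 < ε) (hε1 : ε ≤ 1 / 2)
    (hy : ∀ v, ‖y v‖ ≤ (1 - 2 * ε) * ‖v‖) (hf : ∀ v, ‖adjoint f v‖ ≤ η * ‖v‖)
    (hη : η ≤ ε) (hητ : 4 * η ≤ τ * ε) (hηm : 2 * m * η ≤ 1)
    (hσ : ∀ v, |(inner ℂ v (y v)).im| ≤ σ * ‖v‖ ^ 2) (hστ : 4 * σ ≤ τ * ε)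
    (w : E) (hw : d w ≠ 0) (hρw : ρ * ‖d w‖ ^ 2 ≤ (inner ℂ (d w) (y (d w))).re)
    (hρ : 8 * m ^ 2 * (1 - ρ) ≤ 1) (hρη : η ≤ ρ) : SkewBlock E τ m :=
  -- The adjoint of `yd = df` is `d y* = f* d`. Hence `K = i(y - f*)d`, and up to the small `f*` one
  -- has `Q + iK ≈ (1 - y)d` and `Q - iK ≈ (1 + y)d`.
  have hKx : ∀ x, (Complex.I • (y * d - d * adjoint y)) x =
      Complex.I • (y (d x) - adjoint f (d x)) := fun x => by
    have h1 : d * adjoint y = adjoint f * d := by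
      have h2 : adjoint (y * d) = adjoint (d * f) := by rw [hyd]
      have h3 : adjoint (y * d) = adjoint d * adjoint y := adjoint_comp y d
      have h4 : adjoint (d * f) = adjoint f * adjoint d := adjoint_comp d f
      rw [h3, h4, hd] at h2
      exact h2
    rw [h1]; rfl
  { Q := d
    K := Complex.I • (y * d - d * adjoint y)
    Q_adj := hd
    K_adj := by
      have h3 : adjoint (y * d) = adjoint d * adjoint y := adjoint_comp y d
      have h4 : adjoint (d * adjoint y) = adjoint (adjoint y) * adjoint d :=
        adjoint_comp d (adjoint y)
      rw [map_smulₛₗ, map_sub, h3, h4, adjoint_adjoint, hd, Complex.conj_I, neg_smul, ← smul_neg,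
        neg_sub]
    Q_pos := hdpos
    norm_Q := hdn
    ε := ε
    ε_pos := hε
    ε_le := by linarith
    norm_K := fun x => by
      rw [hKx, norm_smul, Complex.norm_I, one_mul]
      have h1 := norm_sub_le (y (d x)) (adjoint f (d x))
      have h2 := hy (d x)
      have h3 := hf (d x)
      have h4 : ‖y (d x) - adjoint f (d x)‖ ≤ (1 - ε) * ‖d x‖ := by
        nlinarith [norm_nonneg (d x)]
      calc _ ≤ ((1 - ε) * ‖d x‖) ^ 2 := by gcongr
        _ ≤ _ := by nlinarith [sq_nonneg ‖d x‖, mul_nonneg hε.le (sq_nonneg ‖d x‖)]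
    inner_K := fun x => by
      rw [hKx, inner_smul_right, inner_sub_right]
      have h1 := hσ (d x)
      have h2 : |(inner ℂ (d x) (adjoint f (d x))).im| ≤ η * ‖d x‖ ^ 2 := by
        refine (Complex.abs_im_le_norm _).trans ((norm_inner_le_norm _ _).trans ?_)
        have h3 := mul_le_mul_of_nonneg_left (hf (d x)) (norm_nonneg (d x))
        linarith
      have h3 : (Complex.I * (inner ℂ (d x) (y (d x)) - inner ℂ (d x) (adjoint f (d x)))).re =
          (inner ℂ (d x) (adjoint f (d x))).im - (inner ℂ (d x) (y (d x))).im := by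
        simp
      rw [h3]
      have h4 := abs_sub (inner ℂ (d x) (adjoint f (d x))).im (inner ℂ (d x) (y (d x))).im
      nlinarith [sq_nonneg ‖d x‖]
    w := w
    Q_w := hw
    norm_add := by
      rw [hKx, smul_smul, Complex.I_mul_I, neg_one_smul]
      set v := d w
      have h1 : v + -(y v - adjoint f v) = (v - y v) + adjoint f v := by abel
      have h2 := norm_add_le (v - y v) (adjoint f v)
      have h3 := hf v
      -- As `‖yv‖ ≤ ‖v‖` and `Re (v, yv) ≥ ρ‖v‖²`, the square of `‖v - yv‖` is at most `2(1 -
      -- ρ)‖v‖²`: `y` almost fixes `v`.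
      have h4 : 2 * m * ‖v - y v‖ ≤ ‖v‖ := by
        refine le_of_sq_le_sq ?_ (norm_nonneg v)
        rw [mul_pow, norm_sub_sq (𝕜 := ℂ)]
        change _ * (_ - 2 * (inner ℂ v (y v)).re + _) ≤ _
        have h5 : ‖y v‖ ^ 2 ≤ ‖v‖ ^ 2 := by
          refine pow_le_pow_left₀ (norm_nonneg _) ((hy v).trans ?_) 2
          nlinarith [norm_nonneg v]
        have h6 : ‖v‖ ^ 2 - 2 * (inner ℂ v (y v)).re + ‖y v‖ ^ 2 ≤ 2 * (1 - ρ) * ‖v‖ ^ 2 := by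
          linarith
        calc _ ≤ (2 * m) ^ 2 * (2 * (1 - ρ) * ‖v‖ ^ 2) := by gcongr
          _ = 8 * m ^ 2 * (1 - ρ) * ‖v‖ ^ 2 := by ring
          _ ≤ 1 * ‖v‖ ^ 2 := by gcongr
          _ = _ := one_mul _
      rw [h1]
      have h7 : m * ‖v - y v + adjoint f v‖ ≤ m * (‖v - y v‖ + η * ‖v‖) := by
        gcongr
        linarith
      have h8 : 2 * m * η * ‖v‖ ≤ 1 * ‖v‖ := by gcongr
      linarith
    norm_sub := by
      rw [hKx, smul_smul, Complex.I_mul_I, neg_one_smul, sub_neg_eq_add]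
      set v := d w
      have h0 : 0 < ‖v‖ := norm_pos_iff.2 hw
      have h1 : ‖v‖ ^ 2 ≤ (inner ℂ v (v + (y v - adjoint f v))).re := by
        rw [inner_add_right, inner_sub_right, Complex.add_re, Complex.sub_re, re_inner_self_eq]
        have h2 : (inner ℂ v (adjoint f v)).re ≤ η * ‖v‖ ^ 2 := by
          refine (Complex.re_le_norm _).trans ((norm_inner_le_norm _ _).trans ?_)
          have h3 := mul_le_mul_of_nonneg_left (hf v) h0.le
          linarith
        nlinarith [sq_nonneg ‖v‖]
      have h2 := (Complex.re_le_norm _).trans (norm_inner_le_norm (𝕜 := ℂ) v (v + (y v - adjoint f v)))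
      have h3 := h1.trans h2
      rw [sq] at h3
      exact le_of_mul_le_mul_left h3 h0 }

end Construction

/-! ### The truncated shift and its logarithm. -/

section Shift

variable {N : ℕ}

/-- Extension by zero of a vector of `ℂ^N` to a sequence. -/
def zeroExtend (v : EuclideanSpace ℂ (Fin N)) (j : ℕ) : ℂ :=
  if h : j < N then v ⟨j, h⟩ else 0

theorem zeroExtend_fin (v : EuclideanSpace ℂ (Fin N)) (j : Fin N) : zeroExtend v j = v j := by
  simp [zeroExtend]

theorem zeroExtend_of_le (v : EuclideanSpace ℂ (Fin N)) {j : ℕ} (h : N ≤ j) :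
    zeroExtend v j = 0 := by
  simp [zeroExtend, not_lt.2 h]

theorem norm_sq_eq_sum_zeroExtend (v : EuclideanSpace ℂ (Fin N)) :
    ‖v‖ ^ 2 = ∑ j ∈ Finset.range N, ‖zeroExtend v j‖ ^ 2 := by
  rw [EuclideanSpace.norm_sq_eq, ← Fin.sum_univ_eq_sum_range fun j => ‖zeroExtend v j‖ ^ 2]
  simp_rw [zeroExtend_fin]

theorem inner_eq_sum_zeroExtend (v u : EuclideanSpace ℂ (Fin N)) :
    inner ℂ v u = ∑ j ∈ Finset.range N, starRingEnd ℂ (zeroExtend v j) * zeroExtend u j := by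
  rw [PiLp.inner_apply,
    ← Fin.sum_univ_eq_sum_range fun j => starRingEnd ℂ (zeroExtend v j) * zeroExtend u j]
  simp_rw [zeroExtend_fin]
  exact Finset.sum_congr rfl fun j _ => by rw [RCLike.inner_apply, mul_comm]

variable (N)

/-- The truncated backward shift on `ℂ^N`. -/
def truncShift : EuclideanSpace ℂ (Fin N) →L[ℂ] EuclideanSpace ℂ (Fin N) :=
  LinearMap.toContinuousLinearMap
    { toFun := fun v => WithLp.toLp 2 fun j : Fin N => zeroExtend v (j + 1)
      map_add' := fun v u => by
        ext j
        simp only [zeroExtend, PiLp.add_apply]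
        split_ifs <;> simp
      map_smul' := fun c v => by
        ext j
        simp only [zeroExtend, PiLp.smul_apply, RingHom.id_apply]
        split_ifs <;> simp }

/-- The diagonal operator with entries `δ ^ j`. -/
def geomDiag (δ : ℝ) : EuclideanSpace ℂ (Fin N) →L[ℂ] EuclideanSpace ℂ (Fin N) :=
  LinearMap.toContinuousLinearMap
    { toFun := fun v => WithLp.toLp 2 fun j : Fin N => ((δ ^ (j : ℕ) : ℝ) : ℂ) * v j
      map_add' := fun v u => by
        ext j
        simp [mul_add]
      map_smul' := fun c v => by
        ext j
        simp only [PiLp.smul_apply, RingHom.id_apply, smul_eq_mul]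
        ring }

variable {N}

theorem truncShift_apply (v : EuclideanSpace ℂ (Fin N)) (j : Fin N) :
    truncShift N v j = zeroExtend v (j + 1) := rfl

theorem geomDiag_apply (δ : ℝ) (v : EuclideanSpace ℂ (Fin N)) (j : Fin N) :
    geomDiag N δ v j = ((δ ^ (j : ℕ) : ℝ) : ℂ) * v j := rfl

theorem zeroExtend_truncShift (v : EuclideanSpace ℂ (Fin N)) (j : ℕ) :
    zeroExtend (truncShift N v) j = zeroExtend v (j + 1) := by
  by_cases h : j < N
  · exact (zeroExtend_fin _ ⟨j, h⟩).trans (truncShift_apply v ⟨j, h⟩)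
  · rw [zeroExtend_of_le _ (not_lt.1 h), zeroExtend_of_le _ (by omega)]

theorem zeroExtend_truncShift_pow (v : EuclideanSpace ℂ (Fin N)) (m j : ℕ) :
    zeroExtend ((truncShift N ^ m) v) j = zeroExtend v (j + m) := by
  induction m generalizing j with
  | zero => rfl
  | succ m ih =>
    rw [pow_succ']
    change zeroExtend (truncShift N ((truncShift N ^ m) v)) j = _
    rw [zeroExtend_truncShift, ih]
    congr 1
    omega

theorem norm_truncShift_le : ‖truncShift N‖ ≤ 1 := by
  refine opNorm_le_bound _ zero_le_one fun v => ?_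
  rw [one_mul]
  refine le_of_sq_le_sq ?_ (norm_nonneg _)
  rw [norm_sq_eq_sum_zeroExtend, norm_sq_eq_sum_zeroExtend]
  simp_rw [zeroExtend_truncShift]
  have h1 := Finset.sum_range_succ' (fun j => ‖zeroExtend v j‖ ^ 2) N
  have h2 := Finset.sum_range_succ (fun j => ‖zeroExtend v j‖ ^ 2) N
  rw [zeroExtend_of_le v le_rfl, norm_zero] at h2
  have h3 := sq_nonneg ‖zeroExtend v 0‖
  linarith

theorem norm_truncShift_pow_le (m : ℕ) : ‖truncShift N ^ (m + 1)‖ ≤ 1 :=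
  (norm_pow_le' _ m.succ_pos).trans (pow_le_one₀ (norm_nonneg _) norm_truncShift_le)

/-- The shift lowers the index by one and the weights are geometric, so each passage costs a factor
`δ`. Hence moving the diagonal across a polynomial in the shift without constant term makes it
small. -/
theorem truncShift_mul_geomDiag (δ : ℝ) :
    truncShift N * geomDiag N δ = (δ : ℂ) • (geomDiag N δ * truncShift N) := by
  ext v j
  change truncShift N (geomDiag N δ v) j = (δ : ℂ) * geomDiag N δ (truncShift N v) j
  rw [truncShift_apply, geomDiag_apply, truncShift_apply]
  by_cases h : (j : ℕ) + 1 < N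
  · simp only [zeroExtend, dif_pos h, geomDiag_apply]
    push_cast
    ring
  · rw [zeroExtend_of_le _ (not_lt.1 h), zeroExtend_of_le _ (not_lt.1 h)]
    simp

theorem truncShift_pow_mul_geomDiag (δ : ℝ) (m : ℕ) :
    truncShift N ^ m * geomDiag N δ = geomDiag N δ * ((δ : ℂ) ^ m • truncShift N ^ m) := by
  induction m with
  | zero => simp
  | succ m ih =>
    rw [pow_succ', mul_assoc, ih, ← mul_assoc, truncShift_mul_geomDiag, smul_mul_assoc, mul_assoc,
      mul_smul_comm, mul_smul_comm, mul_smul_comm, smul_smul, ← pow_succ']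

theorem geomDiag_adj (δ : ℝ) : adjoint (geomDiag N δ) = geomDiag N δ := by
  ext1 u
  refine ext_inner_left ℂ fun v => ?_
  rw [adjoint_inner_right, PiLp.inner_apply, PiLp.inner_apply]
  refine Finset.sum_congr rfl fun j _ => ?_
  simp only [geomDiag_apply, RCLike.inner_apply, map_mul, Complex.conj_ofReal]
  ring

theorem geomDiag_pos {δ : ℝ} (hδ : 0 < δ) (v : EuclideanSpace ℂ (Fin N)) (hv : v ≠ 0) :
    0 < (inner ℂ v (geomDiag N δ v)).re := by
  have h : ∀ j, (inner ℂ (v j) (geomDiag N δ v j) : ℂ).re = δ ^ (j : ℕ) * ‖v j‖ ^ 2 := by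
    intro j
    rw [geomDiag_apply, RCLike.inner_apply, mul_assoc, Complex.mul_conj, ← Complex.ofReal_mul,
      Complex.ofReal_re, Complex.normSq_eq_norm_sq]
  rw [PiLp.inner_apply, Complex.re_sum]
  simp_rw [h]
  obtain ⟨j, hj⟩ : ∃ j, v j ≠ 0 := by
    by_contra hne
    push Not at hne
    exact hv (by ext j; exact hne j)
  refine Finset.sum_pos' (fun i _ => by positivity) ⟨j, Finset.mem_univ j, ?_⟩
  have := norm_pos_iff.2 hj
  positivity

theorem norm_geomDiag_le {δ : ℝ} (hδ : 0 ≤ δ) (hδ1 : δ ≤ 1) (v : EuclideanSpace ℂ (Fin N)) :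
    ‖geomDiag N δ v‖ ≤ ‖v‖ := by
  refine le_of_sq_le_sq ?_ (norm_nonneg _)
  rw [EuclideanSpace.norm_sq_eq, EuclideanSpace.norm_sq_eq]
  refine Finset.sum_le_sum fun j _ => ?_
  rw [geomDiag_apply, norm_mul, Complex.norm_real, Real.norm_of_nonneg (by positivity)]
  have h1 : δ ^ (j : ℕ) ≤ 1 := pow_le_one₀ hδ hδ1
  gcongr
  exact mul_le_of_le_one_left (norm_nonneg _) h1

/-- The operator `∑_{m ≤ M} zᵐ sᵐ / m` for the truncated shift `s`. -/
def truncLog (N M : ℕ) (z : ℂ) : EuclideanSpace ℂ (Fin N) →L[ℂ] EuclideanSpace ℂ (Fin N) :=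
  ∑ m ∈ Finset.range M, (z ^ (m + 1) / ((m : ℂ) + 1)) • truncShift N ^ (m + 1)

/-- Used at `z = 1`, where the bound is the harmonic number, and at a small `δ`, where the common
factor `δ` outweighs it. -/
theorem norm_truncLog_le (M : ℕ) {δ : ℝ} (hδ : 0 ≤ δ) (hδ1 : δ ≤ 1) :
    ‖truncLog N M (δ : ℂ)‖ ≤ δ * ∑ m ∈ Finset.range M, 1 / ((m : ℝ) + 1) := by
  rw [truncLog, Finset.mul_sum]
  refine (norm_sum_le _ _).trans (Finset.sum_le_sum fun m _ => ?_)
  rw [norm_smul]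
  have h1 : ‖((δ : ℂ) ^ (m + 1) / ((m : ℂ) + 1))‖ = δ ^ (m + 1) / ((m : ℝ) + 1) := by
    rw [norm_div, norm_pow, Complex.norm_real, Real.norm_of_nonneg hδ]
    congr 1
    have : ((m : ℂ) + 1) = ((m + 1 : ℕ) : ℂ) := by push_cast; rfl
    rw [this, Complex.norm_natCast]
    push_cast; rfl
  rw [h1]
  have h2 : δ ^ (m + 1) ≤ δ := pow_le_of_le_one hδ hδ1 (Nat.succ_ne_zero m)
  calc δ ^ (m + 1) / ((m : ℝ) + 1) * ‖truncShift N ^ (m + 1)‖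
      ≤ δ ^ (m + 1) / ((m : ℝ) + 1) * 1 := by gcongr; exact norm_truncShift_pow_le m
    _ ≤ δ / ((m : ℝ) + 1) := by rw [mul_one]; gcongr
    _ = δ * (1 / ((m : ℝ) + 1)) := by ring

theorem truncLog_mul_geomDiag (M : ℕ) (δ : ℝ) :
    truncLog N M 1 * geomDiag N δ = geomDiag N δ * truncLog N M (δ : ℂ) := by
  rw [truncLog, truncLog, Finset.sum_mul, Finset.mul_sum]
  refine Finset.sum_congr rfl fun m _ => ?_
  rw [smul_mul_assoc, truncShift_pow_mul_geomDiag, mul_smul_comm, mul_smul_comm, smul_smul,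
    one_pow]
  congr 1
  ring

theorem inner_truncLog (M : ℕ) (v : EuclideanSpace ℂ (Fin N)) :
    inner ℂ v (truncLog N M 1 v) = ∑ j ∈ Finset.range N, ∑ m ∈ Finset.range M,
      starRingEnd ℂ (zeroExtend v j) * zeroExtend v (j + (m + 1)) / ((m : ℂ) + 1) := by
  rw [truncLog, sum_apply, inner_sum, Finset.sum_comm]
  refine Finset.sum_congr rfl fun m _ => ?_
  rw [smul_apply, inner_smul_right, inner_eq_sum_zeroExtend, Finset.mul_sum, one_pow]
  refine Finset.sum_congr rfl fun j _ => ?_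
  rw [zeroExtend_truncShift_pow]
  ring

theorem sum_range_eq_of_shift {f g : ℕ → ℂ} {j : ℕ} (hj : j < N)
    (hf : ∀ m, N ≤ j + (m + 1) → f m = 0) (hg : ∀ k, k ≤ j → g k = 0)
    (hfg : ∀ m, g (j + (m + 1)) = f m) :
    ∑ m ∈ Finset.range N, f m = ∑ k ∈ Finset.range N, g k := by
  obtain ⟨r, hr⟩ : ∃ r, N = r + (j + 1) := ⟨N - (j + 1), by omega⟩
  have h1 : ∑ m ∈ Finset.range N, f m = ∑ m ∈ Finset.range r, f m := by
    rw [hr, Finset.sum_range_add, add_eq_left]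
    exact Finset.sum_eq_zero fun m _ => hf _ (by omega)
  have h2 : ∑ k ∈ Finset.range N, g k = ∑ m ∈ Finset.range r, g (j + 1 + m) := by
    rw [hr, add_comm r, Finset.sum_range_add, add_eq_right]
    exact Finset.sum_eq_zero fun k hk => hg _ (by rw [Finset.mem_range] at hk; omega)
  rw [h1, h2]
  refine Finset.sum_congr rfl fun m _ => ?_
  rw [← hfg]
  congr 1
  omega

/-- Substituting `k = j + m + 1` turns the form into the sum in Hilbert's inequality, so the bound
does not depend on `N`. -/
theorem abs_im_inner_truncLog_le (v : EuclideanSpace ℂ (Fin N)) :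
    |(inner ℂ v (truncLog N N 1 v)).im| ≤ Real.pi / 2 * ‖v‖ ^ 2 := by
  have h := abs_im_hilbert_sum_le (zeroExtend v) N
  rw [norm_sq_eq_sum_zeroExtend]
  convert h using 3
  rw [inner_truncLog]
  refine Finset.sum_congr rfl fun j hj => ?_
  rw [Finset.mem_range] at hj
  refine sum_range_eq_of_shift hj (fun m hm => ?_) (fun k hk => if_neg (by omega)) fun m => ?_
  · rw [zeroExtend_of_le _ hm]
    simp
  · rw [if_pos (by omega)]
    push_cast
    congr 1
    ring

/-- There are `N - (m + 1)` pairs of indices at distance `m + 1`, each contributing `1/(m + 1)`,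
which gives `N/(m + 1) - 1` for every `m`. -/
theorem re_inner_truncLog_ones :
    (N : ℝ) * ((∑ m ∈ Finset.range N, 1 / ((m : ℝ) + 1)) - 1) ≤
      (inner ℂ (WithLp.toLp 2 fun _ : Fin N => (1 : ℂ))
        (truncLog N N 1 (WithLp.toLp 2 fun _ : Fin N => (1 : ℂ)))).re := by
  set v : EuclideanSpace ℂ (Fin N) := WithLp.toLp 2 fun _ : Fin N => (1 : ℂ) with hv
  have h1 : ∀ j, zeroExtend v j = if j < N then 1 else 0 := by
    intro j
    simp [zeroExtend, hv]
  rw [inner_truncLog, Finset.sum_comm, Complex.re_sum]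
  have h2 : ∀ m ∈ Finset.range N, (N : ℝ) * (1 / ((m : ℝ) + 1)) - 1 =
      (∑ j ∈ Finset.range N, starRingEnd ℂ (zeroExtend v j) * zeroExtend v (j + (m + 1)) /
        ((m : ℂ) + 1)).re := by
    intro m hm
    rw [Finset.mem_range] at hm
    obtain ⟨r, hr⟩ : ∃ r, N = r + (m + 1) := ⟨N - (m + 1), by omega⟩
    have h3 : ∀ j ∈ Finset.range N, starRingEnd ℂ (zeroExtend v j) * zeroExtend v (j + (m + 1)) /
        ((m : ℂ) + 1) = if j < r then 1 / ((m : ℂ) + 1) else 0 := by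
      intro j hj
      rw [Finset.mem_range] at hj
      rw [h1, h1, if_pos hj]
      by_cases h : j < r
      · rw [if_pos h, if_pos (by omega)]; simp
      · rw [if_neg h, if_neg (by omega)]; simp
    rw [Finset.sum_congr rfl h3, hr, Finset.sum_range_add, Finset.sum_congr rfl
      (g := fun _ => 1 / ((m : ℂ) + 1)) (fun j hj => if_pos (Finset.mem_range.1 hj)),
      Finset.sum_eq_zero (s := Finset.range (m + 1)) (fun j _ => if_neg (by omega)), add_zero,
      Finset.sum_const, Finset.card_range, nsmul_eq_mul]
    have h4 : ((r : ℂ) * (1 / ((m : ℂ) + 1))) = ((r * (1 / ((m : ℝ) + 1)) : ℝ) : ℂ) := by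
      push_cast; rfl
    rw [h4, Complex.ofReal_re]
    have h5 : (m : ℝ) + 1 ≠ 0 := by positivity
    push_cast
    field_simp
    ring
  rw [← Finset.sum_congr rfl h2, Finset.sum_sub_distrib, ← Finset.mul_sum, Finset.sum_const,
    Finset.card_range, nsmul_eq_mul]
  linarith

end Shift

end

/-! ### Choice of the parameters of a skew block. -/

noncomputable section

open ContinuousLinearMap

theorem exists_geomDiag_eq (N : ℕ) {δ : ℝ} (hδ : 0 < δ) (v : EuclideanSpace ℂ (Fin N)) :
    ∃ w, geomDiag N δ w = v := by
  refine ⟨WithLp.toLp 2 fun j => (((δ ^ (j : ℕ))⁻¹ : ℝ) : ℂ) * v j, ?_⟩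
  ext j
  rw [geomDiag_apply]
  change _ * (_ * v j) = v j
  rw [← mul_assoc, ← Complex.ofReal_mul, mul_inv_cancel₀ (by positivity), Complex.ofReal_one,
    one_mul]

/-- Skew blocks exist in all thin sectors. -/
theorem exists_skewBlock {τ : ℝ} (hτ : 0 < τ) {m : ℝ} (hm : 1 ≤ m) :
    ∃ N : ℕ, 0 < N ∧ Nonempty (SkewBlock (EuclideanSpace ℂ (Fin N)) τ m) := by
  have hm0 : 0 < m := by linarith
  set ε : ℝ := 1 / (32 * m ^ 2) with hε
  have hε0 : 0 < ε := by positivity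
  have hεm : 32 * m ^ 2 * ε = 1 := by rw [hε]; field_simp
  have hε1 : ε ≤ 1 / 32 := by
    have : 1 ≤ m ^ 2 := one_le_pow₀ hm
    nlinarith
  set δ : ℝ := min ε (min (τ * ε / 4) (1 / (2 * m))) with hδ
  have hδ0 : 0 < δ := by
    rw [hδ]
    refine lt_min hε0 (lt_min (by positivity) (by positivity))
  have hδε : δ ≤ ε := min_le_left _ _
  have hδτ : δ ≤ τ * ε / 4 := (min_le_right _ _).trans (min_le_left _ _)
  have hδm : δ ≤ 1 / (2 * m) := (min_le_right _ _).trans (min_le_right _ _)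
  have hδm' : 2 * m * δ ≤ 1 := by
    rw [le_div_iff₀ (by positivity)] at hδm
    linarith
  -- Divergence of the harmonic series: `h` must exceed `16m²`, so that the form at the constant
  -- vector nearly attains the norm bound, and `2π/(τε)`, so that the numerical range is thin.
  obtain ⟨N, hN⟩ := (Real.tendsto_sum_range_one_div_nat_succ_atTop.eventually_ge_atTop
    (max (16 * m ^ 2) (2 * Real.pi / (τ * ε)))).exists
  set h : ℝ := ∑ i ∈ Finset.range N, 1 / ((i : ℝ) + 1) with hh
  have h1 : 16 * m ^ 2 ≤ h := (le_max_left _ _).trans hN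
  have h2 : 2 * Real.pi ≤ τ * ε * h := by
    have h3 := (le_max_right _ _).trans hN
    rw [div_le_iff₀ (by positivity)] at h3
    linarith
  have hh0 : 0 < h := lt_of_lt_of_le (by positivity) h1
  have hN0 : 0 < N := by
    rcases Nat.eq_zero_or_pos N with h3 | h3
    · rw [hh, h3, Finset.sum_range_zero] at hh0
      exact absurd hh0 (lt_irrefl 0)
    · exact h3
  refine ⟨N, hN0, ?_⟩
  -- Normalizes the logarithm to norm at most `1 - 2ε`. Its form at the constant vector is then at
  -- least `1 - 2ε - c` in real part, relative to the squared norm, and `8m²(2ε + c) ≤ 1`.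
  set c : ℝ := (1 - 2 * ε) / h with hc
  have hc0 : 0 ≤ c := div_nonneg (by linarith) hh0.le
  have hch : c * h = 1 - 2 * ε := by rw [hc]; field_simp
  have hc1 : c * h ≤ 1 := by linarith
  obtain ⟨w, hw⟩ := exists_geomDiag_eq N hδ0 (WithLp.toLp 2 fun _ : Fin N => (1 : ℂ))
  have hones : ‖(WithLp.toLp 2 fun _ : Fin N => (1 : ℂ) : EuclideanSpace ℂ (Fin N))‖ ^ 2 = N := by
    rw [EuclideanSpace.norm_sq_eq]
    simp
  have hnorm : ∀ (t : ℝ), 0 ≤ t → t ≤ 1 → ‖(c : ℂ) • truncLog N N (t : ℂ)‖ ≤ t * (c * h) := by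
    intro t ht ht1
    rw [norm_smul, Complex.norm_real, Real.norm_of_nonneg hc0]
    calc _ ≤ c * (t * h) := mul_le_mul_of_nonneg_left (norm_truncLog_le N ht ht1) hc0
      _ = _ := by ring
  refine ⟨SkewBlock.ofTriangular hm ((c : ℂ) • truncLog N N 1) (geomDiag N δ)
    ((c : ℂ) • truncLog N N (δ : ℂ)) (geomDiag_adj δ) ?_ (geomDiag_pos hδ0)
    (norm_geomDiag_le hδ0.le (by linarith)) (ε := ε) (η := δ) (σ := c * (Real.pi / 2))
    (ρ := (1 - 2 * ε) - c) hε0 (by linarith) ?_ ?_ hδε (by linarith) hδm' ?_ ?_ w ?_ ?_ ?_ ?_⟩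
  · rw [smul_mul_assoc, truncLog_mul_geomDiag, mul_smul_comm]
  · intro v
    refine (le_opNorm _ v).trans (mul_le_mul_of_nonneg_right ?_ (norm_nonneg v))
    have h3 := hnorm 1 zero_le_one le_rfl
    rw [Complex.ofReal_one] at h3
    linarith
  · intro v
    refine (le_opNorm _ v).trans (mul_le_mul_of_nonneg_right ?_ (norm_nonneg v))
    rw [LinearIsometryEquiv.norm_map]
    have h3 := hnorm δ hδ0.le (by linarith)
    nlinarith
  · intro v
    have h3 := mul_le_mul_of_nonneg_left (abs_im_inner_truncLog_le v) hc0
    rw [smul_apply, inner_smul_right, Complex.im_ofReal_mul, abs_mul, abs_of_nonneg hc0]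
    linarith
  · have h3 : c * (2 * Real.pi) ≤ c * (τ * ε * h) := mul_le_mul_of_nonneg_left h2 hc0
    have h4 : τ * ε * (c * h) ≤ τ * ε * 1 := mul_le_mul_of_nonneg_left hc1 (by positivity)
    linarith
  · rw [hw]
    intro h3
    rw [h3, norm_zero] at hones
    have : (0 : ℝ) < N := by exact_mod_cast hN0
    norm_num at hones
    linarith
  · rw [hw, hones, smul_apply, inner_smul_right, Complex.re_ofReal_mul]
    have h3 := mul_le_mul_of_nonneg_left (re_inner_truncLog_ones (N := N)) hc0
    refine le_trans (le_of_eq ?_) h3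
    rw [← hh]
    linear_combination (-(N : ℝ)) * hch
  · have h3 : 16 * m ^ 2 * c ≤ c * h := by nlinarith
    linarith
  · have h3 : 16 * m ^ 2 * c ≤ c * h := by nlinarith
    have h4 : 1 ≤ m ^ 2 := one_le_pow₀ hm
    nlinarith

end

/-! ### Hilbert bases indexed by `ℕ`, the doubling of `H`, and an operator moving `ran R` off
itself. -/

noncomputable section

open ContinuousLinearMap

variable {H : Type*} [NormedAddCommGroup H] [InnerProductSpace ℂ H]

theorem Orthonormal.countable_of_separableSpace [TopologicalSpace.SeparableSpace H] {ι : Type*}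
    {v : ι → H} (hv : Orthonormal ℂ v) : Countable ι := by
  refine Pairwise.countable_of_isOpen_disjoint (s := fun i => Metric.ball (v i) (1 / 2))
    (fun i j hij => ?_) (fun i => Metric.isOpen_ball)
    (fun i => ⟨v i, Metric.mem_ball_self (by norm_num)⟩)
  refine Metric.ball_disjoint_ball ?_
  have h1 : ‖v i - v j‖ ^ 2 = 2 := by
    rw [norm_sub_sq (𝕜 := ℂ), hv.2 hij, hv.1, hv.1]
    norm_num
  rw [dist_eq_norm]
  nlinarith [norm_nonneg (v i - v j)]

theorem HasSum.clm_apply {F : Type*} [NormedAddCommGroup F] [NormedSpace ℂ F] {ι : Type*}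
    {f : ι → H →L[ℂ] F} {g : H →L[ℂ] F} (h : HasSum f g) (x : H) :
    HasSum (fun i => f i x) (g x) := by
  have h1 := h.mapL (ContinuousLinearMap.apply ℂ F x)
  exact h1

theorem HilbertBasis.eq_of_inner {ι : Type*} (b : HilbertBasis ι ℂ H) {x y : H}
    (h : ∀ i, inner ℂ (b i) x = inner ℂ (b i) y) : x = y := by
  apply b.repr.injective
  ext i
  rw [b.repr_apply_apply, b.repr_apply_apply, h]

namespace HilbertBasis

/-- The terms of `treeShift`. -/
def treeTerm (b : HilbertBasis ℕ ℂ H) (j : ℕ) : H →L[ℂ] H :=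
  (((1 / 2 : ℝ) ^ j : ℝ) : ℂ) • InnerProductSpace.rankOne ℂ (b j) (b (Nat.unpair j).1)

theorem treeTerm_apply (b : HilbertBasis ℕ ℂ H) (j : ℕ) (x : H) : b.treeTerm j x =
    (((1 / 2 : ℝ) ^ j : ℝ) : ℂ) • inner ℂ (b (Nat.unpair j).1) x • b j := rfl

end HilbertBasis

variable [CompleteSpace H]

theorem exists_hilbertBasis_nat [TopologicalSpace.SeparableSpace H]
    (hH : ¬ FiniteDimensional ℂ H) : Nonempty (HilbertBasis ℕ ℂ H) := by
  obtain ⟨w, b, -⟩ := exists_hilbertBasis ℂ H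
  have : Countable w := b.orthonormal.countable_of_separableSpace
  have : Infinite w := by
    by_contra hfin
    rw [not_infinite_iff_finite] at hfin
    have := Fintype.ofFinite w
    exact hH b.toOrthonormalBasis.toBasis.finiteDimensional_of_finite
  obtain ⟨f⟩ : Nonempty (ℕ ≃ w) := nonempty_equiv_of_countable
  refine ⟨HilbertBasis.mk (v := b ∘ f) (b.orthonormal.comp f f.injective) ?_⟩
  rw [f.surjective.range_comp, b.dense_span]

/-- Every orthonormal sequence is the image of a Hilbert basis under an isometry. -/
theorem HilbertBasis.exists_isometry (b : HilbertBasis ℕ ℂ H) {v : ℕ → H}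
    (hv : Orthonormal ℂ v) : ∃ J : H →L[ℂ] H, (∀ x, adjoint J (J x) = x) ∧ ∀ n, J (b n) = v n := by
  set L : H →ₗᵢ[ℂ] H := hv.orthogonalFamily.linearIsometry.comp b.repr.toLinearIsometry with hL
  refine ⟨L.toContinuousLinearMap, fun x => ?_, fun n => ?_⟩
  · exact DFunLike.congr_fun L.adjoint_comp_self x
  · change hv.orthogonalFamily.linearIsometry (b.repr (b n)) = v n
    rw [b.repr_self, hv.orthogonalFamily.linearIsometry_apply_single]
    simp

/-- The two isometries send the basis to its even and to its odd members. -/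
theorem HilbertBasis.nonempty_doubling (b : HilbertBasis ℕ ℂ H) : Nonempty (Doubling H) := by
  have hi : Function.Injective fun n : ℕ => 2 * n := fun m n h => by simpa using h
  have hi' : Function.Injective fun n : ℕ => 2 * n + 1 := fun m n h => by simpa using h
  obtain ⟨J₁, h1, h1b⟩ := b.exists_isometry (b.orthonormal.comp _ hi)
  obtain ⟨J₂, h2, h2b⟩ := b.exists_isometry (b.orthonormal.comp _ hi')
  simp only [Function.comp] at h1b h2b
  have h12 : ∀ n, adjoint J₁ (b (2 * n + 1)) = 0 := fun n => b.eq_of_inner fun i => by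
    rw [adjoint_inner_right, h1b, b.orthonormal.2 (by omega), inner_zero_right]
  have h21 : ∀ n, adjoint J₂ (b (2 * n)) = 0 := fun n => b.eq_of_inner fun i => by
    rw [adjoint_inner_right, h2b, b.orthonormal.2 (by omega), inner_zero_right]
  refine ⟨⟨J₁, J₂, h1, fun x => b.eq_of_inner fun i => ?_, fun x => b.eq_of_inner fun i => ?_, h2,
    fun x => b.eq_of_inner fun i => ?_⟩⟩
  · rw [adjoint_inner_right, h1b, ← adjoint_inner_left, h21, inner_zero_left, inner_zero_right]
  · rw [adjoint_inner_right, h2b, ← adjoint_inner_left, h12, inner_zero_left, inner_zero_right]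
  · rw [inner_add_right, ← adjoint_inner_left J₁, ← adjoint_inner_left J₂]
    rcases Nat.even_or_odd' i with ⟨n, rfl | rfl⟩
    · rw [h21, inner_zero_left, add_zero, adjoint_inner_right, ← h1b, h1]
    · rw [h12, inner_zero_left, zero_add, adjoint_inner_right, ← h2b, h2]

namespace HilbertBasis

variable (b : HilbertBasis ℕ ℂ H)

/-- The operator `∑ 2⁻ʲ (·, e_{p j}) e_j`, where every value of `p` is taken infinitely often. -/
def treeShift : H →L[ℂ] H := ∑' j, b.treeTerm j

theorem norm_treeTerm (j : ℕ) : ‖b.treeTerm j‖ = (1 / 2 : ℝ) ^ j := by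
  rw [treeTerm, norm_smul, InnerProductSpace.norm_rankOne, b.orthonormal.1, b.orthonormal.1,
    Complex.norm_real, Real.norm_of_nonneg (by positivity), mul_one, mul_one]

theorem summable_treeTerm : Summable b.treeTerm := by
  refine Summable.of_norm ?_
  simp_rw [norm_treeTerm]
  exact summable_geometric_two

theorem norm_treeShift_le : ‖b.treeShift‖ ≤ 2 :=
  tsum_of_norm_bounded hasSum_geometric_two fun j => (b.norm_treeTerm j).le

theorem hasSum_treeShift_apply (x : H) : HasSum (fun j => b.treeTerm j x) (b.treeShift x) :=
  b.summable_treeTerm.hasSum.clm_apply x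

theorem inner_treeShift (i : ℕ) (x : H) : inner ℂ (b i) (b.treeShift x) =
    (((1 / 2 : ℝ) ^ i : ℝ) : ℂ) * inner ℂ (b (Nat.unpair i).1) x := by
  have h1 : HasSum (fun j => inner ℂ (b i) (b.treeTerm j x)) (inner ℂ (b i) (b.treeShift x)) :=
    (innerSL ℂ (b i)).hasSum (b.hasSum_treeShift_apply x)
  have h2 := hasSum_single (f := fun j => inner ℂ (b i) (b.treeTerm j x)) i fun j hj => by
    rw [treeTerm_apply, inner_smul_right, inner_smul_right, b.orthonormal.2 hj.symm, mul_zero,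
      mul_zero]
  rw [h1.unique h2, treeTerm_apply, inner_smul_right, inner_smul_right,
    inner_self_eq_norm_sq_to_K, b.orthonormal.1]
  simp

/-- A bounded self-adjoint operator that maps no nonzero rapidly decreasing vector to a rapidly
decreasing vector. -/
def treeOperator : H →L[ℂ] H := b.treeShift + adjoint b.treeShift

theorem treeOperator_adj : adjoint b.treeOperator = b.treeOperator := by
  rw [treeOperator, map_add, adjoint_adjoint, add_comm]

theorem norm_treeOperator_apply_le (x : H) : ‖b.treeOperator x‖ ≤ 4 * ‖x‖ := by
  have h1 : ‖b.treeOperator‖ ≤ 4 := by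
    refine (norm_add_le _ _).trans ?_
    rw [LinearIsometryEquiv.norm_map]
    linarith [b.norm_treeShift_le]
  exact (le_opNorm _ x).trans (mul_le_mul_of_nonneg_right h1 (norm_nonneg x))

variable {R : H →L[ℂ] H} {ρ : ℕ → ℝ}

/-- Only indices `j` with `(Nat.unpair j).1 = i` contribute, and these satisfy `i ≤ j`, so each
weight is at most `4⁻ⁱ`. -/
theorem norm_diag_treeShift_le (hRb : ∀ j, R (b j) = (ρ j : ℂ) • b j) (hρ : ∀ j, 0 < ρ j)
    (hρ' : ∀ j, ρ j ≤ (1 / 4) ^ j) (i : ℕ) : ‖R (b.treeShift (b i))‖ ≤ 2 * (1 / 4) ^ i := by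
  have h1 : HasSum (fun j => R (b.treeTerm j (b i))) (R (b.treeShift (b i))) :=
    R.hasSum (b.hasSum_treeShift_apply (b i))
  rw [← h1.tsum_eq]
  refine tsum_of_norm_bounded (hasSum_geometric_two.mul_right ((1 / 4 : ℝ) ^ i)) fun j => ?_
  rw [treeTerm_apply, map_smul, map_smul, hRb, norm_smul, norm_smul, norm_smul, b.orthonormal.1,
    Complex.norm_real, Complex.norm_real, Real.norm_of_nonneg (by positivity),
    Real.norm_of_nonneg (hρ j).le, mul_one]
  refine mul_le_mul_of_nonneg_left ?_ (by positivity)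
  by_cases h : (Nat.unpair j).1 = i
  · have h2 : i ≤ j := h ▸ Nat.unpair_left_le j
    rw [h, inner_self_eq_norm_sq_to_K, b.orthonormal.1]
    simp only [Complex.ofReal_one, one_pow, norm_one, one_mul, Complex.coe_algebraMap]
    exact (hρ' j).trans (pow_le_pow_of_le_one (by norm_num) (by norm_num) h2)
  · rw [b.orthonormal.2 h, norm_zero, zero_mul]
    positivity

theorem eq_zero_of_treeOperator_diag_eq (hR : adjoint R = R)
    (hRb : ∀ j, R (b j) = (ρ j : ℂ) • b j) (hρ : ∀ j, 0 < ρ j) (hρ' : ∀ j, ρ j ≤ (1 / 4) ^ j)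
    {x y : H} (h : b.treeOperator (R x) = R y) : x = 0 := by
  have hRi : ∀ i z, inner ℂ (b i) (R z) = (ρ i : ℂ) * inner ℂ (b i) z := fun i z => by
    rw [← hR, adjoint_inner_right, hRb, inner_smul_left, Complex.conj_ofReal]
  -- In the `i`-th coordinate of `U R x = R y`, the adjoint part of `U` and the right side are
  -- `O(4⁻ⁱ)`, while the shift contributes `2⁻ⁱ` times the coordinate of `R x` at `(Nat.unpair
  -- i).1`.
  have key : ∀ i, ‖inner ℂ (b (Nat.unpair i).1) (R x)‖ ≤ (1 / 2) ^ i * (‖y‖ + 2 * ‖x‖) := by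
    intro i
    have h1 := congrArg (fun z => inner ℂ (b i) z) h
    simp only [treeOperator, add_apply, inner_add_right, inner_treeShift, adjoint_inner_right,
      hRi i] at h1
    have h2 : inner ℂ (b.treeShift (b i)) (R x) = inner ℂ (R (b.treeShift (b i))) x := by
      rw [← adjoint_inner_left, hR]
    have h3 : ‖inner ℂ (b.treeShift (b i)) (R x)‖ ≤ 2 * (1 / 4) ^ i * ‖x‖ := by
      rw [h2]
      exact (norm_inner_le_norm _ _).trans (mul_le_mul_of_nonneg_right
        (b.norm_diag_treeShift_le hRb hρ hρ' i) (norm_nonneg x))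
    have h4 : ‖(ρ i : ℂ) * inner ℂ (b i) y‖ ≤ (1 / 4) ^ i * ‖y‖ := by
      rw [norm_mul, Complex.norm_real, Real.norm_of_nonneg (hρ i).le]
      have h5 := norm_inner_le_norm (𝕜 := ℂ) (b i) y
      rw [b.orthonormal.1, one_mul] at h5
      exact mul_le_mul (hρ' i) h5 (norm_nonneg _) (by positivity)
    have h5 : ‖(((1 / 2 : ℝ) ^ i : ℝ) : ℂ) * inner ℂ (b (Nat.unpair i).1) (R x)‖ ≤
        (1 / 4) ^ i * (‖y‖ + 2 * ‖x‖) := by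
      rw [eq_sub_of_add_eq h1]
      refine (norm_sub_le _ _).trans ?_
      linarith
    rw [norm_mul, Complex.norm_real, Real.norm_of_nonneg (by positivity)] at h5
    have h6 : ((1 / 4 : ℝ) ^ i) = (1 / 2) ^ i * (1 / 2) ^ i := by
      rw [← mul_pow]; norm_num
    rw [h6, mul_assoc] at h5
    exact le_of_mul_le_mul_left h5 (by positivity)
  refine b.eq_of_inner fun m => ?_
  rw [inner_zero_right]
  have h1 : ∀ j : ℕ, ‖inner ℂ (b m) (R x)‖ ≤ (1 / 2) ^ j * (‖y‖ + 2 * ‖x‖) := by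
    intro j
    -- The indices `Nat.pair m j` all point to the coordinate `m` and are at least `j`; letting `j`
    -- tend to infinity shows that the coordinate vanishes.
    have h2 := key (Nat.pair m j)
    rw [Nat.unpair_pair] at h2
    refine h2.trans (mul_le_mul_of_nonneg_right ?_ (by positivity))
    exact pow_le_pow_of_le_one (by norm_num) (by norm_num) (Nat.right_le_pair m j)
  have h2 : Tendsto (fun j : ℕ => (1 / 2 : ℝ) ^ j * (‖y‖ + 2 * ‖x‖)) atTop (𝓝 0) := by
    rw [← zero_mul (‖y‖ + 2 * ‖x‖)]
    exact (tendsto_pow_atTop_nhds_zero_of_lt_one (by norm_num) (by norm_num)).mul_const _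
  have h3 : ‖inner ℂ (b m) (R x)‖ ≤ 0 := ge_of_tendsto' h2 h1
  have h4 : inner ℂ (b m) (R x) = 0 := norm_le_zero_iff.1 h3
  rw [hRi] at h4
  exact (mul_eq_zero.1 h4).resolve_left (by exact_mod_cast (hρ m).ne')

end HilbertBasis

end

/-! ### Hilbert sums of finite-dimensional blocks and block diagonal operators. -/

noncomputable section

open ContinuousLinearMap

/-- A decomposition of `H` as the Hilbert sum of the spaces `E n`, with embeddings `V n` and
projections `P n`. -/
structure BlockDecomposition (H : Type*) [NormedAddCommGroup H] [InnerProductSpace ℂ H]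
    (E : ℕ → Type*) [∀ n, NormedAddCommGroup (E n)] [∀ n, InnerProductSpace ℂ (E n)] where
  V : ∀ n, E n →L[ℂ] H
  P : ∀ n, H →L[ℂ] E n
  inner_V : ∀ n v x, inner ℂ (V n v) x = inner ℂ v (P n x)
  hasSum_inner : ∀ x y, HasSum (fun n => inner ℂ (P n x) (P n y)) (inner ℂ x y)
  P_V : ∀ n v, P n (V n v) = v
  P_V_of_ne : ∀ m n, m ≠ n → ∀ v, P m (V n v) = 0

namespace BlockDecomposition

variable {H : Type*} [NormedAddCommGroup H] [InnerProductSpace ℂ H]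
  {E : ℕ → Type*} [∀ n, NormedAddCommGroup (E n)] [∀ n, InnerProductSpace ℂ (E n)]
  (𝓑 : BlockDecomposition H E)

theorem hasSum_norm_sq (x : H) : HasSum (fun n => ‖𝓑.P n x‖ ^ 2) (‖x‖ ^ 2) := by
  have h := Complex.hasSum_re (𝓑.hasSum_inner x x)
  simpa only [re_inner_self_eq] using h

theorem norm_P_le (n : ℕ) (x : H) : ‖𝓑.P n x‖ ≤ ‖x‖ := by
  refine le_of_sq_le_sq ?_ (norm_nonneg x)
  exact le_hasSum (𝓑.hasSum_norm_sq x) n fun m _ => sq_nonneg _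

theorem norm_V (n : ℕ) (v : E n) : ‖𝓑.V n v‖ = ‖v‖ := by
  have h : ‖𝓑.V n v‖ ^ 2 = ‖v‖ ^ 2 := by
    rw [← re_inner_self_eq, 𝓑.inner_V, 𝓑.P_V, re_inner_self_eq]
  exact (sq_eq_sq₀ (norm_nonneg _) (norm_nonneg _)).1 h

theorem norm_le_of_forall {c : ℝ} (hc : 0 ≤ c) {x y : H} (h : ∀ n, ‖𝓑.P n x‖ ≤ c * ‖𝓑.P n y‖) :
    ‖x‖ ≤ c * ‖y‖ := by
  refine le_of_sq_le_sq ?_ (by positivity)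
  rw [mul_pow]
  refine hasSum_le (fun n => ?_) (𝓑.hasSum_norm_sq x) ((𝓑.hasSum_norm_sq y).mul_left (c ^ 2))
  rw [← mul_pow]
  exact pow_le_pow_left₀ (norm_nonneg _) (h n) 2

theorem ext {x y : H} (h : ∀ n, 𝓑.P n x = 𝓑.P n y) : x = y := by
  rw [← sub_eq_zero, ← norm_le_zero_iff]
  have := 𝓑.norm_le_of_forall (x := x - y) (y := x - y) le_rfl fun n => by
    rw [map_sub, h, sub_self, norm_zero, zero_mul]
  rwa [zero_mul] at this

variable [CompleteSpace H]

/-- The block diagonal operator with blocks `X n`. -/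
def blockSum (X : ∀ n, E n →L[ℂ] E n) : H →L[ℂ] H := ∑' n, 𝓑.V n ∘L X n ∘L 𝓑.P n

variable {X : ∀ n, E n →L[ℂ] E n}

theorem P_blockSum (hX : Summable fun n => ‖X n‖) (n : ℕ) (x : H) :
    𝓑.P n (𝓑.blockSum X x) = X n (𝓑.P n x) := by
  have hs : Summable fun n => 𝓑.V n ∘L X n ∘L 𝓑.P n := by
    refine Summable.of_norm_bounded hX fun n => ?_
    refine opNorm_le_bound _ (norm_nonneg _) fun x => ?_
    change ‖𝓑.V n (X n (𝓑.P n x))‖ ≤ _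
    rw [𝓑.norm_V]
    exact ((X n).le_opNorm _).trans
      (mul_le_mul_of_nonneg_left (𝓑.norm_P_le n x) (norm_nonneg _))
  have h1 : HasSum (fun m => 𝓑.P n (𝓑.V m (X m (𝓑.P m x)))) (𝓑.P n (𝓑.blockSum X x)) :=
    (hs.hasSum.clm_apply x).mapL (𝓑.P n)
  have h2 := hasSum_single (f := fun m => 𝓑.P n (𝓑.V m (X m (𝓑.P m x)))) n fun m hm =>
    𝓑.P_V_of_ne n m hm.symm _
  rw [h1.unique h2, 𝓑.P_V]

theorem blockSum_V (hX : Summable fun n => ‖X n‖) (n : ℕ) (v : E n) :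
    𝓑.blockSum X (𝓑.V n v) = 𝓑.V n (X n v) := by
  refine 𝓑.ext fun m => ?_
  rw [𝓑.P_blockSum hX]
  by_cases h : m = n
  · subst h
    rw [𝓑.P_V, 𝓑.P_V]
  · rw [𝓑.P_V_of_ne m n h, 𝓑.P_V_of_ne m n h, map_zero]

theorem blockSum_adj [∀ n, CompleteSpace (E n)] (hX : Summable fun n => ‖X n‖)
    (hadj : ∀ n, adjoint (X n) = X n) : adjoint (𝓑.blockSum X) = 𝓑.blockSum X := by
  ext1 u
  refine 𝓑.ext fun n => ?_
  refine ext_inner_left ℂ fun v => ?_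
  rw [← 𝓑.inner_V, adjoint_inner_right, 𝓑.blockSum_V hX, 𝓑.inner_V, 𝓑.P_blockSum hX,
    ← adjoint_inner_right, hadj]

end BlockDecomposition

namespace HilbertBasis

variable {H : Type*} [NormedAddCommGroup H] [InnerProductSpace ℂ H]
  (b : HilbertBasis ℕ ℂ H) {N : ℕ → ℕ} (σ : (Σ n, Fin (N n)) ≃ ℕ)

/-- The embedding of `ℂ^(N n)` into `H` given by the basis vectors of the `n`-th block. -/
def blockEmb (n : ℕ) : EuclideanSpace ℂ (Fin (N n)) →L[ℂ] H :=
  LinearMap.toContinuousLinearMap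
    { toFun := fun v => ∑ k, v k • b (σ ⟨n, k⟩)
      map_add' := fun v w => by
        simp only [PiLp.add_apply, add_smul, Finset.sum_add_distrib]
      map_smul' := fun c v => by
        simp only [PiLp.smul_apply, smul_eq_mul, mul_smul, Finset.smul_sum, RingHom.id_apply] }

theorem blockEmb_apply (n : ℕ) (v : EuclideanSpace ℂ (Fin (N n))) :
    b.blockEmb σ n v = ∑ k, v k • b (σ ⟨n, k⟩) := rfl

theorem blockEmb_single (n : ℕ) (k : Fin (N n)) :
    b.blockEmb σ n (EuclideanSpace.single k 1) = b (σ ⟨n, k⟩) := by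
  rw [blockEmb_apply, Finset.sum_eq_single k]
  · simp
  · intro l _ hl
    simp [hl]
  · simp

variable [CompleteSpace H]

theorem adjoint_blockEmb_apply (n : ℕ) (x : H) (k : Fin (N n)) :
    adjoint (b.blockEmb σ n) x k = inner ℂ (b (σ ⟨n, k⟩)) x := by
  rw [← b.blockEmb_single σ, ← adjoint_inner_right, EuclideanSpace.inner_single_left]
  simp

/-- The block decomposition of `H` given by a partition of a Hilbert basis into finite blocks. -/
def blockDecomposition :
    BlockDecomposition H fun n => EuclideanSpace ℂ (Fin (N n)) where
  V := b.blockEmb σ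
  P n := adjoint (b.blockEmb σ n)
  inner_V n v x := (adjoint_inner_right _ _ _).symm
  hasSum_inner x y := by
    have h1 := (σ.hasSum_iff (f := fun i => inner ℂ x (b i) * inner ℂ (b i) y)).2
      (b.hasSum_inner_mul_inner x y)
    have h2 := h1.sigma fun n => hasSum_fintype _
    convert h2 using 2 with n
    rw [PiLp.inner_apply]
    refine Finset.sum_congr rfl fun k _ => ?_
    rw [adjoint_blockEmb_apply, adjoint_blockEmb_apply, RCLike.inner_apply, inner_conj_symm,
      mul_comm]
    rfl
  P_V n v := by
    ext k
    rw [adjoint_blockEmb_apply, blockEmb_apply, inner_sum, Finset.sum_eq_single k]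
    · rw [inner_smul_right, inner_self_eq_norm_sq_to_K, b.orthonormal.1]
      simp
    · intro l _ hl
      rw [inner_smul_right, b.orthonormal.2, mul_zero]
      intro h
      have h1 := σ.injective h
      simp only [Sigma.mk.injEq, heq_eq_eq, true_and] at h1
      exact hl h1.symm
    · simp
  P_V_of_ne m n hmn v := by
    ext k
    rw [adjoint_blockEmb_apply, blockEmb_apply, inner_sum]
    refine Finset.sum_eq_zero fun l _ => ?_
    rw [inner_smul_right, b.orthonormal.2, mul_zero]
    intro h
    exact hmn (congrArg Sigma.fst (σ.injective h))

end HilbertBasis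

end

/-! ### Coupling data assembled from skew blocks. -/

noncomputable section

open ContinuousLinearMap

theorem SkewBlock.norm_K_le {E : Type*} [NormedAddCommGroup E] [InnerProductSpace ℂ E]
    [CompleteSpace E] {τ m : ℝ} (X : SkewBlock E τ m) (x : E) : ‖X.K x‖ ≤ ‖X.Q x‖ := by
  refine le_of_sq_le_sq ((X.norm_K x).trans ?_) (norm_nonneg _)
  nlinarith [mul_nonneg X.ε_pos.le (sq_nonneg ‖X.Q x‖)]

namespace BlockDecomposition

variable {H : Type*} [NormedAddCommGroup H] [InnerProductSpace ℂ H] [CompleteSpace H]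
  {E : ℕ → Type*} [∀ n, NormedAddCommGroup (E n)] [∀ n, InnerProductSpace ℂ (E n)]

theorem summable_norm_smul {s : ℕ → ℝ} (hs : ∀ n, 0 ≤ s n) (hs' : ∀ n, s n ≤ (1 / 2) ^ n)
    {X : ∀ n, E n →L[ℂ] E n} (hX : ∀ n x, ‖X n x‖ ≤ ‖x‖) :
    Summable fun n => ‖((s n : ℝ) : ℂ) • X n‖ := by
  refine Summable.of_nonneg_of_le (fun n => norm_nonneg _) (fun n => ?_) summable_geometric_two
  refine opNorm_le_bound _ (by positivity) fun x => ?_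
  rw [smul_apply, norm_smul, Complex.norm_real, Real.norm_of_nonneg (hs n)]
  exact mul_le_mul (hs' n) (hX n x) (norm_nonneg _) (by positivity)

theorem adjoint_ofReal_smul [∀ n, CompleteSpace (E n)] (s : ℕ → ℝ) {X : ∀ n, E n →L[ℂ] E n}
    (hX : ∀ n, adjoint (X n) = X n) (n : ℕ) :
    adjoint (((s n : ℝ) : ℂ) • X n) = ((s n : ℝ) : ℂ) • X n := by
  rw [map_smulₛₗ, hX, Complex.conj_ofReal]

end BlockDecomposition

namespace CouplingData

variable {H : Type*} [NormedAddCommGroup H] [InnerProductSpace ℂ H] [CompleteSpace H]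
  {E : ℕ → Type*} [∀ n, NormedAddCommGroup (E n)] [∀ n, InnerProductSpace ℂ (E n)]
  [∀ n, CompleteSpace (E n)]

/-- The coupling data obtained from a sequence of skew blocks, with the weights `r n` on the
blocks. -/
def ofBlocks (𝓑 : BlockDecomposition H E) {τ κ : ℝ} (X : ∀ n, SkewBlock (E n) (τ / 4) (n + 1))
    (r : ℕ → ℝ) (hr : ∀ n, 0 < r n) (hr2 : ∀ n, r n ≤ (1 / 2) ^ n)
    (hκ : 0 < κ) (hκ1 : 20 * κ ^ 2 ≤ 1) (hκτ : 40 * κ ^ 2 ≤ τ)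
    (hrκ : ∀ n, r n ≤ κ * (X n).ε) (U : H →L[ℂ] H) (hU : adjoint U = U)
    (hU4 : ∀ x, ‖U x‖ ≤ 4 * ‖x‖)
    (hUR : ∀ x y, U (𝓑.blockSum (fun n => ((r n : ℝ) : ℂ) • 1) x) =
      𝓑.blockSum (fun n => ((r n : ℝ) : ℂ) • 1) y → x = 0) : CouplingData H τ :=
  have hr1 : ∀ n, r n ≤ 1 := fun n => (hr2 n).trans (pow_le_one₀ (by norm_num) (by norm_num))
  have hr3 : ∀ n, r n ^ 3 ≤ (1 / 2) ^ n := fun n =>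
    (pow_le_of_le_one (hr n).le (hr1 n) (by norm_num)).trans (hr2 n)
  have hr30 : ∀ n, 0 ≤ r n ^ 3 := fun n => pow_nonneg (hr n).le 3
  have hK : ∀ n x, ‖(X n).K x‖ ≤ ‖x‖ := fun n x => ((X n).norm_K_le x).trans ((X n).norm_Q x)
  have hrR : ∀ n x, 𝓑.P n (𝓑.blockSum (fun n => ((r n : ℝ) : ℂ) • 1) x) =
      ((r n : ℝ) : ℂ) • 𝓑.P n x := 𝓑.P_blockSum
    (BlockDecomposition.summable_norm_smul (fun n => (hr n).le) hr2 fun n x => le_rfl)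
  have hA₁ : ∀ n x, 𝓑.P n (𝓑.blockSum (fun n => ((r n : ℝ) : ℂ) • (X n).Q) x) =
      ((r n : ℝ) : ℂ) • (X n).Q (𝓑.P n x) := 𝓑.P_blockSum
    (BlockDecomposition.summable_norm_smul (fun n => (hr n).le) hr2 fun n => (X n).norm_Q)
  have hK₁ : ∀ n x, 𝓑.P n (𝓑.blockSum (fun n => ((r n : ℝ) : ℂ) • (X n).K) x) =
      ((r n : ℝ) : ℂ) • (X n).K (𝓑.P n x) := 𝓑.P_blockSum
    (BlockDecomposition.summable_norm_smul (fun n => (hr n).le) hr2 hK)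
  have hsA := BlockDecomposition.summable_norm_smul hr30 hr3 fun n => (X n).norm_Q
  have hsK := BlockDecomposition.summable_norm_smul hr30 hr3 hK
  have hA : ∀ n x, 𝓑.P n (𝓑.blockSum (fun n => ((r n ^ 3 : ℝ) : ℂ) • (X n).Q) x) =
      ((r n ^ 3 : ℝ) : ℂ) • (X n).Q (𝓑.P n x) := 𝓑.P_blockSum hsA
  have hA' : ∀ n x, 𝓑.P n (𝓑.blockSum (fun n => ((r n ^ 3 : ℝ) : ℂ) • (X n).Q) x) =
      (X n).Q (((r n ^ 3 : ℝ) : ℂ) • 𝓑.P n x) := fun n x => by rw [hA, map_smul]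
  have hK' : ∀ n x, 𝓑.P n (𝓑.blockSum (fun n => ((r n ^ 3 : ℝ) : ℂ) • (X n).K) x) =
      (X n).K (((r n ^ 3 : ℝ) : ℂ) • 𝓑.P n x) := fun n x => by
    rw [map_smul]; exact 𝓑.P_blockSum hsK n x
  have hη : ∀ x, HasSum (fun n => (X n).ε * ‖𝓑.P n x‖ ^ 2) (∑' n, (X n).ε * ‖𝓑.P n x‖ ^ 2) :=
    fun x => (Summable.of_nonneg_of_le (fun n => mul_nonneg (X n).ε_pos.le (sq_nonneg _))
      (fun n => mul_le_of_le_one_left (sq_nonneg _) (X n).ε_le)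
      (𝓑.hasSum_norm_sq x).summable).hasSum
  { R := 𝓑.blockSum fun n => ((r n : ℝ) : ℂ) • 1
    A₁ := 𝓑.blockSum fun n => ((r n : ℝ) : ℂ) • (X n).Q
    K₁ := 𝓑.blockSum fun n => ((r n : ℝ) : ℂ) • (X n).K
    U := U
    -- Two of the three factors `r n` make `A` and `K₀` factor through `R²`; the third makes the
    -- block sums of `A₁` and `K₁` converge.
    A := 𝓑.blockSum fun n => ((r n ^ 3 : ℝ) : ℂ) • (X n).Q
    K₀ := 𝓑.blockSum fun n => ((r n ^ 3 : ℝ) : ℂ) • (X n).K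
    A_eq := fun x => 𝓑.ext fun n => by
      rw [hA, hrR, hrR, hA₁, smul_smul, smul_smul]
      congr 1; push_cast; ring
    K₀_eq := fun x => 𝓑.ext fun n => by
      rw [hK', map_smul, hrR, hrR, hK₁, smul_smul, smul_smul]
      congr 1; push_cast; ring
    R_adj := 𝓑.blockSum_adj
      (BlockDecomposition.summable_norm_smul (fun n => (hr n).le) hr2 fun n x => le_rfl)
      (BlockDecomposition.adjoint_ofReal_smul r fun n => adjoint_id)
    U_adj := hU
    A_adj := 𝓑.blockSum_adj hsA
      (BlockDecomposition.adjoint_ofReal_smul (fun n => r n ^ 3) fun n => (X n).Q_adj)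
    K₀_adj := 𝓑.blockSum_adj hsK
      (BlockDecomposition.adjoint_ofReal_smul (fun n => r n ^ 3) fun n => (X n).K_adj)
    R_A := fun x => 𝓑.ext fun n => by
      rw [hA, hrR, hrR, hA, map_smul, smul_comm]
    R_inj := by
      rw [injective_iff_map_eq_zero]
      intro x hx
      refine 𝓑.ext fun n => ?_
      have h1 := hrR n x
      rw [hx, map_zero] at h1
      rw [map_zero]
      exact (smul_eq_zero.1 h1.symm).resolve_left (by exact_mod_cast (hr n).ne')
    A_pos := fun u hu => by
      have h1 := Complex.hasSum_re (𝓑.hasSum_inner u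
        (𝓑.blockSum (fun n => ((r n ^ 3 : ℝ) : ℂ) • (X n).Q) u))
      have h2 : ∀ n, (inner ℂ (𝓑.P n u) (𝓑.P n
          (𝓑.blockSum (fun n => ((r n ^ 3 : ℝ) : ℂ) • (X n).Q) u))).re =
          r n ^ 3 * (inner ℂ (𝓑.P n u) ((X n).Q (𝓑.P n u))).re := fun n => by
        rw [hA, inner_smul_right, Complex.re_ofReal_mul]
      simp only [h2] at h1
      obtain ⟨n, hn⟩ : ∃ n, 𝓑.P n u ≠ 0 := by
        by_contra! h
        exact hu (𝓑.ext fun n => by rw [h, map_zero])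
      refine lt_of_lt_of_le (mul_pos (pow_pos (hr n) 3) ((X n).Q_pos _ hn))
        (le_hasSum h1 n fun m _ => mul_nonneg (hr30 m) ?_)
      by_cases hm : 𝓑.P m u = 0
      · rw [hm, inner_zero_left, Complex.zero_re]
      · exact ((X m).Q_pos _ hm).le
    U_R := hUR
    norm_U := hU4
    norm_A := fun x => by
      rw [← one_mul ‖x‖]
      refine 𝓑.norm_le_of_forall zero_le_one fun n => ?_
      rw [hA, norm_smul, Complex.norm_real, Real.norm_of_nonneg (hr30 n)]
      exact mul_le_mul (pow_le_one₀ (hr n).le (hr1 n)) ((X n).norm_Q _) (norm_nonneg _) zero_le_one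
    A_small := fun ε hε => by
      obtain ⟨n, hn⟩ := exists_pow_lt_of_lt_one hε (show (1 / 2 : ℝ) < 1 by norm_num)
      refine ⟨𝓑.V n (X n).w, fun h => (X n).Q_w ?_, ?_⟩
      · rw [← 𝓑.P_V n (X n).w, h, map_zero, map_zero]
      · rw [𝓑.blockSum_V hsA, 𝓑.norm_V, 𝓑.norm_V, smul_apply, norm_smul, Complex.norm_real,
          Real.norm_of_nonneg (hr30 n)]
        exact mul_le_mul ((hr3 n).trans hn.le) ((X n).norm_Q _) (norm_nonneg _) hε.le
    κ := κ
    κ_pos := hκ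
    κ_le := hκ1
    κ_le' := hκτ
    norm_R := fun x => 𝓑.norm_le_of_forall hκ.le fun n => by
      rw [hrR, norm_smul, Complex.norm_real, Real.norm_of_nonneg (hr n).le]
      exact mul_le_mul_of_nonneg_right
        ((hrκ n).trans (mul_le_of_le_one_right hκ.le (X n).ε_le)) (norm_nonneg _)
    -- Each block of `A x` is weighted by its own margin `ε`; the margins need not be bounded below.
    -- The condition `r n ≤ κ ε` compares `R` with this form.
    η := fun x => ∑' n, (X n).ε *
      ‖𝓑.P n (𝓑.blockSum (fun n => ((r n ^ 3 : ℝ) : ℂ) • (X n).Q) x)‖ ^ 2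
    η_nonneg := fun x => tsum_nonneg fun n => mul_nonneg (X n).ε_pos.le (sq_nonneg _)
    norm_RA := fun x => by
      refine hasSum_le (fun n => ?_) (𝓑.hasSum_norm_sq _) ((hη _).mul_left (κ ^ 2))
      rw [hrR, norm_smul, Complex.norm_real, Real.norm_of_nonneg (hr n).le, mul_pow, ← mul_assoc]
      refine mul_le_mul_of_nonneg_right ?_ (sq_nonneg _)
      refine (pow_le_pow_left₀ (hr n).le (hrκ n) 2).trans ?_
      rw [mul_pow]
      exact mul_le_mul_of_nonneg_left (pow_le_of_le_one (X n).ε_pos.le (X n).ε_le two_ne_zero)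
        (sq_nonneg κ)
    norm_K₀ := fun x => by
      refine hasSum_le (fun n => ?_) (𝓑.hasSum_norm_sq _) ((𝓑.hasSum_norm_sq _).sub (hη _))
      rw [hA', hK']
      exact (X n).norm_K _
    inner_K₀ := fun x => by
      have h1 := (Complex.hasSum_re (𝓑.hasSum_inner
        (𝓑.blockSum (fun n => ((r n ^ 3 : ℝ) : ℂ) • (X n).Q) x)
        (𝓑.blockSum (fun n => ((r n ^ 3 : ℝ) : ℂ) • (X n).K) x))).mul_left 2
      have h2 := h1.norm_le_of_bounded ((hη _).mul_left (τ / 4)) fun n => by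
        rw [Real.norm_eq_abs, abs_mul, abs_two, hA', hK']
        exact (X n).inner_K _
      rwa [Real.norm_eq_abs, abs_mul, abs_two] at h2
    norm_RK₀ := fun x => by
      refine (𝓑.norm_le_of_forall zero_le_one fun n => ?_).trans_eq (one_mul _)
      rw [hrR, hrR, norm_smul, norm_smul, one_mul, hA', hK']
      exact mul_le_mul_of_nonneg_left ((X n).norm_K_le _) (norm_nonneg _) }

/-- Every infinite dimensional separable Hilbert space carries coupling data for which `A + i K₀`
is arbitrarily small compared to `A - i K₀`. -/
theorem exists_skew {τ : ℝ} (hτ : 0 < τ) (b : HilbertBasis ℕ ℂ H) :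
    ∃ D : CouplingData H τ, ∀ n : ℕ, ∃ w, D.A w ≠ 0 ∧
      (n + 1) * ‖D.A w + Complex.I • D.K₀ w‖ ≤ ‖D.A w‖ ∧
      ‖D.A w‖ ≤ ‖D.A w - Complex.I • D.K₀ w‖ ∧ (n + 1) * ‖D.R (D.A w)‖ ≤ ‖D.A w‖ := by
  have h : ∀ n : ℕ, ∃ N : ℕ, 0 < N ∧
      Nonempty (SkewBlock (EuclideanSpace ℂ (Fin N)) (τ / 4) (n + 1)) := fun n =>
    exists_skewBlock (by positivity) (by simp)
  choose N hN hX using h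
  have X := fun n => (hX n).some
  have : Infinite (Σ n, Fin (N n)) :=
    Infinite.of_injective (fun n => (⟨n, ⟨0, hN n⟩⟩ : Σ n, Fin (N n))) fun m n hmn =>
      congrArg Sigma.fst hmn
  obtain ⟨σ⟩ : Nonempty ((Σ n, Fin (N n)) ≃ ℕ) := nonempty_equiv_of_countable
  obtain ⟨κ, hκ, hκ1, hκτ⟩ : ∃ κ : ℝ, 0 < κ ∧ 20 * κ ^ 2 ≤ 1 ∧ 40 * κ ^ 2 ≤ τ := by
    refine ⟨min (1 / 40) τ, lt_min (by norm_num) hτ, ?_, ?_⟩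
    · nlinarith [min_le_left (1 / 40) τ, lt_min (show (0 : ℝ) < 1 / 40 by norm_num) hτ]
    · nlinarith [min_le_left (1 / 40) τ, min_le_right (1 / 40) τ,
        lt_min (show (0 : ℝ) < 1 / 40 by norm_num) hτ]
  have hκ2 : κ ≤ 1 := by nlinarith
  -- The factor `κ ε` controls the coupling, `2⁻ⁿ` gives summability, and the last factor makes `r n
  -- ≤ 4⁻ʲ` for every basis index `j` in the `n`-th block, as the property of `treeOperator`
  -- requires.
  set r : ℕ → ℝ := fun n => κ * (X n).ε * ((1 / 2) ^ n * (1 / 4) ^ (∑ k, σ ⟨n, k⟩)) with hr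
  have hκε : ∀ n, 0 < κ * (X n).ε := fun n => mul_pos hκ (X n).ε_pos
  have hκε1 : ∀ n, κ * (X n).ε ≤ 1 := fun n => mul_le_one₀ hκ2 (X n).ε_pos.le (X n).ε_le
  have h2 : ∀ n : ℕ, (1 / 2 : ℝ) ^ n ≤ 1 := fun n => pow_le_one₀ (by norm_num) (by norm_num)
  have h4 : ∀ n : ℕ, (1 / 4 : ℝ) ^ n ≤ 1 := fun n => pow_le_one₀ (by norm_num) (by norm_num)
  have hr0 : ∀ n, 0 < r n := fun n => mul_pos (hκε n) (by positivity)
  have hr2 : ∀ n, r n ≤ (1 / 2) ^ n := fun n =>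
    (mul_le_of_le_one_left (by positivity) (hκε1 n)).trans
      (mul_le_of_le_one_right (by positivity) (h4 _))
  have hrκ : ∀ n, r n ≤ κ * (X n).ε := fun n =>
    mul_le_of_le_one_right (hκε n).le (mul_le_one₀ (h2 n) (by positivity) (h4 _))
  have hr4 : ∀ n k, r n ≤ (1 / 4) ^ (σ ⟨n, k⟩) := fun n k =>
    (mul_le_of_le_one_left (by positivity) (hκε1 n)).trans
      ((mul_le_of_le_one_left (by positivity) (h2 n)).trans
        (pow_le_pow_of_le_one (by norm_num) (by norm_num)
          (Finset.single_le_sum (f := fun k => σ ⟨n, k⟩) (fun k _ => Nat.zero_le _)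
            (Finset.mem_univ k))))
  set 𝓑 := b.blockDecomposition σ with h𝓑
  have hs : Summable fun n => ‖((r n : ℝ) : ℂ) • (1 : EuclideanSpace ℂ (Fin (N n)) →L[ℂ] _)‖ :=
    BlockDecomposition.summable_norm_smul (fun n => (hr0 n).le) hr2 fun n x => le_rfl
  have hRb : ∀ j, 𝓑.blockSum (fun n => ((r n : ℝ) : ℂ) • 1) (b j) =
      ((r (σ.symm j).1 : ℝ) : ℂ) • b j := fun j => by
    have h1 : b j = 𝓑.V (σ.symm j).1 (EuclideanSpace.single (σ.symm j).2 1) := by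
      refine Eq.trans ?_ (b.blockEmb_single σ (σ.symm j).1 (σ.symm j).2).symm
      rw [Sigma.eta, σ.apply_symm_apply]
    rw [h1, 𝓑.blockSum_V hs, smul_apply, map_smul]
    rfl
  refine ⟨ofBlocks 𝓑 X r hr0 hr2 hκ hκ1 hκτ hrκ b.treeOperator b.treeOperator_adj
    b.norm_treeOperator_apply_le fun x y hxy => b.eq_zero_of_treeOperator_diag_eq
      (𝓑.blockSum_adj hs (BlockDecomposition.adjoint_ofReal_smul r fun n => adjoint_id)) hRb
      (fun j => hr0 _) (fun j => ?_) hxy, fun n => ⟨𝓑.V n (X n).w, ?_⟩⟩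
  · refine (hr4 _ (σ.symm j).2).trans_eq ?_
    rw [Sigma.eta, σ.apply_symm_apply]
  have hr1 : ∀ n, r n ≤ 1 := fun n => (hr2 n).trans (h2 n)
  have hr3 : ∀ n, r n ^ 3 ≤ (1 / 2) ^ n := fun n =>
    (pow_le_of_le_one (hr0 n).le (hr1 n) (by norm_num)).trans (hr2 n)
  have hr30 : ∀ n, 0 < r n ^ 3 := fun n => pow_pos (hr0 n) 3
  have hA : ∀ v, 𝓑.blockSum (fun n => ((r n ^ 3 : ℝ) : ℂ) • (X n).Q) (𝓑.V n v) =
      ((r n ^ 3 : ℝ) : ℂ) • 𝓑.V n ((X n).Q v) := fun v => by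
    rw [𝓑.blockSum_V (BlockDecomposition.summable_norm_smul (fun n => (hr30 n).le) hr3
      fun n => (X n).norm_Q), smul_apply, map_smul]
  have hK : ∀ v, 𝓑.blockSum (fun n => ((r n ^ 3 : ℝ) : ℂ) • (X n).K) (𝓑.V n v) =
      ((r n ^ 3 : ℝ) : ℂ) • 𝓑.V n ((X n).K v) := fun v => by
    rw [𝓑.blockSum_V (BlockDecomposition.summable_norm_smul (fun n => (hr30 n).le) hr3
      fun n x => ((X n).norm_K_le x).trans ((X n).norm_Q x)), smul_apply, map_smul]
  have hR : ∀ v, 𝓑.blockSum (fun n => ((r n : ℝ) : ℂ) • 1) (𝓑.V n v) =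
      ((r n : ℝ) : ℂ) • 𝓑.V n v := fun v => by
    rw [𝓑.blockSum_V hs, smul_apply, map_smul]
    rfl
  change 𝓑.blockSum (fun n => ((r n ^ 3 : ℝ) : ℂ) • (X n).Q) (𝓑.V n (X n).w) ≠ 0 ∧
    (n + 1) * ‖𝓑.blockSum (fun n => ((r n ^ 3 : ℝ) : ℂ) • (X n).Q) (𝓑.V n (X n).w) +
      Complex.I • 𝓑.blockSum (fun n => ((r n ^ 3 : ℝ) : ℂ) • (X n).K) (𝓑.V n (X n).w)‖ ≤
      ‖𝓑.blockSum (fun n => ((r n ^ 3 : ℝ) : ℂ) • (X n).Q) (𝓑.V n (X n).w)‖ ∧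
    ‖𝓑.blockSum (fun n => ((r n ^ 3 : ℝ) : ℂ) • (X n).Q) (𝓑.V n (X n).w)‖ ≤
      ‖𝓑.blockSum (fun n => ((r n ^ 3 : ℝ) : ℂ) • (X n).Q) (𝓑.V n (X n).w) -
      Complex.I • 𝓑.blockSum (fun n => ((r n ^ 3 : ℝ) : ℂ) • (X n).K) (𝓑.V n (X n).w)‖ ∧
    (n + 1) * ‖𝓑.blockSum (fun n => ((r n : ℝ) : ℂ) • 1)
      (𝓑.blockSum (fun n => ((r n ^ 3 : ℝ) : ℂ) • (X n).Q) (𝓑.V n (X n).w))‖ ≤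
      ‖𝓑.blockSum (fun n => ((r n ^ 3 : ℝ) : ℂ) • (X n).Q) (𝓑.V n (X n).w)‖
  rw [hA, hK, smul_comm Complex.I, ← smul_add, ← smul_sub, ← map_smul (𝓑.V n) Complex.I,
    ← map_add, ← map_sub, map_smul, hR, norm_smul, norm_smul,
    norm_smul, norm_smul, norm_smul, 𝓑.norm_V, 𝓑.norm_V, 𝓑.norm_V, Complex.norm_real,
    Complex.norm_real, Real.norm_of_nonneg (hr30 n).le, Real.norm_of_nonneg (hr0 n).le]
  refine ⟨fun h => ?_, ?_, ?_, ?_⟩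
  · have h5 := congrArg norm h
    rw [norm_smul, 𝓑.norm_V, Complex.norm_real, norm_zero, Real.norm_of_nonneg (hr30 n).le] at h5
    exact (X n).Q_w (norm_eq_zero.1 ((mul_eq_zero.1 h5).resolve_left (hr30 n).ne'))
  · rw [mul_left_comm]
    exact mul_le_mul_of_nonneg_left (X n).norm_add (hr30 n).le
  · exact mul_le_mul_of_nonneg_left (X n).norm_sub (hr30 n).le
  · rw [mul_left_comm]
    refine mul_le_mul_of_nonneg_left ?_ (hr30 n).le
    rw [← mul_assoc]
    refine mul_le_of_le_one_left (norm_nonneg _) ?_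
    -- On the `n`-th block `R` is the scalar `r n ≤ 2⁻ⁿ`, so `(n + 1) r n ≤ 1`.
    have h5 : (n + 1 : ℝ) ≤ 2 ^ n := by exact_mod_cast Nat.lt_two_pow_self
    calc (n + 1 : ℝ) * r n ≤ 2 ^ n * (1 / 2) ^ n :=
          mul_le_mul h5 (hr2 n) (hr0 n).le (by positivity)
      _ = 1 := by rw [← mul_pow]; norm_num

end CouplingData

end

theorem mainTheorem8
    {H : Type*} [NormedAddCommGroup H] [InnerProductSpace ℂ H] [CompleteSpace H]
    [TopologicalSpace.SeparableSpace H] (hH : ¬ FiniteDimensional ℂ H)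
    (α : ℝ) (hα₀ : 0 < α) (hα₁ : α < Real.pi / 2) :
    (∃ S : ℂ → (H →ₗ.[ℂ] H),
      (∀ ξ : ℂ, (S ξ).IsUnbounded ∧ (S ξ).IsCoercive ∧ (S ξ).IsMSectorial α) ∧
      (∀ ξ : ℂ, (S ξ).domain ⊓ (S ξ).adjoint.domain = ⊥) ∧
      (∀ ξ : ℂ, (S ξ).msqrt.domain ≠ (S ξ).adjoint.msqrt.domain) ∧
      (∃ Q : H →ₗ.[ℂ] H, ∀ ξ : ℂ, (S ξ).invSqrt.rePart = Q) ∧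
      (∀ ξ ζ : ℂ, ξ ≠ ζ → (S ξ).invSqrt.imPart.ran ⊓ (S ζ).invSqrt.imPart.ran = ⊥)) ∧
    (∃ X : ℂ → (H →ₗ.[ℂ] H),
      LinearPMap.NormResolventContinuous X ∧
      (∀ ξ : ℂ, (X ξ).IsUnbounded ∧ (X ξ).IsCoercive ∧ (X ξ).IsMSectorial α) ∧
      (∀ ξ : ℂ, (X ξ).domain ⊓ (X ξ).adjoint.domain = ⊥) ∧
      (∃ D : Submodule ℂ H, ∀ ξ : ℂ,
        (X ξ).msqrt.domain = D ∧ (X ξ).adjoint.msqrt.domain = D) ∧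
      (∀ ξ : ℂ, Dense ((X ξ).invSqrt.imPart.ran : Set H)) ∧
      (∀ ξ ζ : ℂ, ξ ≠ ζ → (X ξ).invSqrt.imPart.ran ⊓ (X ζ).invSqrt.imPart.ran = ⊥) ∧
      (∃ L : Submodule ℂ H, ∀ ξ ζ : ℂ, ξ ≠ ζ →
        (X ξ).invSqrt.imPart.ran ⊔ (X ζ).invSqrt.imPart.ran = L)) := by
  obtain ⟨b⟩ := exists_hilbertBasis_nat hH
  obtain ⟨J⟩ := b.nonempty_doubling
  have hα : 0 < Real.tan α := Real.tan_pos_of_pos_of_lt_pi_div_two hα₀ hα₁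
  obtain ⟨D, hD⟩ := CouplingData.exists_skew hα b
  -- The same `R`, `U`, `A` serve both families; only the corner `K₀` is dropped for the second.
  exact ⟨D.exists_family_sqrt_domain_ne J hα hD,
    D.decoupled.exists_family_sqrt_domain_eq J hα rfl⟩
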